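/- Let $n,p,d\ge 1$ be integers, $a\in\mathbb R$, let $X$ be a real $n\times p$ matrix with rows $x_1^T,\dots,x_n^T$ and $y$ a real $n\times d$ matrix with rows $y_1^T,\dots,y_n^T$. Assume that the $n\times(p+d)$ matrix $(X:y)$ has rank $p+d$ and that $n>p+2d-2a$. Let $\mathcal S_d\subset\mathbb R^{d(d+1)/2}$ be the set of positive definite $d\times d$ matrices, with Lebesgue measure $d\Sigma$, and let $\mathsf X=\mathbb R^{p\times d}\times\mathcal S_d$. Let $h$ be a mixing density, that is, a probability density on $(0,\infty)$, satisfying condition $\mathcal M$: $\int_0^\infty u^{d/2}h(u)\,du<\infty$. For $(\beta,\Sigma)\in\mathsf X$ put $r_i=(\beta^Tx_i-y_i)^T\Sigma^{-1}(\beta^Tx_i-y_i)$, let $$f(y|\beta,\Sigma)=\prod_{i=1}^n\int_0^\infty\frac{u^{d/2}}{(2\pi)^{d/2}|\Sigma|^{1/2}}\,e^{-u r_i/2}\,h(u)\,du ,\qquad m(y)=\int_{\mathcal S_d}\int_{\mathbb R^{p\times d}}f(y|\beta,\Sigma)\,|\Sigma|^{-a}\,d\beta\,d\Sigma ,$$ and,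 when $m(y)<\infty$ (in which case the posterior is called proper), let $\pi^*(\beta,\Sigma|y)=f(y|\beta,\Sigma)|\Sigma|^{-a}/m(y)$ be the posterior density. The data augmentation (DA) Markov chain on $\mathsf X$ moves from $(\tilde\beta,\tilde\Sigma)$ to $(\beta,\Sigma)$ as follows. (1) Draw $z_1,\dots,z_n$ independently, $z_i$ having density on $(0,\infty)$ proportional to $u^{d/2}e^{-\tilde r_iu/2}h(u)$, where $\tilde r_i$ is $r_i$ evaluated at $(\tilde\beta,\tilde\Sigma)$. With $Q=\mathrm{diag}(z_1^{-1},\dots,z_n^{-1})$, $\Omega=(X^TQ^{-1}X)^{-1}$ and $\mu=\Omega X^TQ^{-1}y$: (2) draw $\Sigma\sim \mathrm{IW}_d\big(n-p+2a-d-1,(y^TQ^{-1}y-\mu^T\Omega^{-1}\mu)^{-1}\big)$; (3) draw $\beta\sim \mathrm N_{p,d}(\mu,\Omega,\Sigma)$. Here $\mathrm{IW}_d(m,\Theta)$ is the inverse Wishart distribution, with density proportional to $|w|^{-(m+d+1)/2}\exp\{-\frac12\mathrm{tr}(\Theta^{-1}w^{-1})\}$ on $\mathcal S_d$, and $\mathrm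 N_{p,d}(\theta,A,B)$ is the matrix normal distribution on $\mathbb R^{p\times d}$, with density proportional to $\exp[-\frac12\mathrm{tr}\{A^{-1}(w-\theta)B^{-1}(w-\theta)^T\}]$. Let $k^m(\cdot\,|\,\tilde\beta,\tilde\Sigma)$ be the $m$-step transition density of this chain with respect to $d\beta\,d\Sigma$. Assume that one of the following holds: 1. $h$ is zero near the origin: there is $\delta>0$ with $h(u)=0$ for all $u\in(0,\delta)$; 2. $h$ is faster than polynomial near the origin: $h$ is strictly positive on some interval $(0,\delta)$ with $\delta>0$, and for every $c>0$ there is $\eta_c>0$ such that $h(u)/u^c$ is strictly increasing on $(0,\eta_c)$; 3. $h$ is polynomial near the origin with some power $c>\frac{n-p+2a-d-1}{2}$: $h$ is strictly positive on some interval $(0,\delta)$ with $\delta>0$, $c>-1$, and $\lim_{u\downarrow0}h(u)/u^c$ exists and lies in $(0,\infty)$. Then the posterior is proper, i.e. $m(y)<\infty$, and the DA Markov chain is geometrically ergodic: there are $M:\mathsf X\to[0,\infty)$ and $\rho\in[0,1)$ such that for all integers $m\ge1$ and all $(\tilde\beta,\tilde\Sigma)\in\mathsf X$, $$\int_{\mathcal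 S_d}\int_{\mathbb R^{p\times d}}\big|k^m(\beta,\Sigma|\tilde\beta,\tilde\Sigma)-\pi^*(\beta,\Sigma|y)\big|\,d\beta\,d\Sigma\le M(\tilde\beta,\tilde\Sigma)\,\rho^m .$$ -/

import Mathlib

open MeasureTheory Filter Topology Set
open scoped ENNReal NNReal Matrix

noncomputable section

namespace BayesReg

/-! ### Mixing densities -/

/-- `h` is a mixing density, i.e. a probability density on `(0, ∞)`
(values of `h` outside `(0, ∞)` play no role). -/
structure IsMixingDensity (h : ℝ → ℝ) : Prop where
  measurable : Measurable h
  nonneg : ∀ u : ℝ, 0 < u → 0 ≤ h u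
  total : ∫⁻ u in Ioi (0 : ℝ), ENNReal.ofReal (h u) = 1

/-- Condition `M`: `∫₀^∞ u^(d/2) h(u) du < ∞`. -/
def ConditionM (d : ℕ) (h : ℝ → ℝ) : Prop :=
  ∫⁻ u in Ioi (0 : ℝ), ENNReal.ofReal (u ^ ((d : ℝ) / 2) * h u) < ∞

/-- `h` vanishes on some interval `(0, δ)`. -/
def ZeroNearOrigin (h : ℝ → ℝ) : Prop :=
  ∃ δ : ℝ, 0 < δ ∧ ∀ u ∈ Ioo 0 δ, h u = 0

/-- `h` is strictly positive on some interval `(0, δ)`. -/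
def PositiveNearOrigin (h : ℝ → ℝ) : Prop :=
  ∃ δ : ℝ, 0 < δ ∧ ∀ u ∈ Ioo 0 δ, 0 < h u

/-- `h` is polynomial near the origin with power `c > -1`:
`h(u) / u^c` has a limit in `(0, ∞)` as `u ↓ 0`. -/
def PolynomialNearOrigin (h : ℝ → ℝ) (c : ℝ) : Prop :=
  PositiveNearOrigin h ∧ -1 < c ∧
    ∃ l : ℝ, 0 < l ∧ Tendsto (fun u : ℝ => h u / u ^ c) (𝓝[>] 0) (𝓝 l)

/-- `h` is faster than polynomial near the origin: for every `c > 0`, the ratio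
`h(u) / u^c` is strictly increasing on some interval `(0, η)`. -/
def FasterThanPolynomialNearOrigin (h : ℝ → ℝ) : Prop :=
  PositiveNearOrigin h ∧
    ∀ c : ℝ, 0 < c → ∃ η : ℝ, 0 < η ∧ StrictMonoOn (fun u : ℝ => h u / u ^ c) (Ioo 0 η)

/-! ### The state space and its reference measure -/

/-- The entrywise (Borel) σ-algebra on real matrices. -/
instance instMeasurableSpaceMatrix (r s : ℕ) : MeasurableSpace (Matrix (Fin r) (Fin s) ℝ) :=
  inferInstanceAs (MeasurableSpace (Fin r → Fin s → ℝ))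

/-- Lebesgue measure on `r × s` real matrices. -/
def matrixVolume (r s : ℕ) : Measure (Matrix (Fin r) (Fin s) ℝ) :=
  Measure.map (fun f : Fin r → Fin s → ℝ => Matrix.of f) volume

/-- The symmetric `d × d` matrix with prescribed entries on and above the diagonal. -/
def symOfUpper (d : ℕ) (t : {ij : Fin d × Fin d // ij.1 ≤ ij.2} → ℝ) :
    Matrix (Fin d) (Fin d) ℝ :=
  Matrix.of fun i j => t ⟨(min i j, max i j), min_le_max⟩

/-- Lebesgue measure `dΣ` on symmetric `d × d` matrices, identified with `ℝ^(d(d+1)/2)` through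
the entries on and above the diagonal. -/
def symVolume (d : ℕ) : Measure (Matrix (Fin d) (Fin d) ℝ) :=
  Measure.map (symOfUpper d) volume

/-- The measure `dΣ` on the cone of positive definite `d × d` matrices. -/
def posDefVolume (d : ℕ) : Measure (Matrix (Fin d) (Fin d) ℝ) :=
  (symVolume d).restrict {S | S.PosDef}

/-- Pairs `(β, Σ)`. The state space of the chain is the set of pairs with `Σ` positive
definite, see `stateSpace`. -/
abbrev State (p d : ℕ) : Type :=
  Matrix (Fin p) (Fin d) ℝ × Matrix (Fin d) (Fin d) ℝ

/-- The state space: all `(β, Σ)` with `Σ` positive definite. -/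
def stateSpace (p d : ℕ) : Set (State p d) := {θ | θ.2.PosDef}

/-- The measure `dβ dΣ` on the state space. -/
def stateVolume (p d : ℕ) : Measure (State p d) :=
  (matrixVolume p d).prod (posDefVolume d)

/-- Lebesgue measure `dz` on `(0, ∞)^n`. -/
def latentVolume (n : ℕ) : Measure (Fin n → ℝ) :=
  volume.restrict {z | ∀ i, 0 < z i}

/-! ### Model, prior and posterior -/

/-- `r_i = (βᵀ x_i - y_i)ᵀ Σ⁻¹ (βᵀ x_i - y_i)`, with `x_i`, `y_i` the rows of `X`, `y`. -/
def residualForm {n p d : ℕ} (X : Matrix (Fin n) (Fin p) ℝ) (y : Matrix (Fin n) (Fin d) ℝ)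
    (θ : State p d) (i : Fin n) : ℝ :=
  (θ.1ᵀ *ᵥ X i - y i) ⬝ᵥ (θ.2⁻¹ *ᵥ (θ.1ᵀ *ᵥ X i - y i))

/-- The joint density `f(y | β, Σ)` of the data. -/
def likelihood {n p d : ℕ} (h : ℝ → ℝ) (X : Matrix (Fin n) (Fin p) ℝ)
    (y : Matrix (Fin n) (Fin d) ℝ) (θ : State p d) : ℝ≥0∞ :=
  ∏ i : Fin n, ∫⁻ u in Ioi (0 : ℝ), ENNReal.ofReal
    (u ^ ((d : ℝ) / 2) / ((2 * Real.pi) ^ ((d : ℝ) / 2) * θ.2.det ^ ((1 : ℝ) / 2)) *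
      Real.exp (-(u / 2) * residualForm X y θ i) * h u)

/-- The (improper) prior density `ω(β, Σ) = |Σ|^(-a)` on the state space. -/
def prior {p d : ℕ} (a : ℝ) (θ : State p d) : ℝ≥0∞ :=
  ENNReal.ofReal (θ.2.det ^ (-a))

/-- `m(y) = ∫∫ f(y | β, Σ) ω(β, Σ) dβ dΣ`. -/
def marginal {n p d : ℕ} (a : ℝ) (h : ℝ → ℝ) (X : Matrix (Fin n) (Fin p) ℝ)
    (y : Matrix (Fin n) (Fin d) ℝ) : ℝ≥0∞ :=
  ∫⁻ θ, likelihood h X y θ * prior a θ ∂(stateVolume p d)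

/-- The posterior distribution is proper. -/
def PosteriorProper {n p d : ℕ} (a : ℝ) (h : ℝ → ℝ) (X : Matrix (Fin n) (Fin p) ℝ)
    (y : Matrix (Fin n) (Fin d) ℝ) : Prop :=
  marginal a h X y < ∞

/-- The posterior density `π*(β, Σ | y) = f(y | β, Σ) ω(β, Σ) / m(y)`. -/
def posterior {n p d : ℕ} (a : ℝ) (h : ℝ → ℝ) (X : Matrix (Fin n) (Fin p) ℝ)
    (y : Matrix (Fin n) (Fin d) ℝ) (θ : State p d) : ℝ≥0∞ :=
  likelihood h X y θ * prior a θ / marginal a h X y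

/-! ### The densities used by the data augmentation algorithm -/

/-- The density `ψ(u; s) = b(s) u^(d/2) e^(-su/2) h(u)` on `(0, ∞)`, where `b(s)` is the
normalizing constant. -/
def psi (d : ℕ) (h : ℝ → ℝ) (s u : ℝ) : ℝ≥0∞ :=
  (∫⁻ v in Ioi (0 : ℝ), ENNReal.ofReal (v ^ ((d : ℝ) / 2) * Real.exp (-(s * v / 2)) * h v))⁻¹ *
    ENNReal.ofReal (u ^ ((d : ℝ) / 2) * Real.exp (-(s * u / 2)) * h u)

/-- The density at `w` of the matrix normal distribution `N_{r,c}(θ, A, B)`. -/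
def matrixNormalDensity {r c : ℕ} (θ : Matrix (Fin r) (Fin c) ℝ) (A : Matrix (Fin r) (Fin r) ℝ)
    (B : Matrix (Fin c) (Fin c) ℝ) (w : Matrix (Fin r) (Fin c) ℝ) : ℝ :=
  Real.exp (-(1 / 2) * (A⁻¹ * (w - θ) * B⁻¹ * (w - θ)ᵀ).trace) /
    ((2 * Real.pi) ^ ((r : ℝ) * c / 2) * A.det ^ ((c : ℝ) / 2) * B.det ^ ((r : ℝ) / 2))

/-- The density at `w` (positive definite) of the inverse Wishart distribution `IW_r(m, Θ)`,
with respect to Lebesgue measure on positive definite matrices. -/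
def invWishartDensity {r : ℕ} (m : ℝ) (Θ : Matrix (Fin r) (Fin r) ℝ)
    (w : Matrix (Fin r) (Fin r) ℝ) : ℝ :=
  w.det ^ (-((m + r + 1) / 2)) * Real.exp (-(1 / 2) * (Θ⁻¹ * w⁻¹).trace) /
    (2 ^ (m * r / 2) * Real.pi ^ ((r : ℝ) * ((r : ℝ) - 1) / 4) * Θ.det ^ (m / 2) *
      ∏ i ∈ Finset.Icc 1 r, Real.Gamma ((m + 1 - (i : ℝ)) / 2))

/-- The diagonal matrix `Q` with diagonal entries `1 / z_i`. -/
def Qmat {n : ℕ} (z : Fin n → ℝ) : Matrix (Fin n) (Fin n) ℝ :=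
  Matrix.diagonal fun i => (z i)⁻¹

/-- `Ω = (Xᵀ Q⁻¹ X)⁻¹`. -/
def OmegaMat {n p : ℕ} (X : Matrix (Fin n) (Fin p) ℝ) (z : Fin n → ℝ) :
    Matrix (Fin p) (Fin p) ℝ :=
  (Xᵀ * (Qmat z)⁻¹ * X)⁻¹

/-- `μ = (Xᵀ Q⁻¹ X)⁻¹ Xᵀ Q⁻¹ y`. -/
def muMat {n p d : ℕ} (X : Matrix (Fin n) (Fin p) ℝ) (y : Matrix (Fin n) (Fin d) ℝ)
    (z : Fin n → ℝ) : Matrix (Fin p) (Fin d) ℝ :=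
  (Xᵀ * (Qmat z)⁻¹ * X)⁻¹ * Xᵀ * (Qmat z)⁻¹ * y

/-- Step 1: the density at `z` of `z_1, …, z_n` independent with `z_i ∼ ψ(·; r_i)`. -/
def latentDensity {n p d : ℕ} (h : ℝ → ℝ) (X : Matrix (Fin n) (Fin p) ℝ)
    (y : Matrix (Fin n) (Fin d) ℝ) (θ : State p d) (z : Fin n → ℝ) : ℝ≥0∞ :=
  ∏ i : Fin n, psi d h (residualForm X y θ i) (z i)

/-- Steps 2 and 3: the density at `(β, Σ)` of a draw
`Σ ∼ IW_d(n - p + 2a - d - 1, (yᵀ Q⁻¹ y - μᵀ Ω⁻¹ μ)⁻¹)` followed by `β ∼ N_{p,d}(μ, Ω, Σ)`. -/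
def paramDensity {n p d : ℕ} (a : ℝ) (X : Matrix (Fin n) (Fin p) ℝ)
    (y : Matrix (Fin n) (Fin d) ℝ) (z : Fin n → ℝ) (θ : State p d) : ℝ≥0∞ :=
  ENNReal.ofReal (matrixNormalDensity (muMat X y z) (OmegaMat X z) θ.2 θ.1) *
    ENNReal.ofReal (invWishartDensity ((n : ℝ) - p + 2 * a - d - 1)
      (yᵀ * (Qmat z)⁻¹ * y - (muMat X y z)ᵀ * (OmegaMat X z)⁻¹ * muMat X y z)⁻¹ θ.2)

/-! ### The data augmentation Markov chain -/

/-- `daStep a h X y θ₀ θ` is the Markov transition density `k(θ | θ₀)` of the DA chain, with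
respect to `dβ dΣ`. -/
def daStep {n p d : ℕ} (a : ℝ) (h : ℝ → ℝ) (X : Matrix (Fin n) (Fin p) ℝ)
    (y : Matrix (Fin n) (Fin d) ℝ) (θ₀ θ : State p d) : ℝ≥0∞ :=
  ∫⁻ z, paramDensity a X y z θ * latentDensity h X y θ₀ z ∂(latentVolume n)

/-- `daIter a h X y j θ₀ θ` is the `(j + 1)`-step transition density `k^(j+1)(θ | θ₀)`. -/
def daIter {n p d : ℕ} (a : ℝ) (h : ℝ → ℝ) (X : Matrix (Fin n) (Fin p) ℝ)
    (y : Matrix (Fin n) (Fin d) ℝ) : ℕ → State p d → State p d → ℝ≥0∞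
  | 0, θ₀, θ => daStep a h X y θ₀ θ
  | j + 1, θ₀, θ => ∫⁻ θ', daIter a h X y j θ' θ * daStep a h X y θ₀ θ' ∂(stateVolume p d)

/-- The `L¹` distance `∫ |f - g| dβ dΣ` of two densities on the state space; with truncated
subtraction, `|f - g| = (f - g) + (g - f)`. -/
def l1Dist {p d : ℕ} (f g : State p d → ℝ≥0∞) : ℝ≥0∞ :=
  ∫⁻ θ, ((f θ - g θ) + (g θ - f θ)) ∂(stateVolume p d)

/-- Geometric ergodicity of the DA chain: there are `M : stateSpace → [0, ∞)` and `ρ ∈ [0, 1)`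
with `∫ |k^m(θ | θ₀) - π*(θ | y)| dθ ≤ M(θ₀) ρ^m` for all `m ≥ 1` and all states `θ₀`. -/
def GeometricallyErgodic {n p d : ℕ} (a : ℝ) (h : ℝ → ℝ) (X : Matrix (Fin n) (Fin p) ℝ)
    (y : Matrix (Fin n) (Fin d) ℝ) : Prop :=
  ∃ (M : State p d → ℝ≥0) (ρ : ℝ≥0), ρ < 1 ∧
    ∀ j : ℕ, ∀ θ₀ ∈ stateSpace p d,
      l1Dist (daIter a h X y j θ₀) (posterior a h X y) ≤ ((M θ₀ * ρ ^ (j + 1) : ℝ≥0) : ℝ≥0∞)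

end BayesReg

end

/-!
The chain is handled by Harris' theorem with the drift function `V(β, Σ) = ∑ rᵢ`
(`residualSum`), and properness of the posterior is a consequence of the same drift condition.

*Drift.* Given `z`, the parameters have a density proportional to
`|Σ|^(-(n + 2a)/2) exp(-½ ∑ zᵢ rᵢ)` (`paramKernel`). Its normalizing constant is, up to a constant,
`|G|^(-d/2) |S|^(-m/2)`, where `m = n - p + 2a - d - 1`, `G = Xᵀ Q⁻¹ X` and
`S = yᵀ Q⁻¹ y - μᵀ Ω⁻¹ μ` is the Schur complement of `G` in the weighted Gram matrix of `(X : y)`.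
Replacing `zᵢ` by `(1 - t) zᵢ` lowers `|G|` and `|G| |S|` at most by the factor `1 - t`, since a
Gram determinant is affine in each weight. Hence the Laplace transform of `zᵢ rᵢ / 2` given `z`,
a ratio of normalizing constants, is at most `(1 - t)^(-(m + d)/2)` at `t`, and letting `t ↓ 0`,
the mean of `rᵢ` is at most `K / zᵢ` for any `K > m + d`
(`lintegral_residualForm_mul_paramDensity_le`, `exists_laplace_parameter`).
It remains to see that the mean of `1 / zᵢ` under `ψ(·; s)` is at most `b s + L` with
`(m + d) b < 1` (`exists_psiInvMoment_le_of_origin`). If `h` vanishes near the origin, `b = 0` does.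
Otherwise `h` is near the origin, up to a factor as close to `1` as desired, `u^c` times a
nondecreasing function `q` with `c > m / 2`. With `κ = d/2 + c`, the derivative of `u^κ e^(-su/2)`
changes sign once, from positive to negative, so that integrating it against `q` instead of a
constant gives at most a multiple of the boundary term; this bounds the mean of `1 / zᵢ` by
`s / (d + 2c)` plus a constant (`lintegral_rpow_sub_one_mul_exp_le`), and `d + 2c > m + d`.

*Minorization.* For `V ≤ R`, the density of `z` dominates a multiple of the product of
`u^(d/2) e^(-Ru/2) h(u)`, uniformly in the current state (`exists_minorant`).

*Invariance.* The unnormalized posterior density `f` is reversible for the chain, because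
`f(θ)` times the density of `z` given `θ` is a function of `z` times `paramKernel`
(`likelihood_mul_prior_mul_daStep`). On `V ≤ R`, `f` is at most a multiple of `paramKernel` at
`z = (1, …, 1)`, so its integral there is finite. By the drift condition the chain is eventually in
a large sublevel set with probability at least `1/2`, from any starting point; Fatou's lemma and
invariance then bound the total mass of `f` by twice its mass on that set
(`DriftMinorization.lintegral_lt_top_of_invariant`).

*Harris' theorem* (`DriftMinorization.exists_geometric_bound`) is proved by contracting the
oscillation of functions weighted by `2 + β (V(x) + V(y))`.

That the conditional densities of the sampler integrate to `1` is also proved here: for the matrix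
normal distribution by vectorization, and for the inverse Wishart distribution by induction on the
dimension, integrating out the first row and column (`lintegral_inverse_wishart_corner`).
-/

noncomputable section

namespace BayesReg

/-! ### Iterates of a transition density under a drift condition -/

section Harris

/-- A function whose oscillation is bounded by `w x + w y` is within `w x` of a constant. -/
lemma exists_center {α : Type*} {S : Set α} {φ w : α → ℝ}
    (h : ∀ x ∈ S, ∀ y ∈ S, |φ x - φ y| ≤ w x + w y) :
    ∃ c : ℝ, ∀ x ∈ S, |φ x - c| ≤ w x := by
  rcases S.eq_empty_or_nonempty with rfl | ⟨x₀, hx₀⟩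
  · exact ⟨0, by simp⟩
  have key : ∀ x ∈ S, ∀ y ∈ S, φ x - w x ≤ φ y + w y := fun x hx y hy => by
    have := abs_le.1 (h x hx y hy); linarith [this.2]
  refine ⟨sSup ((fun x => φ x - w x) '' S), fun y hy => ?_⟩
  have hb : BddAbove ((fun x => φ x - w x) '' S) :=
    ⟨φ x₀ + w x₀, by rintro _ ⟨x, hx, rfl⟩; exact key x hx x₀ hx₀⟩
  have h1 : φ y - w y ≤ sSup ((fun x => φ x - w x) '' S) := le_csSup hb ⟨y, hy, rfl⟩
  have h2 : sSup ((fun x => φ x - w x) '' S) ≤ φ y + w y :=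
    csSup_le ⟨_, x₀, hx₀, rfl⟩ (by rintro _ ⟨x, hx, rfl⟩; exact key x hx y hy)
  rw [abs_le]; constructor <;> linarith

variable {α : Type*} [MeasurableSpace α]

lemma abs_integral_sub_integral_le {P ν : Measure α} [IsFiniteMeasure P] [IsFiniteMeasure ν]
    (hν : ν ≤ P) {f w : α → ℝ} (hf : AEStronglyMeasurable f P) (hw : Integrable w P)
    (hfw : ∀ᵐ x ∂P, |f x| ≤ w x) :
    |∫ x, f x ∂P - ∫ x, f x ∂ν| ≤ ∫ x, w x ∂P - ∫ x, w x ∂ν := by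
  have hfi : Integrable f P := hw.mono' hf hfw
  have hdec : P - ν + ν = P := Measure.sub_add_cancel_of_le hν
  have hle : P - ν ≤ P := Measure.sub_le
  have hsplit : ∀ g : α → ℝ, Integrable g P →
      ∫ x, g x ∂P - ∫ x, g x ∂ν = ∫ x, g x ∂(P - ν) := fun g hg => by
    have := integral_add_measure (f := g) (hg.mono_measure hle) (hg.mono_measure hν)
    rw [hdec] at this
    linarith
  rw [hsplit f hfi, hsplit w hw]
  have hfw' : ∀ᵐ x ∂(P - ν), ‖f x‖ ≤ w x :=
    (Measure.absolutelyContinuous_of_le hle).ae_le hfw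
  have := norm_integral_le_of_norm_le (hw.mono_measure hle) hfw'
  rwa [Real.norm_eq_abs] at this

/-- One step of the Harris contraction: two probability measures dominating a common measure `ν`
contract the weighted oscillation of `φ`. -/
lemma abs_integral_sub_integral_le_of_common_part {P Q ν : Measure α} [IsProbabilityMeasure P]
    [IsProbabilityMeasure Q] (hP : ν ≤ P) (hQ : ν ≤ Q)
    {S : Set α} (hPS : ∀ᵐ x ∂P, x ∈ S) (hQS : ∀ᵐ x ∂Q, x ∈ S) {φ : α → ℝ} (hφ : Measurable φ)
    {V : α → ℝ≥0} (hVP : Integrable (fun x => (V x : ℝ)) P)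
    (hVQ : Integrable (fun x => (V x : ℝ)) Q) {K β : ℝ} (hK : 0 ≤ K) (hβ : 0 ≤ β)
    (h : ∀ x ∈ S, ∀ y ∈ S, |φ x - φ y| ≤ K * (2 + β * (V x + V y))) :
    |∫ x, φ x ∂P - ∫ x, φ x ∂Q| ≤
      K * (2 * (1 - ν.real univ) + β * (∫ x, (V x : ℝ) ∂P + ∫ x, (V x : ℝ) ∂Q)) := by
  have hνfin : IsFiniteMeasure ν := isFiniteMeasure_of_le P hP
  obtain ⟨c, hc⟩ := exists_center (S := S) (φ := φ) (w := fun x => K * (1 + β * V x))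
    (fun x hx y hy => (h x hx y hy).trans_eq (by ring))
  have hm : Measurable fun x => φ x - c := hφ.sub_const c
  have main : ∀ (T : Measure α) [IsProbabilityMeasure T], ν ≤ T → (∀ᵐ x ∂T, x ∈ S) →
      Integrable (fun x => (V x : ℝ)) T →
      |∫ x, (φ x - c) ∂T - ∫ x, (φ x - c) ∂ν| ≤
        K * ((1 - ν.real univ) + β * ∫ x, (V x : ℝ) ∂T) ∧
      ∫ x, φ x ∂T = ∫ x, (φ x - c) ∂T + c := by
    intro T _ hR hRS hV
    have hw : Integrable (fun x => K * (1 + β * (V x : ℝ))) T :=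
      ((integrable_const (1 : ℝ)).add (hV.const_mul β)).const_mul K
    have hfw : ∀ᵐ x ∂T, |φ x - c| ≤ K * (1 + β * (V x : ℝ)) := hRS.mono fun x hx => hc x hx
    have h1 := abs_integral_sub_integral_le hR hm.aestronglyMeasurable hw hfw
    have h2 : ∫ x, K * (1 + β * (V x : ℝ)) ∂T = K * (1 + β * ∫ x, (V x : ℝ) ∂T) := by
      rw [integral_const_mul, integral_add (integrable_const _) (hV.const_mul β),
        integral_const_mul]
      simp
    have h3 : K * ν.real univ ≤ ∫ x, K * (1 + β * (V x : ℝ)) ∂ν := by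
      rw [integral_const_mul, integral_add (integrable_const _)
        ((hV.mono_measure hR).const_mul β), integral_const_mul]
      have : 0 ≤ ∫ x, (V x : ℝ) ∂ν := integral_nonneg fun x => (V x).2
      simp only [integral_const, smul_eq_mul, mul_one]
      gcongr
      nlinarith [mul_nonneg hβ this]
    refine ⟨by nlinarith, ?_⟩
    have hint : Integrable (fun x => φ x - c) T := hw.mono' hm.aestronglyMeasurable hfw
    have := integral_add hint (integrable_const (μ := T) c)
    simpa using this
  obtain ⟨a1, a2⟩ := main P hP hPS hVP
  obtain ⟨b1, b2⟩ := main Q hQ hQS hVQ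
  rw [a2, b2]
  rw [abs_le] at a1 b1 ⊢
  constructor <;> nlinarith [a1.1, a1.2, b1.1, b1.2]

/-- The densities of the iterates of the Markov chain with transition density `k` with respect to
`μ`; `iterDensity μ k j` is the density after `j + 1` steps. -/
def iterDensity (μ : Measure α) (k : α → α → ℝ≥0∞) : ℕ → α → α → ℝ≥0∞
  | 0, x, θ => k x θ
  | j + 1, x, θ => ∫⁻ θ', iterDensity μ k j θ' θ * k x θ' ∂μ

/-- A drift condition and a minorization condition for the transition density `k` with respect to
`μ`, on a set `S` of full measure. The function `V` drifts with rate `r` and constant `L`. -/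
structure DriftMinorization (μ : Measure α) (S : Set α) (k : α → α → ℝ≥0∞) (V : α → ℝ≥0)
    (r L : ℝ≥0) : Prop where
  measurable_density : Measurable (Function.uncurry k)
  measurable_drift : Measurable V
  ae_mem : ∀ᵐ x ∂μ, x ∈ S
  mass : ∀ x ∈ S, ∫⁻ θ, k x θ ∂μ = 1
  rate_lt_one : r < 1
  drift : ∀ x ∈ S, ∫⁻ θ, V θ * k x θ ∂μ ≤ r * V x + L
  minorization : ∀ R : ℝ≥0, ∃ q : α → ℝ≥0∞, Measurable q ∧ 0 < ∫⁻ θ, q θ ∂μ ∧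
    ∀ x ∈ S, V x ≤ R → ∀ θ ∈ S, q θ ≤ k x θ

namespace DriftMinorization

variable {μ : Measure α} {S : Set α} {k : α → α → ℝ≥0∞} {V : α → ℝ≥0} {r L : ℝ≥0}

lemma measurable_coe_drift (H : DriftMinorization μ S k V r L) : Measurable fun x => (V x : ℝ≥0∞) :=
  H.measurable_drift.coe_nnreal_ennreal

lemma measurable_density_right (H : DriftMinorization μ S k V r L) (x : α) : Measurable (k x) :=
  H.measurable_density.comp (measurable_const.prodMk measurable_id)

variable [SFinite μ]

lemma measurable_iterDensity (hk : Measurable (Function.uncurry k)) (j : ℕ) :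
    Measurable (Function.uncurry (iterDensity μ k j)) := by
  induction j with
  | zero => exact hk
  | succ j ih =>
    have : Measurable fun q : (α × α) × α =>
        iterDensity μ k j q.2 q.1.2 * k q.1.1 q.2 :=
      (ih.comp (measurable_snd.prodMk measurable_fst.snd)).mul
        (hk.comp (measurable_fst.fst.prodMk measurable_snd))
    exact this.lintegral_prod_right'

lemma lintegral_iterDensity_succ (hk : Measurable (Function.uncurry k)) {φ : α → ℝ≥0∞}
    (hφ : Measurable φ) (j : ℕ) (x : α) :
    ∫⁻ θ, φ θ * iterDensity μ k (j + 1) x θ ∂μ =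
      ∫⁻ θ', (∫⁻ θ, φ θ * iterDensity μ k j θ' θ ∂μ) * k x θ' ∂μ := by
  have hi := measurable_iterDensity (μ := μ) hk j
  have hkx : Measurable (k x) := hk.comp (measurable_const.prodMk measurable_id)
  calc ∫⁻ θ, φ θ * iterDensity μ k (j + 1) x θ ∂μ
      = ∫⁻ θ, ∫⁻ θ', φ θ * (iterDensity μ k j θ' θ * k x θ') ∂μ ∂μ := by
        refine lintegral_congr fun θ => ?_
        rw [iterDensity, lintegral_const_mul]
        exact (hi.comp (measurable_id.prodMk measurable_const)).mul hkx
    _ = ∫⁻ θ', ∫⁻ θ, φ θ * (iterDensity μ k j θ' θ * k x θ') ∂μ ∂μ := by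
        apply lintegral_lintegral_swap
        exact ((hφ.comp measurable_fst).mul
          ((hi.comp (measurable_snd.prodMk measurable_fst)).mul
            (hkx.comp measurable_snd))).aemeasurable
    _ = _ := by
        refine lintegral_congr fun θ' => ?_
        rw [← lintegral_mul_const]
        · simp only [mul_assoc]
        · exact hφ.mul (hi.comp (measurable_const.prodMk measurable_id))

lemma measurable_lintegral_iterDensity (hk : Measurable (Function.uncurry k)) {φ : α → ℝ≥0∞}
    (hφ : Measurable φ) (j : ℕ) :
    Measurable fun x => ∫⁻ θ, φ θ * iterDensity μ k j x θ ∂μ := by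
  have : Measurable fun q : α × α => φ q.2 * iterDensity μ k j q.1 q.2 :=
    (hφ.comp measurable_snd).mul (measurable_iterDensity hk j)
  exact this.lintegral_prod_right'

variable (H : DriftMinorization μ S k V r L)
include H

lemma lintegral_iterDensity (j : ℕ) {x : α} (hx : x ∈ S) :
    ∫⁻ θ, iterDensity μ k j x θ ∂μ = 1 := by
  induction j generalizing x with
  | zero => exact H.mass x hx
  | succ j ih =>
    have h1 := lintegral_iterDensity_succ (μ := μ) H.measurable_density
      (measurable_const (a := (1 : ℝ≥0∞))) j x
    simp only [one_mul] at h1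
    rw [h1, ← H.mass x hx]
    refine lintegral_congr_ae (H.ae_mem.mono fun θ' hθ' => ?_)
    simp only [ih hθ', one_mul]

lemma lintegral_drift_iterDensity_le_sum (j : ℕ) {x : α} (hx : x ∈ S) :
    ∫⁻ θ, V θ * iterDensity μ k j x θ ∂μ ≤
      (r : ℝ≥0∞) ^ (j + 1) * V x + L * ∑ i ∈ Finset.range (j + 1), (r : ℝ≥0∞) ^ i := by
  induction j generalizing x with
  | zero => simpa [iterDensity] using H.drift x hx
  | succ j ih =>
    rw [lintegral_iterDensity_succ H.measurable_density H.measurable_coe_drift]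
    have hV := H.measurable_coe_drift
    have hkx := H.measurable_density_right x
    set C : ℝ≥0∞ := L * ∑ i ∈ Finset.range (j + 1), (r : ℝ≥0∞) ^ i with hC
    calc ∫⁻ θ', (∫⁻ θ, V θ * iterDensity μ k j θ' θ ∂μ) * k x θ' ∂μ
        ≤ ∫⁻ θ', ((r : ℝ≥0∞) ^ (j + 1) * (V θ' * k x θ') + C * k x θ') ∂μ := by
          refine lintegral_mono_ae (H.ae_mem.mono fun θ' hθ' => ?_)
          calc _ ≤ ((r : ℝ≥0∞) ^ (j + 1) * V θ' + C) * k x θ' := by gcongr; exact ih hθ'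
            _ = _ := by ring
      _ = (r : ℝ≥0∞) ^ (j + 1) * ∫⁻ θ', V θ' * k x θ' ∂μ + C := by
          rw [lintegral_add_right _ (hkx.const_mul C), lintegral_const_mul _ (by fun_prop),
            lintegral_const_mul _ hkx, H.mass x hx, mul_one]
      _ ≤ (r : ℝ≥0∞) ^ (j + 1) * (r * V x + L) + C := by gcongr; exact H.drift x hx
      _ = _ := by rw [hC, Finset.sum_range_succ _ (j + 1)]; ring

lemma lintegral_drift_iterDensity_le (j : ℕ) {x : α} (hx : x ∈ S) :
    ∫⁻ θ, V θ * iterDensity μ k j x θ ∂μ ≤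
      (r : ℝ≥0∞) ^ (j + 1) * V x + ((L / (1 - r) : ℝ≥0) : ℝ≥0∞) := by
  refine (H.lintegral_drift_iterDensity_le_sum j hx).trans ?_
  gcongr
  rw [ENNReal.coe_div (tsub_pos_of_lt H.rate_lt_one).ne', div_eq_mul_inv]
  gcongr
  calc _ ≤ ∑' i, (r : ℝ≥0∞) ^ i := ENNReal.sum_le_tsum _
    _ = _ := by rw [ENNReal.tsum_geometric]; simp

/-- A density that is invariant under one step is invariant under all iterates. -/
lemma lintegral_mul_lintegral_iterDensity {f : α → ℝ≥0∞} (hf : Measurable f)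
    (hinv : ∀ θ ∈ S, ∫⁻ x, f x * k x θ ∂μ = f θ) {φ : α → ℝ≥0∞} (hφ : Measurable φ) (j : ℕ) :
    ∫⁻ x, f x * ∫⁻ θ, φ θ * iterDensity μ k j x θ ∂μ ∂μ = ∫⁻ x, f x * φ x ∂μ := by
  have one : ∀ ψ : α → ℝ≥0∞, Measurable ψ →
      ∫⁻ x, f x * ∫⁻ θ, ψ θ * k x θ ∂μ ∂μ = ∫⁻ x, f x * ψ x ∂μ := by
    intro ψ hψ
    calc ∫⁻ x, f x * ∫⁻ θ, ψ θ * k x θ ∂μ ∂μ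
        = ∫⁻ x, ∫⁻ θ, f x * (ψ θ * k x θ) ∂μ ∂μ := by
          refine lintegral_congr fun x => ?_
          have hkx := H.measurable_density_right x
          rw [lintegral_const_mul _ (by fun_prop)]
      _ = ∫⁻ θ, ∫⁻ x, f x * (ψ θ * k x θ) ∂μ ∂μ := by
          apply lintegral_lintegral_swap
          exact ((hf.comp measurable_fst).mul ((hψ.comp measurable_snd).mul
            H.measurable_density)).aemeasurable
      _ = _ := by
          refine lintegral_congr_ae (H.ae_mem.mono fun θ hθ => ?_)
          simp only
          rw [← hinv θ hθ, ← lintegral_mul_const]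
          · exact lintegral_congr fun x => by ring
          · exact hf.mul (H.measurable_density.comp (measurable_id.prodMk measurable_const))
  induction j with
  | zero => exact one φ hφ
  | succ j ih =>
    rw [← ih, ← one _ (measurable_lintegral_iterDensity H.measurable_density hφ j)]
    refine lintegral_congr fun x => ?_
    rw [lintegral_iterDensity_succ H.measurable_density hφ]

end DriftMinorization
end Harris

/-! ### Geometric ergodicity from drift and minorization -/

section HarrisErgodic

variable {α : Type*} [MeasurableSpace α]

/-- The `L¹` distance of two probability densities is at most twice the largest difference of the
probabilities of an event. -/
lemma lintegral_sub_add_sub_le {μ : Measure α} {F G : α → ℝ≥0∞} (hF : Measurable F)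
    (hG : Measurable G) (hF1 : ∫⁻ x, F x ∂μ = 1) (hG1 : ∫⁻ x, G x ∂μ = 1) {B : ℝ}
    (hB : ∀ A : Set α, MeasurableSet A →
      |(∫⁻ x in A, F x ∂μ).toReal - (∫⁻ x in A, G x ∂μ).toReal| ≤ B) :
    ∫⁻ x, ((F x - G x) + (G x - F x)) ∂μ ≤ ENNReal.ofReal (2 * B) := by
  have half : ∀ F G : α → ℝ≥0∞, Measurable F → Measurable G → ∫⁻ x, F x ∂μ = 1 →
      ∫⁻ x, G x ∂μ = 1 → (∀ A : Set α, MeasurableSet A →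
      |(∫⁻ x in A, F x ∂μ).toReal - (∫⁻ x in A, G x ∂μ).toReal| ≤ B) →
      ∫⁻ x, (F x - G x) ∂μ ≤ ENNReal.ofReal B := by
    intro F G hF hG hF1 hG1 hB
    have hA : MeasurableSet {x | G x < F x} := measurableSet_lt hG hF
    have hfinF : ∫⁻ x in {x | G x < F x}, F x ∂μ ≠ ∞ :=
      ((setLIntegral_le_lintegral _ _).trans_lt (hF1 ▸ ENNReal.one_lt_top)).ne
    have hfin : ∫⁻ x in {x | G x < F x}, G x ∂μ ≠ ∞ :=
      ((setLIntegral_le_lintegral _ _).trans_lt (hG1 ▸ ENNReal.one_lt_top)).ne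
    have h1 : ∫⁻ x, (F x - G x) ∂μ = ∫⁻ x in {x | G x < F x}, (F x - G x) ∂μ := by
      rw [← lintegral_indicator hA]
      refine lintegral_congr fun x => ?_
      by_cases hx : G x < F x
      · simp [hx]
      · simp [hx, tsub_eq_zero_of_le (not_lt.1 hx)]
    rw [h1, lintegral_sub hG hfin ((ae_restrict_mem hA).mono fun x hx => le_of_lt hx),
      ← ENNReal.ofReal_toReal hfinF, ← ENNReal.ofReal_toReal hfin,
      ← ENNReal.ofReal_sub _ ENNReal.toReal_nonneg]
    exact ENNReal.ofReal_le_ofReal ((le_abs_self _).trans (hB _ hA))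
  rw [lintegral_add_left (f := fun x => F x - G x) (hF.sub hG), two_mul]
  have hB0 : 0 ≤ B := (abs_nonneg _).trans (hB ∅ MeasurableSet.empty)
  rw [ENNReal.ofReal_add hB0 hB0]
  exact add_le_add (half F G hF hG hF1 hG1 hB)
    (half G F hG hF hG1 hF1 fun A hA => by rw [abs_sub_comm]; exact hB A hA)

namespace DriftMinorization

variable {μ : Measure α} [SFinite μ] {S : Set α} {k : α → α → ℝ≥0∞} {V : α → ℝ≥0} {r L : ℝ≥0}
variable (H : DriftMinorization μ S k V r L)
include H

/-- By the drift condition the chain spends, in the long run, half of its time in a sublevel set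
of `V`; hence an invariant density that is integrable on the sublevel sets is integrable. -/
lemma lintegral_lt_top_of_invariant {f : α → ℝ≥0∞} (hf : Measurable f)
    (hinv : ∀ θ ∈ S, ∫⁻ x, f x * k x θ ∂μ = f θ)
    (hfin : ∀ R : ℝ≥0, ∫⁻ x in {x | V x ≤ R}, f x ∂μ < ∞) : ∫⁻ x, f x ∂μ < ∞ := by
  set C : ℝ≥0 := L / (1 - r) with hC
  -- the mean of `V` after many steps is at most `1 + C`, so Markov's inequality at `R` gives `1/2`
  set R : ℝ≥0 := 2 * (1 + C) with hR
  have hAm : MeasurableSet {x | V x ≤ R} := H.measurable_drift measurableSet_Iic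
  set φ : α → ℝ≥0∞ := {x | V x ≤ R}.indicator 1 with hφ
  have hφm : Measurable φ := measurable_one.indicator hAm
  have hlow : ∀ x ∈ S, ∀ᶠ j : ℕ in atTop,
      (2⁻¹ : ℝ≥0∞) ≤ ∫⁻ θ, φ θ * iterDensity μ k j x θ ∂μ := by
    intro x hx
    have hlim : Tendsto (fun j : ℕ => (r : ℝ≥0∞) ^ (j + 1) * V x) atTop (𝓝 0) := by
      have := (tendsto_pow_atTop_nhds_zero_of_lt_one zero_le H.rate_lt_one).comp
        (tendsto_add_atTop_nat 1)
      have h2 := (ENNReal.tendsto_coe.2 (this.mul_const (V x)))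
      simpa using h2
    have hev : ∀ᶠ j : ℕ in atTop, (r : ℝ≥0∞) ^ (j + 1) * V x ≤ 1 :=
      (hlim.eventually_lt_const one_pos).mono fun _ h => h.le
    refine hev.mono fun j hj => ?_
    have him : Measurable (iterDensity μ k j x) :=
      (measurable_iterDensity H.measurable_density j).comp
        (measurable_const.prodMk measurable_id)
    have hVm := H.measurable_coe_drift
    have hpt : ∀ θ, 1 ≤ φ θ + (R⁻¹ : ℝ≥0) * V θ := by
      intro θ
      by_cases hθ : V θ ≤ R
      · simp [hφ, hθ]
      · have hR0 : 0 < R := by positivity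
        refine le_add_left ?_
        rw [← ENNReal.coe_mul]
        norm_cast
        rw [← inv_mul_cancel₀ hR0.ne']
        gcongr
        exact (not_le.1 hθ).le
    have h1 : (1 : ℝ≥0∞) ≤ ∫⁻ θ, φ θ * iterDensity μ k j x θ ∂μ + 2⁻¹ := by
      calc (1 : ℝ≥0∞) = ∫⁻ θ, iterDensity μ k j x θ ∂μ := (H.lintegral_iterDensity j hx).symm
        _ ≤ ∫⁻ θ, (φ θ * iterDensity μ k j x θ +
              (R⁻¹ : ℝ≥0) * (V θ * iterDensity μ k j x θ)) ∂μ := by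
            refine lintegral_mono fun θ => ?_
            calc _ = 1 * iterDensity μ k j x θ := (one_mul _).symm
              _ ≤ (φ θ + (R⁻¹ : ℝ≥0) * V θ) * iterDensity μ k j x θ := by
                gcongr; exact hpt θ
              _ = _ := by ring
        _ = ∫⁻ θ, φ θ * iterDensity μ k j x θ ∂μ +
              (R⁻¹ : ℝ≥0) * ∫⁻ θ, V θ * iterDensity μ k j x θ ∂μ := by
            rw [lintegral_add_left (by fun_prop), lintegral_const_mul _ (by fun_prop)]
        _ ≤ ∫⁻ θ, φ θ * iterDensity μ k j x θ ∂μ + (R⁻¹ : ℝ≥0) * (1 + C) := by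
            gcongr
            exact (H.lintegral_drift_iterDensity_le j hx).trans (by gcongr)
        _ = _ := by
            congr 1
            have : R⁻¹ * (1 + C) = 2⁻¹ := by rw [hR]; field_simp
            rw [← ENNReal.coe_one, ← ENNReal.coe_add, ← ENNReal.coe_mul, this]
            simp
    rw [← ENNReal.one_sub_inv_two]
    exact tsub_le_iff_right.2 h1
  have hint : ∫⁻ x, f x * 2⁻¹ ∂μ ≤ ∫⁻ x in {x | V x ≤ R}, f x ∂μ := by
    calc ∫⁻ x, f x * 2⁻¹ ∂μ
        ≤ ∫⁻ x, liminf (fun j => f x * ∫⁻ θ, φ θ * iterDensity μ k j x θ ∂μ) atTop ∂μ := by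
          refine lintegral_mono_ae (H.ae_mem.mono fun x hx => ?_)
          exact le_liminf_of_le (by isBoundedDefault)
            ((hlow x hx).mono fun j hj => mul_le_mul_right hj (f x))
      _ ≤ liminf (fun j => ∫⁻ x, f x * ∫⁻ θ, φ θ * iterDensity μ k j x θ ∂μ ∂μ) atTop :=
          lintegral_liminf_le fun j =>
            hf.mul (measurable_lintegral_iterDensity H.measurable_density hφm j)
      _ = ∫⁻ x, f x * φ x ∂μ := by
          simp only [H.lintegral_mul_lintegral_iterDensity hf hinv hφm, liminf_const]
      _ = _ := by
          rw [← lintegral_indicator hAm]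
          refine lintegral_congr fun x => ?_
          by_cases hx : V x ≤ R <;> simp [hφ, hx]
  rw [lintegral_mul_const _ hf] at hint
  by_contra htop
  rw [not_lt, top_le_iff] at htop
  rw [htop, ENNReal.top_mul (by simp)] at hint
  exact (hfin R).not_ge hint

/-- The drift function is integrable against an invariant density: its truncations have mean at most
`L / (1 - r)`, by invariance under many steps and dominated convergence. -/
lemma lintegral_mul_drift_lt_top {f : α → ℝ≥0∞} (hf : Measurable f)
    (hinv : ∀ θ ∈ S, ∫⁻ x, f x * k x θ ∂μ = f θ) (hfin : ∫⁻ x, f x ∂μ < ∞) :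
    ∫⁻ x, f x * V x ∂μ < ∞ := by
  set C : ℝ≥0 := L / (1 - r) with hC
  have hVm := H.measurable_coe_drift
  have key : ∀ N : ℕ, ∫⁻ x, f x * min (V x : ℝ≥0∞) N ∂μ ≤ (∫⁻ x, f x ∂μ) * C := by
    intro N
    have hφm : Measurable fun x => min (V x : ℝ≥0∞) N := by fun_prop
    have hstep : ∀ j : ℕ, ∫⁻ x, f x * min (V x : ℝ≥0∞) N ∂μ ≤
        ∫⁻ x, f x * min ((r : ℝ≥0∞) ^ (j + 1) * V x + C) N ∂μ := by
      intro j
      rw [← H.lintegral_mul_lintegral_iterDensity hf hinv hφm j]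
      refine lintegral_mono_ae (H.ae_mem.mono fun x hx => ?_)
      have him : Measurable (iterDensity μ k j x) :=
        (measurable_iterDensity H.measurable_density j).comp
          (measurable_const.prodMk measurable_id)
      refine mul_le_mul_right (le_min ?_ ?_) _
      · refine le_trans (lintegral_mono fun θ => ?_) (H.lintegral_drift_iterDensity_le j hx)
        exact mul_le_mul_left (min_le_left _ _) _
      · calc _ ≤ ∫⁻ θ, N * iterDensity μ k j x θ ∂μ :=
              lintegral_mono fun θ => mul_le_mul_left (min_le_right _ _) _
          _ = N := by rw [lintegral_const_mul _ him, H.lintegral_iterDensity j hx, mul_one]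
    have hlim : Tendsto (fun j : ℕ => ∫⁻ x, f x * min ((r : ℝ≥0∞) ^ (j + 1) * V x + C) N ∂μ)
        atTop (𝓝 (∫⁻ x, f x * min (C : ℝ≥0∞) N ∂μ)) := by
      refine tendsto_lintegral_of_dominated_convergence (fun x => f x * N)
        (fun j => by fun_prop) (fun j => ae_of_all _ fun x => ?_) ?_ ?_
      · exact mul_le_mul_right (min_le_right _ _) _
      · rw [lintegral_mul_const _ hf]
        exact (ENNReal.mul_lt_top hfin (ENNReal.natCast_lt_top N)).ne
      · have hfae : ∀ᵐ x ∂μ, f x < ∞ := ae_lt_top hf hfin.ne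
        refine hfae.mono fun x hx => ENNReal.Tendsto.const_mul ?_ (Or.inr hx.ne)
        refine Tendsto.min ?_ tendsto_const_nhds
        have := (tendsto_pow_atTop_nhds_zero_of_lt_one zero_le H.rate_lt_one).comp
          (tendsto_add_atTop_nat 1)
        have h2 := (ENNReal.tendsto_coe.2 ((this.mul_const (V x)).add_const C))
        simpa using h2
    calc _ ≤ ∫⁻ x, f x * min (C : ℝ≥0∞) N ∂μ := ge_of_tendsto' hlim hstep
      _ ≤ ∫⁻ x, f x * C ∂μ := lintegral_mono fun x => mul_le_mul_right (min_le_left _ _) _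
      _ = _ := lintegral_mul_const _ hf
  have hsup : ∫⁻ x, f x * V x ∂μ = ⨆ N : ℕ, ∫⁻ x, f x * min (V x : ℝ≥0∞) N ∂μ := by
    rw [← lintegral_iSup (fun N => by fun_prop)]
    · refine lintegral_congr fun x => ?_
      rw [← ENNReal.mul_iSup]
      congr 1
      refine le_antisymm ?_ (iSup_le fun N => min_le_left _ _)
      obtain ⟨N, hN⟩ := exists_nat_ge (V x)
      refine le_iSup_of_le N (le_min le_rfl ?_)
      exact_mod_cast hN
    · intro a b hab x
      refine mul_le_mul_right (min_le_min_left _ ?_) _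
      exact_mod_cast hab
  rw [hsup]
  exact (iSup_le key).trans_lt (ENNReal.mul_lt_top hfin ENNReal.coe_lt_top)

omit [SFinite μ] in
lemma isProbabilityMeasure_withDensity {x : α} (hx : x ∈ S) :
    IsProbabilityMeasure (μ.withDensity (k x)) :=
  ⟨by rw [withDensity_apply _ MeasurableSet.univ, Measure.restrict_univ, H.mass x hx]⟩

omit [SFinite μ] in
lemma lintegral_drift_withDensity_le {x : α} (hx : x ∈ S) :
    ∫⁻ θ, V θ ∂(μ.withDensity (k x)) ≤ r * V x + L := by
  rw [lintegral_withDensity_eq_lintegral_mul _ (H.measurable_density_right x)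
    H.measurable_coe_drift]
  refine le_trans (le_of_eq (lintegral_congr fun θ => ?_)) (H.drift x hx)
  simp [mul_comm]

omit [SFinite μ] in
lemma integrable_drift {x : α} (hx : x ∈ S) :
    Integrable (fun θ => (V θ : ℝ)) (μ.withDensity (k x)) := by
  refine ⟨H.measurable_drift.coe_nnreal_real.aestronglyMeasurable, ?_⟩
  rw [hasFiniteIntegral_iff_enorm]
  refine lt_of_le_of_lt (le_of_eq (lintegral_congr fun θ => ?_))
    ((H.lintegral_drift_withDensity_le hx).trans_lt (by finiteness))
  simp [enorm_eq_nnnorm]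

omit [SFinite μ] in
lemma integral_drift_le {x : α} (hx : x ∈ S) :
    ∫ θ, (V θ : ℝ) ∂(μ.withDensity (k x)) ≤ r * V x + L := by
  rw [integral_eq_lintegral_of_nonneg_ae (f := fun θ => (V θ : ℝ)) (ae_of_all _ fun θ => (V θ).2)
    H.measurable_drift.coe_nnreal_real.aestronglyMeasurable]
  have h1 := H.lintegral_drift_withDensity_le hx
  have h2 : ∫⁻ θ, ENNReal.ofReal (V θ : ℝ) ∂(μ.withDensity (k x)) =
      ∫⁻ θ, V θ ∂(μ.withDensity (k x)) := lintegral_congr fun θ => by simp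
  rw [h2]
  refine (ENNReal.toReal_mono (by finiteness) h1).trans_eq ?_
  rw [ENNReal.toReal_add (by finiteness) (by finiteness)]
  simp

omit [SFinite μ] in
/-- The one-step contraction of the weighted oscillation, following Hairer and Mattingly. -/
lemma exists_contraction : ∃ (β : ℝ) (ρ : ℝ≥0), 0 < β ∧ ρ < 1 ∧
    ∀ (φ : α → ℝ) (K : ℝ), Measurable φ → 0 ≤ K →
      (∀ x ∈ S, ∀ y ∈ S, |φ x - φ y| ≤ K * (2 + β * (V x + V y))) →
      ∀ x ∈ S, ∀ y ∈ S,
        |∫ θ, φ θ ∂(μ.withDensity (k x)) - ∫ θ, φ θ ∂(μ.withDensity (k y))| ≤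
          ρ * K * (2 + β * (V x + V y)) := by
  have hr1 : (r : ℝ) < 1 := by exact_mod_cast H.rate_lt_one
  have hr0 : (0 : ℝ) ≤ r := r.2
  have hL0 : (0 : ℝ) ≤ L := L.2
  -- with this `R`, `r v + 2 L ≤ (1 + r) / 2 * v - 2` for `v ≥ R`
  set R : ℝ≥0 := 4 * (L + 1) / (1 - r) with hR
  have hRr : (1 - (r : ℝ)) * R = 4 * (L + 1) := by
    rw [hR, NNReal.coe_div, NNReal.coe_sub H.rate_lt_one.le]
    push_cast
    field_simp [(sub_pos.2 hr1).ne']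
  obtain ⟨ν, ε, hε0, hε1, hν⟩ : ∃ (ν : Measure α) (ε : ℝ), 0 < ε ∧ ε ≤ 1 ∧
      ∀ x ∈ S, V x ≤ R → ν ≤ μ.withDensity (k x) ∧ ν.real univ = ε := by
    obtain ⟨q, hq, hqpos, hqk⟩ := H.minorization R
    by_cases hne : ∃ x₀ ∈ S, V x₀ ≤ R
    swap
    · push Not at hne
      exact ⟨0, 1, one_pos, le_rfl, fun x hx hVx => absurd hVx (hne x hx).not_ge⟩
    obtain ⟨x₀, hx₀, hVx₀⟩ := hne
    have hν : ∀ x ∈ S, V x ≤ R → μ.withDensity q ≤ μ.withDensity (k x) := fun x hx hVx =>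
      withDensity_mono (H.ae_mem.mono fun θ hθ => hqk x hx hVx θ hθ)
    have hP₀ := H.isProbabilityMeasure_withDensity hx₀
    have hfinq : IsFiniteMeasure (μ.withDensity q) := isFiniteMeasure_of_le _ (hν x₀ hx₀ hVx₀)
    refine ⟨μ.withDensity q, (μ.withDensity q).real univ, ?_, ?_,
      fun x hx hVx => ⟨hν x hx hVx, rfl⟩⟩
    · rw [measureReal_def, ENNReal.toReal_pos_iff]
      refine ⟨?_, measure_lt_top _ _⟩
      rwa [withDensity_apply _ MeasurableSet.univ, Measure.restrict_univ]
    · have : (μ.withDensity q) univ ≤ 1 := by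
        rw [← measure_univ (μ := μ.withDensity (k x₀))]
        exact hν x₀ hx₀ hVx₀ _
      exact ENNReal.toReal_le_of_le_ofReal zero_le_one (by simpa using this)
  -- the weight `β` is so small that the constant `L` of the drift costs less than the gain `ε`
  set β : ℝ := ε / (2 * (L + 1)) with hβ
  have hβ0 : 0 < β := by positivity
  have hβL : 2 * (β * (L + 1)) = ε := by rw [hβ]; field_simp
  have hβε : β ≤ ε / 2 := by nlinarith
  set ρ : ℝ := max ((1 + r) / 2) (1 - β) with hρ
  have hρ1 : ρ < 1 := max_lt (by linarith) (by linarith)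
  have hργ : (1 + (r : ℝ)) / 2 ≤ ρ := le_max_left _ _
  have hρβ : 1 - β ≤ ρ := le_max_right _ _
  have hρ0 : 0 ≤ ρ := le_trans (by positivity) hργ
  refine ⟨β, ⟨ρ, hρ0⟩, hβ0, by exact_mod_cast hρ1, fun φ K hφ hK hosc x hx y hy => ?_⟩
  have hPx := H.isProbabilityMeasure_withDensity hx
  have hPy := H.isProbabilityMeasure_withDensity hy
  have haeS : ∀ z, ∀ᵐ θ ∂(μ.withDensity (k z)), θ ∈ S := fun z =>
    (withDensity_absolutelyContinuous μ (k z)).ae_le H.ae_mem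
  have hVx := H.integral_drift_le hx
  have hVy := H.integral_drift_le hy
  have hx0 : (0 : ℝ) ≤ V x := (V x).2
  have hy0 : (0 : ℝ) ≤ V y := (V y).2
  have hstep : ∀ κ : Measure α, κ ≤ μ.withDensity (k x) → κ ≤ μ.withDensity (k y) →
      2 * (1 - κ.real univ) + β * ((r * V x + L) + (r * V y + L)) ≤
        ρ * (2 + β * (V x + V y)) →
      |∫ θ, φ θ ∂(μ.withDensity (k x)) - ∫ θ, φ θ ∂(μ.withDensity (k y))| ≤
          ρ * K * (2 + β * (V x + V y)) := by
    intro κ h1 h2 h3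
    refine (abs_integral_sub_integral_le_of_common_part h1 h2 (haeS x) (haeS y) hφ
      (H.integrable_drift hx) (H.integrable_drift hy) hK hβ0.le hosc).trans ?_
    calc _ ≤ K * (2 * (1 - κ.real univ) + β * ((r * V x + L) + (r * V y + L))) := by gcongr
      _ ≤ K * (ρ * (2 + β * (V x + V y))) := by gcongr
      _ = _ := by ring
  by_cases hnear : V x ≤ R ∧ V y ≤ R
  · -- both states in the sublevel set: the common part `ν` gains a factor `1 - ε`
    obtain ⟨hνx, hνε⟩ := hν x hx hnear.1
    obtain ⟨hνy, -⟩ := hν y hy hnear.2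
    refine hstep ν hνx hνy ?_
    rw [hνε]
    have hr' : (r : ℝ) ≤ ρ := by linarith
    have h1 : r * (β * (V x + V y)) ≤ ρ * (β * (V x + V y)) := by gcongr
    nlinarith
  · -- one state is far out: the drift condition alone contracts
    refine hstep 0 (Measure.zero_le _) (Measure.zero_le _) ?_
    have hfar : (R : ℝ) ≤ V x + V y := by
      rw [not_and_or, not_le, not_le] at hnear
      rcases hnear with h | h
      · have : (R : ℝ) < V x := by exact_mod_cast h
        linarith
      · have : (R : ℝ) < V y := by exact_mod_cast h
        linarith
    have h1 : 4 * ((L : ℝ) + 1) ≤ (1 - r) * (V x + V y) := by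
      rw [← hRr]; exact mul_le_mul_of_nonneg_left hfar (by linarith)
    have h2 : β * (r * (V x + V y) + 2 * L) ≤
        β * ((1 + r) / 2 * (V x + V y) - 2) := by gcongr; nlinarith
    have h3 : (1 + (r : ℝ)) / 2 * (β * (V x + V y)) ≤ ρ * (β * (V x + V y)) := by gcongr
    simp only [measureReal_zero, Pi.zero_apply]
    nlinarith

/-- The weighted oscillation of the `j + 1` step transition probabilities decays geometrically. -/
lemma exists_geometric_oscillation : ∃ (β : ℝ) (ρ : ℝ≥0), 0 < β ∧ ρ < 1 ∧
    ∀ A : Set α, MeasurableSet A → ∀ j : ℕ, ∀ x ∈ S, ∀ y ∈ S,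
      |(∫⁻ θ in A, iterDensity μ k j x θ ∂μ).toReal -
        (∫⁻ θ in A, iterDensity μ k j y θ ∂μ).toReal| ≤
          (ρ : ℝ) ^ (j + 1) * (2 + β * (V x + V y)) := by
  obtain ⟨β, ρ, hβ, hρ, hcon⟩ := H.exists_contraction
  refine ⟨β, ρ, hβ, hρ, fun A hA j => ?_⟩
  set φ : α → ℝ≥0∞ := A.indicator 1 with hφ
  have hφm : Measurable φ := measurable_one.indicator hA
  have hset : ∀ j x, ∫⁻ θ in A, iterDensity μ k j x θ ∂μ =
      ∫⁻ θ, φ θ * iterDensity μ k j x θ ∂μ := by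
    intro j x
    rw [← lintegral_indicator hA]
    refine lintegral_congr fun θ => ?_
    by_cases hθ : θ ∈ A <;> simp [hφ, hθ]
  have htoReal : ∀ ψ : α → ℝ≥0∞, Measurable ψ → (∀ θ ∈ S, ψ θ ≤ 1) → ∀ x ∈ S,
      (∫⁻ θ, ψ θ * k x θ ∂μ).toReal = ∫ θ, (ψ θ).toReal ∂(μ.withDensity (k x)) := by
    intro ψ hψ hψ1 x hx
    rw [integral_toReal hψ.aemeasurable, lintegral_withDensity_eq_lintegral_mul _
      (H.measurable_density_right x) hψ]
    · congr 1
      exact lintegral_congr fun θ => by simp [mul_comm]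
    · exact (withDensity_absolutelyContinuous μ (k x)).ae_le
        (H.ae_mem.mono fun θ hθ => (hψ1 θ hθ).trans_lt ENNReal.one_lt_top)
  simp only [hset]
  have hle1 : ∀ j, ∀ x ∈ S, ∫⁻ θ, φ θ * iterDensity μ k j x θ ∂μ ≤ 1 := by
    intro j x hx
    rw [← hset, ← H.lintegral_iterDensity j hx]
    exact setLIntegral_le_lintegral _ _
  have hφ1 : ∀ θ, φ θ ≤ 1 := fun θ => by by_cases hθ : θ ∈ A <;> simp [hφ, hθ]
  induction j with
  | zero =>
    intro x hx y hy
    simp only [iterDensity]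
    rw [htoReal φ hφm (fun θ _ => hφ1 θ) x hx, htoReal φ hφm (fun θ _ => hφ1 θ) y hy]
    refine (hcon _ 1 hφm.ennreal_toReal zero_le_one (fun a ha b hb => ?_) x hx y hy).trans_eq
      (by ring)
    have h1 : ∀ θ, 0 ≤ (φ θ).toReal ∧ (φ θ).toReal ≤ 1 := fun θ =>
      ⟨ENNReal.toReal_nonneg, ENNReal.toReal_mono ENNReal.one_ne_top (hφ1 θ)⟩
    have ha0 : (0 : ℝ) ≤ V a := (V a).2
    have hb0 : (0 : ℝ) ≤ V b := (V b).2
    have h2 : 0 ≤ β * ((V a : ℝ) + V b) := by positivity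
    rw [abs_le]
    constructor <;> linarith [(h1 a).1, (h1 a).2, (h1 b).1, (h1 b).2]
  | succ j ih =>
    intro x hx y hy
    have hm := measurable_lintegral_iterDensity (μ := μ) H.measurable_density hφm j
    simp only [lintegral_iterDensity_succ H.measurable_density hφm]
    rw [htoReal _ hm (hle1 j) x hx, htoReal _ hm (hle1 j) y hy]
    refine (hcon _ ((ρ : ℝ) ^ (j + 1)) hm.ennreal_toReal (by positivity) ih x hx y hy).trans_eq ?_
    ring

/-- **Harris' theorem** for transition densities: a drift condition and a minorization condition
on the sublevel sets of `V` give geometric convergence to the invariant density in `L¹`. -/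
theorem exists_geometric_bound {g : α → ℝ≥0∞} (hg : Measurable g)
    (hinv : ∀ θ ∈ S, ∫⁻ x, g x * k x θ ∂μ = g θ) (hg1 : ∫⁻ x, g x ∂μ = 1) :
    ∃ (M : α → ℝ≥0) (ρ : ℝ≥0), ρ < 1 ∧ ∀ j : ℕ, ∀ x ∈ S,
      ∫⁻ θ, ((iterDensity μ k j x θ - g θ) + (g θ - iterDensity μ k j x θ)) ∂μ ≤
        ((M x * ρ ^ (j + 1) : ℝ≥0) : ℝ≥0∞) := by
  obtain ⟨β, ρ, hβ, hρ, hosc⟩ := H.exists_geometric_oscillation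
  have hVg := H.lintegral_mul_drift_lt_top hg hinv (hg1 ▸ ENNReal.one_lt_top)
  set P := μ.withDensity g with hP
  have hPprob : IsProbabilityMeasure P :=
    ⟨by rw [withDensity_apply _ MeasurableSet.univ, Measure.restrict_univ, hg1]⟩
  have hVint : Integrable (fun θ => (V θ : ℝ)) P := by
    refine ⟨H.measurable_drift.coe_nnreal_real.aestronglyMeasurable, ?_⟩
    rw [hasFiniteIntegral_iff_enorm, lintegral_withDensity_eq_lintegral_mul _ hg
      H.measurable_drift.coe_nnreal_real.enorm]
    refine lt_of_le_of_lt (le_of_eq (lintegral_congr fun θ => ?_)) hVg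
    simp [enorm_eq_nnnorm]
  set W : ℝ := ∫ θ, (V θ : ℝ) ∂P with hW
  have hW0 : 0 ≤ W := integral_nonneg fun θ => (V θ).2
  refine ⟨fun x => Real.toNNReal (2 * (2 + β * (V x + W))), ρ, hρ, fun j x hx => ?_⟩
  have him : Measurable (iterDensity μ k j x) :=
    (measurable_iterDensity H.measurable_density j).comp (measurable_const.prodMk measurable_id)
  refine (lintegral_sub_add_sub_le him hg (H.lintegral_iterDensity j hx) hg1
    (B := (ρ : ℝ) ^ (j + 1) * (2 + β * (V x + W))) fun A hA => ?_).trans ?_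
  · set ψ : α → ℝ≥0∞ := fun y => ∫⁻ θ in A, iterDensity μ k j y θ ∂μ with hψ
    have hset : ∀ y, ψ y = ∫⁻ θ, (A.indicator 1 θ) * iterDensity μ k j y θ ∂μ := by
      intro y
      simp only [hψ]
      rw [← lintegral_indicator hA]
      refine lintegral_congr fun θ => ?_
      by_cases hθ : θ ∈ A <;> simp [hθ]
    have h1m : Measurable (A.indicator (1 : α → ℝ≥0∞)) := measurable_one.indicator hA
    have hψm : Measurable ψ := by
      simp only [funext hset]
      exact measurable_lintegral_iterDensity H.measurable_density h1m j
    have hψ1 : ∀ y ∈ S, ψ y ≤ 1 := fun y hy => by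
      rw [← H.lintegral_iterDensity j hy]; exact setLIntegral_le_lintegral _ _
    have hPS : ∀ᵐ y ∂P, y ∈ S := (withDensity_absolutelyContinuous μ g).ae_le H.ae_mem
    have hgA : (∫⁻ θ in A, g θ ∂μ).toReal = ∫ y, (ψ y).toReal ∂P := by
      rw [integral_toReal hψm.aemeasurable
        (hPS.mono fun y hy => (hψ1 y hy).trans_lt ENNReal.one_lt_top),
        lintegral_withDensity_eq_lintegral_mul _ hg hψm]
      congr 1
      have := H.lintegral_mul_lintegral_iterDensity hg hinv h1m j
      simp only [Pi.mul_apply, hset, this]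
      rw [← lintegral_indicator hA]
      refine lintegral_congr fun θ => ?_
      by_cases hθ : θ ∈ A <;> simp [hθ]
    have hψint : Integrable (fun y => (ψ y).toReal) P :=
      Integrable.of_bound hψm.ennreal_toReal.aestronglyMeasurable 1 (hPS.mono fun y hy => by
        rw [Real.norm_of_nonneg ENNReal.toReal_nonneg]
        exact ENNReal.toReal_mono ENNReal.one_ne_top (hψ1 y hy))
    have hconst : (ψ x).toReal = ∫ _, (ψ x).toReal ∂P := by simp
    rw [hgA]
    change |(ψ x).toReal - _| ≤ _
    rw [hconst, ← integral_sub (integrable_const _) hψint]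
    have hbint : Integrable (fun y => (ρ : ℝ) ^ (j + 1) * (2 + β * (V x + V y))) P :=
      ((integrable_const (2 : ℝ)).add
        (((integrable_const (V x : ℝ)).add hVint).const_mul β)).const_mul _
    have := norm_integral_le_of_norm_le hbint
      (f := fun y => (ψ x).toReal - (ψ y).toReal) (hPS.mono fun y hy => hosc A hA j x hx y hy)
    refine this.trans_eq ?_
    have hVx : Integrable (fun y => (V x : ℝ) + V y) P := (integrable_const _).add hVint
    rw [integral_const_mul, integral_add (integrable_const _) (hVx.const_mul β),
      integral_const_mul, integral_add (integrable_const _) hVint]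
    simp [hW]
  · rw [ENNReal.ofReal_le_iff_le_toReal ENNReal.coe_ne_top, ENNReal.coe_toReal]
    rw [NNReal.coe_mul, NNReal.coe_pow, Real.coe_toNNReal _ (by positivity)]
    exact le_of_eq (by ring)

end DriftMinorization
end HarrisErgodic

/-! ### Gaussian integrals -/

lemma lintegral_pi_prod {n : ℕ} (μ : Fin n → Measure ℝ) [∀ i, SigmaFinite (μ i)]
    (f : Fin n → ℝ → ℝ≥0∞) (hf : ∀ i, Measurable (f i)) :
    ∫⁻ x, ∏ i, f i (x i) ∂(Measure.pi μ) = ∏ i, ∫⁻ t, f i t ∂(μ i) := by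
  induction n with
  | zero => simp
  | succ n ih =>
    have e := (measurePreserving_piFinSuccAbove μ 0).symm
    rw [← e.lintegral_comp (by fun_prop), lintegral_prod _ (by fun_prop)]
    simp only [Fin.prod_univ_succ, MeasurableEquiv.piFinSuccAbove_symm_apply, Fin.insertNthEquiv,
      Equiv.coe_fn_mk, Fin.insertNth_zero, Fin.cons_zero, Fin.cons_succ]
    rw [← ih (fun i => μ i.succ) (fun i => f i.succ) (fun i => hf i.succ),
      ← lintegral_mul_const _ (hf 0)]
    refine lintegral_congr fun t => ?_
    rw [← lintegral_const_mul _ (by fun_prop)]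
    rfl

lemma lintegral_exp_neg_half_sq :
    ∫⁻ t : ℝ, ENNReal.ofReal (Real.exp (-(1 / 2) * t ^ 2)) = ENNReal.ofReal √(2 * Real.pi) := by
  rw [← ofReal_integral_eq_lintegral_ofReal (integrable_exp_neg_mul_sq (by norm_num))
    (ae_of_all _ fun t => (Real.exp_pos _).le), integral_gaussian]
  congr 2
  ring

lemma lintegral_exp_neg_half_sum_sq (ι : Type*) [Fintype ι] :
    ∫⁻ x : ι → ℝ, ENNReal.ofReal (Real.exp (-(1 / 2) * ∑ i, x i ^ 2)) =
      ENNReal.ofReal ((2 * Real.pi) ^ ((Fintype.card ι : ℝ) / 2)) := by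
  have e := volume_measurePreserving_piCongrLeft (fun _ : ι => ℝ) (Fintype.equivFin ι).symm
  rw [← e.lintegral_comp (by fun_prop)]
  have h1 : ∀ x : Fin (Fintype.card ι) → ℝ,
      ENNReal.ofReal (Real.exp (-(1 / 2) * ∑ i, (MeasurableEquiv.piCongrLeft (fun _ : ι => ℝ)
        (Fintype.equivFin ι).symm x i) ^ 2)) =
      ∏ i, ENNReal.ofReal (Real.exp (-(1 / 2) * x i ^ 2)) := by
    intro x
    rw [← ENNReal.ofReal_prod_of_nonneg fun _ _ => (Real.exp_pos _).le, ← Real.exp_sum,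
      ← Finset.mul_sum, ← (Fintype.equivFin ι).symm.sum_comp]
    simp [MeasurableEquiv.coe_piCongrLeft]
  simp only [h1]
  rw [volume_pi, lintegral_pi_prod _ (fun _ t => ENNReal.ofReal (Real.exp (-(1 / 2) * t ^ 2)))
    (fun _ => by fun_prop)]
  simp only [lintegral_exp_neg_half_sq]
  rw [Finset.prod_const, ← ENNReal.ofReal_pow (Real.sqrt_nonneg _), Finset.card_univ,
    Fintype.card_fin, Real.sqrt_eq_rpow, ← Real.rpow_natCast, ← Real.rpow_mul (by positivity)]
  congr 2
  ring

open scoped MatrixOrder in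
lemma exists_transpose_mul_self {ι : Type*} [Fintype ι] [DecidableEq ι] {M : Matrix ι ι ℝ}
    (hM : M.PosDef) : ∃ C : Matrix ι ι ℝ, M = Cᵀ * C := by
  obtain ⟨C, hC⟩ := CStarAlgebra.nonneg_iff_eq_star_mul_self.mp
    (Matrix.nonneg_iff_posSemidef.2 hM.posSemidef)
  refine ⟨C, ?_⟩
  rw [hC, Matrix.star_eq_conjTranspose, Matrix.conjTranspose_eq_transpose_of_trivial]

/-- The Gaussian integral `∫ exp(-xᵀ M x / 2) dx = (2π)^(k/2) |M|^(-1/2)`. -/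
lemma lintegral_exp_neg_half_quadratic {ι : Type*} [Fintype ι] [DecidableEq ι] {M : Matrix ι ι ℝ}
    (hM : M.PosDef) :
    ∫⁻ x : ι → ℝ, ENNReal.ofReal (Real.exp (-(1 / 2) * (x ⬝ᵥ (M *ᵥ x)))) =
      ENNReal.ofReal ((2 * Real.pi) ^ ((Fintype.card ι : ℝ) / 2) * M.det ^ (-(1 / 2) : ℝ)) := by
  obtain ⟨C, rfl⟩ := exists_transpose_mul_self hM
  have hdet : 0 < C.det ^ 2 := by
    have := hM.det_pos
    rwa [Matrix.det_mul, Matrix.det_transpose, ← sq] at this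
  have hC : C.det ≠ 0 := by rintro h; simp [h] at hdet
  have h1 : ∀ x : ι → ℝ, x ⬝ᵥ ((Cᵀ * C) *ᵥ x) = ∑ i, (Matrix.toLin' C x) i ^ 2 := by
    intro x
    rw [← Matrix.mulVec_mulVec, Matrix.dotProduct_mulVec, Matrix.vecMul_transpose]
    simp [dotProduct, sq]
  simp only [h1]
  have hmeas : Measurable (Matrix.toLin' C) :=
    (Matrix.toLin' C).continuous_of_finiteDimensional.measurable
  have hg : Measurable fun x : ι → ℝ => ENNReal.ofReal (Real.exp (-(1 / 2) * ∑ i, x i ^ 2)) := by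
    fun_prop
  rw [← lintegral_map (f := fun x : ι → ℝ => ENNReal.ofReal (Real.exp (-(1 / 2) * ∑ i, x i ^ 2)))
    hg hmeas, Real.map_matrix_volume_pi_eq_smul_volume_pi hC, lintegral_smul_measure,
    lintegral_exp_neg_half_sum_sq, smul_eq_mul, ← ENNReal.ofReal_mul (abs_nonneg _), mul_comm]
  congr 2
  rw [Matrix.det_mul, Matrix.det_transpose, ← sq, ← sq_abs, ← Real.rpow_natCast,
    ← Real.rpow_mul (abs_nonneg _), abs_inv]
  norm_num [Real.rpow_neg_one]

/-! ### The matrix normal distribution -/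

instance instBorelSpaceMatrix (r s : ℕ) : BorelSpace (Matrix (Fin r) (Fin s) ℝ) :=
  inferInstanceAs (BorelSpace (Fin r → Fin s → ℝ))

lemma matrixVolume_eq (r s : ℕ) :
    matrixVolume r s = (volume : Measure (Fin r → Fin s → ℝ)) := by
  exact Measure.map_id

instance (r s : ℕ) : SFinite (matrixVolume r s) := by
  unfold matrixVolume; infer_instance

instance (d : ℕ) : SFinite (posDefVolume d) := by
  unfold posDefVolume symVolume; infer_instance

lemma lintegral_matrixVolume_sub (r s : ℕ) (f : Matrix (Fin r) (Fin s) ℝ → ℝ≥0∞)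
    (θ : Matrix (Fin r) (Fin s) ℝ) :
    ∫⁻ w, f (w - θ) ∂(matrixVolume r s) = ∫⁻ w, f w ∂(matrixVolume r s) := by
  rw [matrixVolume_eq]
  exact lintegral_sub_right_eq_self (μ := (volume : Measure (Fin r → Fin s → ℝ))) f θ

/-- `vec` preserves Lebesgue measure. -/
lemma lintegral_matrixVolume_vec (r s : ℕ) {f : (Fin s × Fin r → ℝ) → ℝ≥0∞} (hf : Measurable f) :
    ∫⁻ w, f w.vec ∂(matrixVolume r s) = ∫⁻ x, f x := by
  rw [matrixVolume_eq]
  have hv : Measurable fun w : Fin r → Fin s → ℝ => Matrix.vec (Matrix.of w) := by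
    refine measurable_pi_lambda _ fun q => ?_
    exact (measurable_pi_apply q.1).comp (measurable_pi_apply q.2)
  have hmap : Measure.map (fun w : Fin r → Fin s → ℝ => Matrix.vec (Matrix.of w)) volume =
      volume := by
    refine (Measure.pi_eq fun t ht => ?_).symm
    rw [Measure.map_apply hv (MeasurableSet.univ_pi ht)]
    have hpre : (fun w : Fin r → Fin s → ℝ => Matrix.vec (Matrix.of w)) ⁻¹' univ.pi t =
        univ.pi fun i => univ.pi fun j => t (j, i) := by
      ext w
      simp only [mem_preimage, mem_univ_pi, Matrix.vec, Matrix.of_apply]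
      exact ⟨fun h i j => h (j, i), fun h q => h q.2 q.1⟩
    rw [hpre, volume_pi, Measure.pi_pi]
    simp only [volume_pi, Measure.pi_pi]
    rw [Fintype.prod_prod_type_right]
  calc _ = ∫⁻ x, f x ∂(Measure.map (fun w : Fin r → Fin s → ℝ => Matrix.vec (Matrix.of w))
        volume) := (lintegral_map hf hv).symm
    _ = _ := by rw [hmap]

/-- Vectorization turns the quadratic form `tr(A⁻¹ w B⁻¹ wᵀ)` into the one of `B⁻¹ ⊗ A⁻¹`. -/
lemma lintegral_matrixNormalDensity {r c : ℕ} (θ : Matrix (Fin r) (Fin c) ℝ)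
    {A : Matrix (Fin r) (Fin r) ℝ} {B : Matrix (Fin c) (Fin c) ℝ} (hA : A.PosDef) (hB : B.PosDef) :
    ∫⁻ w, ENNReal.ofReal (matrixNormalDensity θ A B w) ∂(matrixVolume r c) = 1 := by
  unfold matrixNormalDensity
  rw [lintegral_matrixVolume_sub r c (fun w => ENNReal.ofReal
    (Real.exp (-(1 / 2) * (A⁻¹ * w * B⁻¹ * wᵀ).trace) /
      ((2 * Real.pi) ^ ((r : ℝ) * c / 2) * A.det ^ ((c : ℝ) / 2) * B.det ^ ((r : ℝ) / 2))))]
  set D : ℝ := (2 * Real.pi) ^ ((r : ℝ) * c / 2) * A.det ^ ((c : ℝ) / 2) * B.det ^ ((r : ℝ) / 2)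
    with hD
  have hApos := hA.det_pos
  have hBpos := hB.det_pos
  have hDpos : 0 < D := by positivity
  have hM : (Matrix.kroneckerMap (· * ·) B⁻¹ A⁻¹).PosDef := hB.inv.kronecker hA.inv
  have h1 : ∀ w : Matrix (Fin r) (Fin c) ℝ,
      ENNReal.ofReal (Real.exp (-(1 / 2) * (A⁻¹ * w * B⁻¹ * wᵀ).trace) / D) =
      (fun x : Fin c × Fin r → ℝ => ENNReal.ofReal (Real.exp (-(1 / 2) *
        (x ⬝ᵥ (Matrix.kroneckerMap (· * ·) B⁻¹ A⁻¹ *ᵥ x)))) * ENNReal.ofReal D⁻¹) w.vec := by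
    intro w
    simp only
    rw [Matrix.kronecker_mulVec_vec, Matrix.vec_dotProduct_vec,
      ← ENNReal.ofReal_mul (Real.exp_pos _).le, div_eq_mul_inv,
      ← Matrix.conjTranspose_eq_transpose_of_trivial B⁻¹, hB.inv.isHermitian.eq,
      Matrix.trace_mul_comm]
  simp only [h1]
  rw [lintegral_matrixVolume_vec r c (f := fun x : Fin c × Fin r → ℝ =>
      ENNReal.ofReal (Real.exp (-(1 / 2) *
        (x ⬝ᵥ (Matrix.kroneckerMap (· * ·) B⁻¹ A⁻¹ *ᵥ x)))) * ENNReal.ofReal D⁻¹) (by fun_prop),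
    lintegral_mul_const _ (by fun_prop),
    lintegral_exp_neg_half_quadratic hM, ← ENNReal.ofReal_mul
      (mul_nonneg (by positivity) (Real.rpow_nonneg hM.det_pos.le _)), ← ENNReal.ofReal_one]
  congr 1
  have hpow : ∀ (x : ℝ) (n : ℕ), 0 < x → ((x⁻¹) ^ n) ^ (-(1 / 2) : ℝ) = x ^ ((n : ℝ) / 2) := by
    intro x n hx
    rw [inv_pow, Real.inv_rpow (by positivity), ← Real.rpow_neg (by positivity),
      ← Real.rpow_natCast, ← Real.rpow_mul hx.le]
    congr 1
    ring
  rw [Matrix.det_kronecker, Matrix.det_nonsing_inv, Matrix.det_nonsing_inv,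
    Ring.inverse_eq_inv', Fintype.card_fin, Fintype.card_fin,
    Real.mul_rpow (x := B.det⁻¹ ^ r) (by positivity) (by positivity),
    hpow _ _ hBpos, hpow _ _ hApos, hD, Fintype.card_prod, Fintype.card_fin, Fintype.card_fin]
  push_cast
  rw [mul_comm (c : ℝ) r]
  have h2 : 0 < (2 * Real.pi) ^ ((r : ℝ) * c / 2) := by positivity
  have h3 : 0 < A.det ^ ((c : ℝ) / 2) := by positivity
  have h4 : 0 < B.det ^ ((r : ℝ) / 2) := by positivity
  rw [mul_inv_eq_one₀ (by positivity)]
  ring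

/-! ### Measurability of matrix operations -/

section Measurability

variable {α : Type*} [MeasurableSpace α]

lemma measurable_matrix_iff {r s : ℕ} {f : α → Matrix (Fin r) (Fin s) ℝ} :
    Measurable f ↔ ∀ i j, Measurable fun a => f a i j := by
  constructor
  · intro h i j
    exact (measurable_pi_apply j).comp ((measurable_pi_apply i).comp h)
  · intro h
    exact measurable_pi_lambda _ fun i => measurable_pi_lambda _ fun j => h i j

lemma measurable_matrix_apply {r s : ℕ} {f : α → Matrix (Fin r) (Fin s) ℝ} (hf : Measurable f)
    (i : Fin r) (j : Fin s) : Measurable fun a => f a i j :=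
  measurable_matrix_iff.1 hf i j

@[fun_prop]
lemma measurable_matrix_mul {r s t : ℕ} {f : α → Matrix (Fin r) (Fin s) ℝ}
    {g : α → Matrix (Fin s) (Fin t) ℝ} (hf : Measurable f) (hg : Measurable g) :
    Measurable fun a => f a * g a := by
  refine measurable_matrix_iff.2 fun i j => ?_
  simp only [Matrix.mul_apply]
  exact Finset.measurable_sum _ fun l _ =>
    (measurable_matrix_apply hf i l).mul (measurable_matrix_apply hg l j)

@[fun_prop]
lemma measurable_matrix_sub {r s : ℕ} {f g : α → Matrix (Fin r) (Fin s) ℝ} (hf : Measurable f)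
    (hg : Measurable g) : Measurable fun a => f a - g a :=
  measurable_matrix_iff.2 fun i j =>
    (measurable_matrix_apply hf i j).sub (measurable_matrix_apply hg i j)

@[fun_prop]
lemma measurable_matrix_transpose {r s : ℕ} {f : α → Matrix (Fin r) (Fin s) ℝ}
    (hf : Measurable f) : Measurable fun a => (f a)ᵀ :=
  measurable_matrix_iff.2 fun i j => measurable_matrix_apply hf j i

@[fun_prop]
lemma measurable_matrix_det {r : ℕ} {f : α → Matrix (Fin r) (Fin r) ℝ}
    (hf : Measurable f) : Measurable fun a => (f a).det :=
  (Continuous.matrix_det continuous_id).measurable.comp hf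

@[fun_prop]
lemma measurable_matrix_trace {r : ℕ} {f : α → Matrix (Fin r) (Fin r) ℝ}
    (hf : Measurable f) : Measurable fun a => (f a).trace :=
  (Continuous.matrix_trace continuous_id).measurable.comp hf

@[fun_prop]
lemma measurable_matrix_inv {r : ℕ} {f : α → Matrix (Fin r) (Fin r) ℝ}
    (hf : Measurable f) : Measurable fun a => (f a)⁻¹ := by
  refine measurable_matrix_iff.2 fun i j => ?_
  simp only [Matrix.inv_def, Ring.inverse_eq_inv', Matrix.smul_apply, smul_eq_mul]
  have h : Measurable fun a => (f a).adjugate :=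
    (Continuous.matrix_adjugate continuous_id).measurable.comp hf
  exact (measurable_matrix_det hf).inv.mul (measurable_matrix_apply h i j)

@[fun_prop]
lemma measurable_matrix_mulVec {r s : ℕ} {f : α → Matrix (Fin r) (Fin s) ℝ}
    {v : α → Fin s → ℝ} (hf : Measurable f) (hv : Measurable v) :
    Measurable fun a => f a *ᵥ v a := by
  refine measurable_pi_lambda _ fun i => ?_
  simp only [Matrix.mulVec, dotProduct]
  exact Finset.measurable_sum _ fun l _ =>
    (measurable_matrix_apply hf i l).mul ((measurable_pi_apply l).comp hv)

@[fun_prop]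
lemma measurable_dotProduct {s : ℕ} {v w : α → Fin s → ℝ} (hv : Measurable v)
    (hw : Measurable w) : Measurable fun a => v a ⬝ᵥ w a := by
  simp only [dotProduct]
  exact Finset.measurable_sum _ fun l _ =>
    ((measurable_pi_apply l).comp hv).mul ((measurable_pi_apply l).comp hw)

/-- Positive definiteness is a closed condition, positive semidefiniteness, together with an open
one, a nonzero determinant. -/
lemma measurableSet_posDef (r : ℕ) : MeasurableSet {S : Matrix (Fin r) (Fin r) ℝ | S.PosDef} := by
  have h : {S : Matrix (Fin r) (Fin r) ℝ | S.PosDef} =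
      ({S | Sᵀ = S} ∩ ⋂ x : Fin r → ℝ, {S | 0 ≤ x ⬝ᵥ (S *ᵥ x)}) ∩ {S | S.det ≠ 0} := by
    ext S
    simp only [mem_ofPred_eq, mem_inter_iff, mem_iInter]
    constructor
    · intro hS
      refine ⟨⟨?_, fun x => ?_⟩, hS.det_pos.ne'⟩
      · have := hS.isHermitian.eq
        rwa [Matrix.conjTranspose_eq_transpose_of_trivial] at this
      · simpa using hS.posSemidef.dotProduct_mulVec_nonneg x
    · rintro ⟨⟨h1, h2⟩, h3⟩
      have hpsd : S.PosSemidef := Matrix.PosSemidef.of_dotProduct_mulVec_nonneg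
        (by rw [Matrix.IsHermitian, Matrix.conjTranspose_eq_transpose_of_trivial, h1])
        (fun x => by simpa using h2 x)
      exact hpsd.posDef_iff_det_ne_zero.2 h3
  rw [h]
  refine MeasurableSet.inter (IsClosed.measurableSet ?_) ?_
  · refine (isClosed_eq (Continuous.matrix_transpose continuous_id) continuous_id).inter
      (isClosed_iInter fun x => isClosed_le continuous_const ?_)
    exact Continuous.dotProduct continuous_const
      (Continuous.matrix_mulVec continuous_id continuous_const)
  · exact (measurable_matrix_det measurable_id) (measurableSet_singleton (0 : ℝ)).compl

end Measurability

/-! ### Bordered matrices -/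

/-- The symmetric matrix with corner entry `s`, first row and column `v`, and remaining
block `W`. -/
def border {d : ℕ} (s : ℝ) (v : Fin d → ℝ) (W : Matrix (Fin d) (Fin d) ℝ) :
    Matrix (Fin (d + 1)) (Fin (d + 1)) ℝ :=
  Matrix.of (Fin.cons (Fin.cons s v) fun i => Fin.cons (v i) (W i))

section Border

variable {d : ℕ}

@[simp] lemma border_zero_zero (s : ℝ) (v : Fin d → ℝ) (W) : border s v W 0 0 = s := rfl
@[simp] lemma border_zero_succ (s : ℝ) (v : Fin d → ℝ) (W) (j : Fin d) :
    border s v W 0 j.succ = v j := rfl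
@[simp] lemma border_succ_zero (s : ℝ) (v : Fin d → ℝ) (W) (i : Fin d) :
    border s v W i.succ 0 = v i := rfl
@[simp] lemma border_succ_succ (s : ℝ) (v : Fin d → ℝ) (W) (i j : Fin d) :
    border s v W i.succ j.succ = W i j := rfl

/-- The unit lower triangular matrix with `u` below the corner of the identity matrix. -/
def lowerUnit (u : Fin d → ℝ) : Matrix (Fin (d + 1)) (Fin (d + 1)) ℝ :=
  Matrix.of (Fin.cons (Fin.cons 1 0) fun i => Fin.cons (u i) ((1 : Matrix (Fin d) (Fin d) ℝ) i))

@[simp] lemma lowerUnit_zero_zero (u : Fin d → ℝ) : lowerUnit u 0 0 = 1 := rfl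
@[simp] lemma lowerUnit_zero_succ (u : Fin d → ℝ) (j : Fin d) : lowerUnit u 0 j.succ = 0 := rfl
@[simp] lemma lowerUnit_succ_zero (u : Fin d → ℝ) (i : Fin d) : lowerUnit u i.succ 0 = u i := rfl
@[simp] lemma lowerUnit_succ_succ (u : Fin d → ℝ) (i j : Fin d) :
    lowerUnit u i.succ j.succ = (1 : Matrix (Fin d) (Fin d) ℝ) i j := rfl

lemma matrix_ext_succ {A B : Matrix (Fin (d + 1)) (Fin (d + 1)) ℝ} (h00 : A 0 0 = B 0 0)
    (h01 : ∀ j : Fin d, A 0 j.succ = B 0 j.succ) (h10 : ∀ i : Fin d, A i.succ 0 = B i.succ 0)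
    (h11 : ∀ i j : Fin d, A i.succ j.succ = B i.succ j.succ) : A = B := by
  ext i j
  refine Fin.cases ?_ (fun i => ?_) i <;> refine Fin.cases ?_ (fun j => ?_) j
  exacts [h00, h01 j, h10 i, h11 i j]

lemma border_eq_of_transpose_eq {Ψ : Matrix (Fin (d + 1)) (Fin (d + 1)) ℝ} (h : Ψᵀ = Ψ) :
    Ψ = border (Ψ 0 0) (fun j => Ψ 0 j.succ) (Ψ.submatrix Fin.succ Fin.succ) :=
  matrix_ext_succ rfl (fun _ => rfl)
    (fun i => by rw [border_succ_zero]; conv_lhs => rw [← h]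
                 rfl) (fun _ _ => rfl)

lemma lowerUnit_mul_neg (u : Fin d → ℝ) : lowerUnit u * lowerUnit (-u) = 1 := by
  refine matrix_ext_succ ?_ (fun j => ?_) (fun i => ?_) (fun i j => ?_) <;>
    simp [Matrix.mul_apply, Fin.sum_univ_succ, Matrix.one_apply, Fin.succ_ne_zero,
      (Fin.succ_ne_zero _).symm]

lemma det_border_zero (s : ℝ) (S : Matrix (Fin d) (Fin d) ℝ) :
    (border s 0 S).det = s * S.det := by
  rw [Matrix.det_succ_row_zero, Fin.sum_univ_succ]
  simp [Matrix.submatrix]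
  left; rfl

lemma det_lowerUnit (u : Fin d → ℝ) : (lowerUnit u).det = 1 := by
  rw [Matrix.det_succ_row_zero, Fin.sum_univ_succ]
  simp only [lowerUnit_zero_succ, lowerUnit_zero_zero]
  simp
  rw [show (lowerUnit u).submatrix Fin.succ Fin.succ = 1 from by ext i j; simp]
  simp

/-- Elimination of the first variable: a congruence by a unit triangular matrix. -/
lemma border_eq_conj (s : ℝ) (u : Fin d → ℝ) (S : Matrix (Fin d) (Fin d) ℝ) :
    border s (s • u) (S + s • Matrix.vecMulVec u u) =
      lowerUnit u * border s 0 S * (lowerUnit u)ᵀ := by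
  refine matrix_ext_succ ?_ (fun j => ?_) (fun i => ?_) (fun i j => ?_) <;>
    simp [Matrix.mul_apply, Fin.sum_univ_succ, Matrix.one_apply, Matrix.vecMulVec_apply]
  · ring
  · ring

lemma det_border_conj (s : ℝ) (u : Fin d → ℝ) (S : Matrix (Fin d) (Fin d) ℝ) :
    (border s (s • u) (S + s • Matrix.vecMulVec u u)).det = s * S.det := by
  rw [border_eq_conj, Matrix.det_mul, Matrix.det_mul, Matrix.det_transpose, det_lowerUnit,
    det_border_zero]
  ring

lemma posDef_border_zero_iff (s : ℝ) (S : Matrix (Fin d) (Fin d) ℝ) :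
    (border s 0 S).PosDef ↔ 0 < s ∧ S.PosDef := by
  have hquad : ∀ x : Fin (d + 1) → ℝ, x ⬝ᵥ (border s 0 S *ᵥ x) =
      s * x 0 ^ 2 + (fun i => x (Fin.succ i)) ⬝ᵥ (S *ᵥ fun i => x (Fin.succ i)) := by
    intro x
    simp only [dotProduct, Matrix.mulVec, Fin.sum_univ_succ, border_zero_zero, border_zero_succ,
      border_succ_zero, border_succ_succ, Pi.zero_apply]
    simp
    ring
  constructor
  · intro h
    refine ⟨h.diag_pos (i := 0), ?_⟩
    exact h.submatrix (e := Fin.succ) (Fin.succ_injective d)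
  · rintro ⟨hs, hS⟩
    refine Matrix.PosDef.of_dotProduct_mulVec_pos ?_ fun x hx => ?_
    · refine matrix_ext_succ ?_ (fun j => ?_) (fun i => ?_) (fun i j => ?_) <;>
        simp [Matrix.conjTranspose_apply]
      exact hS.isHermitian.apply i j
    · rw [star_trivial, hquad]
      by_cases hx' : (fun i => x (Fin.succ i)) = 0
      · have h0 : x 0 ≠ 0 := by
          intro h0
          apply hx
          ext i
          refine Fin.cases h0 (fun i => congrFun hx' i) i
        rw [hx']
        simp
        positivity
      · have := hS.dotProduct_mulVec_pos hx'
        rw [star_trivial] at this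
        positivity

lemma isUnit_lowerUnit (u : Fin d → ℝ) : IsUnit (lowerUnit u) := by
  rw [Matrix.isUnit_iff_isUnit_det, det_lowerUnit]; exact isUnit_one

lemma posDef_border_conj_iff (s : ℝ) (u : Fin d → ℝ) (S : Matrix (Fin d) (Fin d) ℝ) :
    (border s (s • u) (S + s • Matrix.vecMulVec u u)).PosDef ↔ 0 < s ∧ S.PosDef := by
  rw [border_eq_conj, ← posDef_border_zero_iff]
  have := Matrix.IsUnit.posDef_star_right_conjugate_iff (x := border s 0 S) (isUnit_lowerUnit u)
  rwa [Matrix.star_eq_conjTranspose, Matrix.conjTranspose_eq_transpose_of_trivial] at this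

lemma inv_border_conj {s : ℝ} (hs : s ≠ 0) (u : Fin d → ℝ) {S : Matrix (Fin d) (Fin d) ℝ}
    (hS : S.PosDef) :
    (border s (s • u) (S + s • Matrix.vecMulVec u u))⁻¹ =
      border (s⁻¹ + u ⬝ᵥ (S⁻¹ *ᵥ u)) (-(S⁻¹ *ᵥ u)) S⁻¹ := by
  have hSS : S * S⁻¹ = 1 := Matrix.mul_nonsing_inv _ (Ne.isUnit hS.det_pos.ne')
  have hsym : (S⁻¹)ᵀ = S⁻¹ := by
    rw [← Matrix.conjTranspose_eq_transpose_of_trivial]; exact hS.inv.isHermitian.eq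
  have h1 : border (s⁻¹ + u ⬝ᵥ (S⁻¹ *ᵥ u)) (-(S⁻¹ *ᵥ u)) S⁻¹ =
      (lowerUnit (-u))ᵀ * border s⁻¹ 0 S⁻¹ * lowerUnit (-u) := by
    have hsym' : ∀ i j, S⁻¹ i j = S⁻¹ j i := fun i j => by
      conv_lhs => rw [← hsym]
      rfl
    refine matrix_ext_succ ?_ (fun j => ?_) (fun i => ?_) (fun i j => ?_) <;>
      simp [Matrix.mul_apply, Fin.sum_univ_succ, Matrix.one_apply, Matrix.mulVec, dotProduct,
        Finset.sum_mul, Finset.mul_sum]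
    · rw [Finset.sum_comm]
      exact Finset.sum_congr rfl fun i _ => Finset.sum_congr rfl fun j _ => by ring
    · exact Finset.sum_congr rfl fun i _ => by rw [hsym' j i]; ring
  have h2 : border s 0 S * border s⁻¹ 0 S⁻¹ = 1 := by
    refine matrix_ext_succ ?_ (fun j => ?_) (fun i => ?_) (fun i j => ?_)
    · simp [Matrix.mul_apply, Fin.sum_univ_succ, hs]
    · simp [Matrix.mul_apply, Fin.sum_univ_succ, (Fin.succ_ne_zero _).symm]
    · simp [Matrix.mul_apply, Fin.sum_univ_succ]
    · have := congrFun (congrFun hSS i) j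
      rw [Matrix.mul_apply] at this
      simp [Matrix.mul_apply, Fin.sum_univ_succ, this, Matrix.one_apply]
  refine Matrix.inv_eq_right_inv ?_
  rw [border_eq_conj, h1]
  have h3 : (lowerUnit u)ᵀ * (lowerUnit (-u))ᵀ = 1 := by
    rw [← Matrix.transpose_mul]
    have := lowerUnit_mul_neg (-u)
    rw [neg_neg] at this
    rw [this, Matrix.transpose_one]
  calc _ = lowerUnit u * border s 0 S * ((lowerUnit u)ᵀ * (lowerUnit (-u))ᵀ) *
        border s⁻¹ 0 S⁻¹ * lowerUnit (-u) := by simp only [Matrix.mul_assoc]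
    _ = lowerUnit u * (border s 0 S * border s⁻¹ 0 S⁻¹) * lowerUnit (-u) := by
      rw [h3, Matrix.mul_one]; simp only [Matrix.mul_assoc]
    _ = 1 := by rw [h2, Matrix.mul_one, lowerUnit_mul_neg]

/-- The exponent of an inverse Wishart density in the coordinates of `border_eq_conj`: a quadratic
in `u` centered at `c`. -/
lemma trace_border_mul_inv {s ψ : ℝ} (hs : s ≠ 0) (u c : Fin d → ℝ)
    {S : Matrix (Fin d) (Fin d) ℝ} (hS : S.PosDef) (P : Matrix (Fin d) (Fin d) ℝ) :
    (border ψ (ψ • c) (P + ψ • Matrix.vecMulVec c c) *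
      (border s (s • u) (S + s • Matrix.vecMulVec u u))⁻¹).trace =
      ψ / s + ψ * ((u - c) ⬝ᵥ (S⁻¹ *ᵥ (u - c))) + (P * S⁻¹).trace := by
  have hsym : (S⁻¹)ᵀ = S⁻¹ := by
    rw [← Matrix.conjTranspose_eq_transpose_of_trivial]; exact hS.inv.isHermitian.eq
  rw [inv_border_conj hs u hS]
  have hcomm : u ⬝ᵥ (S⁻¹ *ᵥ c) = c ⬝ᵥ (S⁻¹ *ᵥ u) := by
    rw [Matrix.dotProduct_mulVec, ← Matrix.mulVec_transpose, hsym, dotProduct_comm]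
  have hvv : (Matrix.vecMulVec c c * S⁻¹).trace = c ⬝ᵥ (S⁻¹ *ᵥ c) := by
    rw [Matrix.trace_mul_comm, Matrix.mul_vecMulVec, Matrix.trace_vecMulVec, dotProduct_comm]
  have htr : ∀ (a b : ℝ) (v w : Fin d → ℝ) (A B : Matrix (Fin d) (Fin d) ℝ),
      (border a v A * border b w B).trace = a * b + 2 * (v ⬝ᵥ w) + (A * B).trace := by
    intro a b v w A B
    simp only [Matrix.trace, Matrix.diag_apply, Matrix.mul_apply, Fin.sum_univ_succ,
      border_zero_zero, border_zero_succ, border_succ_zero, border_succ_succ, dotProduct,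
      Finset.sum_add_distrib]
    ring
  rw [htr, Matrix.add_mul, Matrix.trace_add, Matrix.smul_mul, Matrix.trace_smul, hvv,
    Matrix.mulVec_sub, sub_dotProduct, dotProduct_sub, dotProduct_sub, hcomm, smul_dotProduct,
    dotProduct_neg]
  simp only [smul_eq_mul]
  field_simp
  ring

end Border

/-! ### Lebesgue measure on bordered symmetric matrices -/

/-- The pairs `i ≤ j` in `Fin (d + 1)`: the corner, the rest of the first row, and the pairs
in `Fin d`. -/
def upperIndexEquiv (d : ℕ) : Unit ⊕ (Fin d ⊕ {ij : Fin d × Fin d // ij.1 ≤ ij.2}) ≃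
    {ij : Fin (d + 1) × Fin (d + 1) // ij.1 ≤ ij.2} :=
  Equiv.ofBijective
    (Sum.elim (fun _ => ⟨(0, 0), le_rfl⟩) (Sum.elim (fun j => ⟨(0, j.succ), Fin.zero_le _⟩)
      (fun ij => ⟨(ij.1.1.succ, ij.1.2.succ), Fin.succ_le_succ_iff.2 ij.2⟩))) (by
    constructor
    · rintro (_ | j | ⟨⟨i, j⟩, h⟩) (_ | j' | ⟨⟨i', j'⟩, h'⟩) he <;>
        simp_all [Fin.succ_ne_zero, (Fin.succ_ne_zero _).symm, Prod.ext_iff]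
    · rintro ⟨⟨i, j⟩, h⟩
      induction i using Fin.cases with
      | zero =>
        induction j using Fin.cases with
        | zero => exact ⟨Sum.inl (), rfl⟩
        | succ j => exact ⟨Sum.inr (Sum.inl j), rfl⟩
      | succ i =>
        induction j using Fin.cases with
        | zero => exact absurd h (by simp)
        | succ j => exact ⟨Sum.inr (Sum.inr ⟨(i, j), Fin.succ_le_succ_iff.1 h⟩), rfl⟩)

lemma measurable_symOfUpper (d : ℕ) : Measurable (symOfUpper d) :=
  measurable_matrix_iff.2 fun _ _ => measurable_pi_apply _

@[fun_prop]
lemma measurable_border {α : Type*} [MeasurableSpace α] {d : ℕ} {s : α → ℝ} {v : α → Fin d → ℝ}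
    {W : α → Matrix (Fin d) (Fin d) ℝ} (hs : Measurable s) (hv : Measurable v)
    (hW : Measurable W) : Measurable fun a => border (s a) (v a) (W a) := by
  refine measurable_matrix_iff.2 fun i j => ?_
  refine Fin.cases ?_ (fun i => ?_) i <;> refine Fin.cases ?_ (fun j => ?_) j
  · exact hs
  · exact (measurable_pi_apply j).comp hv
  · exact (measurable_pi_apply i).comp hv
  · exact measurable_matrix_apply hW i j

/-- Lebesgue measure on symmetric matrices splits along the first row and column. -/
lemma lintegral_symVolume_succ {d : ℕ} {F : Matrix (Fin (d + 1)) (Fin (d + 1)) ℝ → ℝ≥0∞}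
    (hF : Measurable F) :
    ∫⁻ w, F w ∂(symVolume (d + 1)) = ∫⁻ s : ℝ, ∫⁻ v, ∫⁻ W, F (border s v W) ∂(symVolume d) := by
  have e1 := volume_measurePreserving_piCongrLeft
    (fun _ : {ij : Fin (d + 1) × Fin (d + 1) // ij.1 ≤ ij.2} => ℝ) (upperIndexEquiv d)
  have e2 := (volume_measurePreserving_sumPiEquivProdPi
    (fun _ : Unit ⊕ (Fin d ⊕ {ij : Fin d × Fin d // ij.1 ≤ ij.2}) => ℝ)).symm
  have e3 := (volume_measurePreserving_sumPiEquivProdPi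
    (fun _ : Fin d ⊕ {ij : Fin d × Fin d // ij.1 ≤ ij.2} => ℝ)).symm
  have e4 := (volume_preserving_funUnique Unit ℝ).symm
  have hsym := measurable_symOfUpper (d + 1)
  rw [symVolume, lintegral_map hF hsym, ← e1.lintegral_comp (by fun_prop),
    ← e2.lintegral_comp (by fun_prop)]
  rw [Measure.volume_eq_prod, lintegral_prod _ (by fun_prop), ← e4.lintegral_comp]
  swap
  · exact Measurable.lintegral_prod_right' (f := fun x : (Unit → ℝ) ×
      (Fin d ⊕ {ij : Fin d × Fin d // ij.1 ≤ ij.2} → ℝ) => F (symOfUpper (d + 1)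
        ((MeasurableEquiv.piCongrLeft (fun _ => ℝ) (upperIndexEquiv d))
          ((MeasurableEquiv.sumPiEquivProdPi fun _ => ℝ).symm x)))) (by fun_prop)
  refine lintegral_congr fun s => ?_
  rw [← e3.lintegral_comp (by fun_prop), Measure.volume_eq_prod, lintegral_prod _ (by fun_prop)]
  refine lintegral_congr fun v => ?_
  rw [symVolume, lintegral_map (by fun_prop) (measurable_symOfUpper d)]
  refine lintegral_congr fun t => ?_
  congr 1
  have happ : ∀ (f : Unit ⊕ (Fin d ⊕ {ij : Fin d × Fin d // ij.1 ≤ ij.2}) → ℝ) q,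
      (MeasurableEquiv.piCongrLeft (fun _ => ℝ) (upperIndexEquiv d)) f (upperIndexEquiv d q) =
        f q := fun f q => by
    rw [MeasurableEquiv.coe_piCongrLeft]; exact Equiv.piCongrLeft_apply_apply _ _ _ _
  refine matrix_ext_succ ?_ (fun j => ?_) (fun i => ?_) (fun i j => ?_)
  · exact happ _ (Sum.inl ())
  · have : (⟨(min (0 : Fin (d + 1)) j.succ, max 0 j.succ), min_le_max⟩ :
        {ij : Fin (d + 1) × Fin (d + 1) // ij.1 ≤ ij.2}) =
        upperIndexEquiv d (Sum.inr (Sum.inl j)) := by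
      apply Subtype.ext
      simp [upperIndexEquiv]
      rfl
    simp only [symOfUpper, Matrix.of_apply, border_zero_succ]
    rw [this, happ]
    rfl
  · have : (⟨(min i.succ (0 : Fin (d + 1)), max i.succ 0), min_le_max⟩ :
        {ij : Fin (d + 1) × Fin (d + 1) // ij.1 ≤ ij.2}) =
        upperIndexEquiv d (Sum.inr (Sum.inl i)) := by
      apply Subtype.ext
      simp [upperIndexEquiv]
      rfl
    simp only [symOfUpper, Matrix.of_apply, border_succ_zero]
    rw [this, happ]
    rfl
  · have : (⟨(min i.succ j.succ, max i.succ j.succ), min_le_max⟩ :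
        {ij : Fin (d + 1) × Fin (d + 1) // ij.1 ≤ ij.2}) =
        upperIndexEquiv d (Sum.inr (Sum.inr ⟨(min i j, max i j), min_le_max⟩)) := by
      apply Subtype.ext
      rw [Prod.ext_iff]
      exact ⟨((Fin.strictMono_succ (n := d)).monotone.map_min).symm,
        ((Fin.strictMono_succ (n := d)).monotone.map_max).symm⟩
    simp only [symOfUpper, Matrix.of_apply, border_succ_succ]
    rw [this, happ]
    rfl

lemma lintegral_symVolume_add {d : ℕ} {F : Matrix (Fin d) (Fin d) ℝ → ℝ≥0∞}
    (hF : Measurable F) {C : Matrix (Fin d) (Fin d) ℝ} (hC : Cᵀ = C) :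
    ∫⁻ W, F (W + C) ∂(symVolume d) = ∫⁻ W, F W ∂(symVolume d) := by
  have hsym := measurable_symOfUpper d
  rw [symVolume, lintegral_map hF hsym, lintegral_map (by fun_prop) hsym]
  refine Eq.trans (lintegral_congr fun t => ?_)
    (lintegral_add_right_eq_self (μ := volume) (fun t => F (symOfUpper d t))
      (fun ij => C ij.1.1 ij.1.2))
  congr 1
  ext i j
  simp only [symOfUpper, Matrix.add_apply, Matrix.of_apply, Pi.add_apply]
  congr 1
  rcases le_total i j with h | h
  · simp [h]
  · simp only [min_eq_right h, max_eq_left h]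
    conv_lhs => rw [← hC]
    rfl

lemma lintegral_smul_pi {d : ℕ} {F : (Fin d → ℝ) → ℝ≥0∞} {s : ℝ} (hs : 0 < s) :
    ∫⁻ v, F v = ENNReal.ofReal (s ^ d) * ∫⁻ u, F (s • u) := by
  have h := Measure.map_addHaar_smul (volume : Measure (Fin d → ℝ)) hs.ne'
  have hm : MeasurableEmbedding fun u : Fin d → ℝ => s • u :=
    (Homeomorph.smulOfNeZero s hs.ne').measurableEmbedding
  have h2 := hm.lintegral_map (μ := volume) F
  rw [← h2]
  change _ = _ * ∫⁻ a, F a ∂(Measure.map (s • ·) volume)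
  rw [h, lintegral_smul_measure, smul_eq_mul, ← mul_assoc, ← ENNReal.ofReal_mul (by positivity)]
  have : s ^ d * |(s ^ Module.finrank ℝ (Fin d → ℝ))⁻¹| = 1 := by
    rw [Module.finrank_fin_fun, abs_of_pos (by positivity)]
    field_simp
  rw [this]
  simp

/-! ### The inverse Wishart distribution -/

lemma lintegral_inverse_gamma {α b : ℝ} (hα : 0 < α) (hb : 0 < b) :
    ∫⁻ s in Ioi (0 : ℝ), ENNReal.ofReal (s ^ (-α - 1) * Real.exp (-(b / s))) =
      ENNReal.ofReal (b ^ (-α) * Real.Gamma α) := by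
  have himg : (fun x : ℝ => x⁻¹) '' Ioi 0 = Ioi 0 := by
    rw [image_inv_eq_inv]
    ext x; simp
  have hcv := lintegral_image_eq_lintegral_abs_deriv_mul (s := Ioi (0 : ℝ)) (f := fun x => x⁻¹)
    (f' := fun x => -(x ^ 2)⁻¹) measurableSet_Ioi
    (fun x hx => (hasDerivAt_inv (ne_of_gt hx)).hasDerivWithinAt) inv_injective.injOn
    (fun s => ENNReal.ofReal (s ^ (-α - 1) * Real.exp (-(b / s))))
  rw [himg] at hcv
  rw [hcv]
  have hval := Real.integral_rpow_mul_exp_neg_mul_Ioi hα hb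
  have hpos : 0 < (1 / b) ^ α * Real.Gamma α := mul_pos (by positivity) (Real.Gamma_pos_of_pos hα)
  have hint : IntegrableOn (fun t : ℝ => t ^ (α - 1) * Real.exp (-(b * t))) (Ioi 0) := by
    by_contra hni
    rw [integral_undef hni] at hval
    exact hpos.ne hval
  have h1 : ∫⁻ x in Ioi (0 : ℝ), ENNReal.ofReal |-(x ^ 2)⁻¹| *
      ENNReal.ofReal (x⁻¹ ^ (-α - 1) * Real.exp (-(b / x⁻¹))) =
      ∫⁻ t in Ioi (0 : ℝ), ENNReal.ofReal (t ^ (α - 1) * Real.exp (-(b * t))) := by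
    refine setLIntegral_congr_fun measurableSet_Ioi fun x hx => ?_
    have hx : 0 < x := hx
    rw [← ENNReal.ofReal_mul (abs_nonneg _), abs_neg, abs_of_pos (by positivity), div_inv_eq_mul,
      ← mul_assoc, Real.inv_rpow hx.le, ← Real.rpow_neg hx.le, ← Real.rpow_natCast,
      ← Real.rpow_neg hx.le, ← Real.rpow_add hx]
    congr 3
    push_cast
    ring
  rw [h1, ← ofReal_integral_eq_lintegral_ofReal hint
    ((ae_restrict_mem measurableSet_Ioi).mono fun t ht =>
      mul_nonneg (Real.rpow_nonneg (le_of_lt ht) _) (Real.exp_pos _).le),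
    hval, one_div, Real.inv_rpow hb.le, ← Real.rpow_neg hb.le]

lemma lintegral_inverse_wishart_zero (f : Matrix (Fin 0) (Fin 0) ℝ → ℝ≥0∞) :
    ∫⁻ w, f w ∂(posDefVolume 0) = f 1 := by
  have h1 : {S : Matrix (Fin 0) (Fin 0) ℝ | S.PosDef} = univ :=
    eq_univ_of_forall fun S => Subsingleton.elim 1 S ▸ Matrix.PosDef.one
  have h2 : ∀ w : Matrix (Fin 0) (Fin 0) ℝ, f w = f 1 := fun w => by
    rw [Subsingleton.elim w 1]
  simp only [h2]
  rw [lintegral_const, posDefVolume, h1, Measure.restrict_univ, symVolume,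
    Measure.map_apply (measurable_symOfUpper 0) MeasurableSet.univ, preimage_univ]
  have : IsEmpty {ij : Fin 0 × Fin 0 // ij.1 ≤ ij.2} := ⟨fun q => q.1.1.elim0⟩
  rw [volume_pi, Measure.pi_of_empty]
  simp

/-- Integrating out the first row and column of an inverse Wishart kernel, at a fixed corner
entry `s`. With `v = s u` and `W = S + s u uᵀ` the integral over `u` is Gaussian. -/
lemma lintegral_inverse_wishart_corner {d : ℕ} (m : ℝ) {ψ : ℝ} (hψ : 0 < ψ) (c : Fin d → ℝ)
    (P : Matrix (Fin d) (Fin d) ℝ) {s : ℝ} (hs : 0 < s) :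
    ∫⁻ v, ∫⁻ W, {w : Matrix (Fin (d + 1)) (Fin (d + 1)) ℝ | w.PosDef}.indicator
      (fun w => ENNReal.ofReal (w.det ^ (-((m + (d + 1 : ℕ) + 1) / 2)) * Real.exp (-(1 / 2) *
        (border ψ (ψ • c) (P + ψ • Matrix.vecMulVec c c) * w⁻¹).trace)))
      (border s v W) ∂(symVolume d) =
    ENNReal.ofReal (s ^ (-((m - d) / 2) - 1) * Real.exp (-(ψ / 2 / s))) *
      (ENNReal.ofReal ((2 * Real.pi) ^ ((d : ℝ) / 2) * ψ ^ (-((d : ℝ) / 2))) *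
      ∫⁻ S, ENNReal.ofReal (S.det ^ (-((m + d + 1) / 2)) *
        Real.exp (-(1 / 2) * (P * S⁻¹).trace)) ∂(posDefVolume d)) := by
  set F := {w : Matrix (Fin (d + 1)) (Fin (d + 1)) ℝ | w.PosDef}.indicator
      (fun w => ENNReal.ofReal (w.det ^ (-((m + (d + 1 : ℕ) + 1) / 2)) * Real.exp (-(1 / 2) *
        (border ψ (ψ • c) (P + ψ • Matrix.vecMulVec c c) * w⁻¹).trace))) with hF
  have hFm : Measurable F := by
    refine Measurable.indicator ?_ (measurableSet_posDef (d + 1))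
    fun_prop
  have hsymm : ∀ u : Fin d → ℝ, (s • Matrix.vecMulVec u u)ᵀ = s • Matrix.vecMulVec u u := by
    intro u
    rw [Matrix.transpose_smul, Matrix.transpose_vecMulVec]
  set E : Matrix (Fin d) (Fin d) ℝ → (Fin d → ℝ) → ℝ :=
    fun S u => Real.exp (-(1 / 2) * (u ⬝ᵥ ((ψ • S⁻¹) *ᵥ u))) with hE
  set A : Matrix (Fin d) (Fin d) ℝ → ℝ := fun S => (s * S.det) ^ (-((m + (d + 1 : ℕ) + 1) / 2)) *
    Real.exp (-(1 / 2) * (ψ / s)) * Real.exp (-(1 / 2) * (P * S⁻¹).trace) with hA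
  have hFval : ∀ u S, F (border s (s • u) (S + s • Matrix.vecMulVec u u)) =
      {S : Matrix (Fin d) (Fin d) ℝ | S.PosDef}.indicator
        (fun S => ENNReal.ofReal (A S) * ENNReal.ofReal (E S (u - c))) S := by
    intro u S
    by_cases hS : S.PosDef
    · have hS' : (border s (s • u) (S + s • Matrix.vecMulVec u u)).PosDef :=
        (posDef_border_conj_iff s u S).2 ⟨hs, hS⟩
      have hApos : 0 ≤ A S := by have := hS.det_pos; positivity
      rw [hF, indicator_of_mem (show _ ∈ {w | Matrix.PosDef w} from hS'),
        indicator_of_mem (show _ ∈ {w | Matrix.PosDef w} from hS), det_border_conj,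
        trace_border_mul_inv hs.ne' u c hS P, ← ENNReal.ofReal_mul hApos, hA, hE]
      simp only
      rw [mul_assoc, mul_assoc, ← Real.exp_add, ← Real.exp_add, Matrix.smul_mulVec,
        dotProduct_smul, smul_eq_mul]
      congr 3
      ring
    · have hS' : ¬ (border s (s • u) (S + s • Matrix.vecMulVec u u)).PosDef := fun h =>
        hS ((posDef_border_conj_iff s u S).1 h).2
      rw [hF, indicator_of_notMem (show _ ∉ {w | Matrix.PosDef w} from hS'),
        indicator_of_notMem (show _ ∉ {w | Matrix.PosDef w} from hS)]
  have hEm : Measurable fun q : (Fin d → ℝ) × Matrix (Fin d) (Fin d) ℝ => E q.2 (q.1 - c) := by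
    simp only [hE]; fun_prop
  have hAm : Measurable A := by simp only [hA]; fun_prop
  have hgauss : ∀ S : Matrix (Fin d) (Fin d) ℝ, S.PosDef →
      ∫⁻ u, ENNReal.ofReal (E S (u - c)) =
        ENNReal.ofReal ((2 * Real.pi) ^ ((d : ℝ) / 2) * (ψ ^ d * S.det⁻¹) ^ (-(1 / 2) : ℝ)) := by
    intro S hS
    rw [lintegral_sub_right_eq_self (μ := volume) (fun u => ENNReal.ofReal (E S u)) c]
    simp only [hE]
    rw [lintegral_exp_neg_half_quadratic (hS.inv.smul hψ), Matrix.det_smul,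
      Matrix.det_nonsing_inv, Ring.inverse_eq_inv', Fintype.card_fin]
  calc ∫⁻ v, ∫⁻ W, F (border s v W) ∂(symVolume d)
      = ENNReal.ofReal (s ^ d) * ∫⁻ u, ∫⁻ W, F (border s (s • u) W) ∂(symVolume d) :=
        lintegral_smul_pi hs
    _ = ENNReal.ofReal (s ^ d) * ∫⁻ u, ∫⁻ S, ENNReal.ofReal (A S) *
          ENNReal.ofReal (E S (u - c)) ∂(posDefVolume d) := by
        congr 1
        refine lintegral_congr fun u => ?_
        rw [← lintegral_symVolume_add (F := fun W => F (border s (s • u) W)) (by fun_prop)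
          (hsymm u), posDefVolume, ← lintegral_indicator (measurableSet_posDef d)]
        exact lintegral_congr fun S => hFval u S
    _ = ENNReal.ofReal (s ^ d) * ∫⁻ S, ENNReal.ofReal (A S) *
          (∫⁻ u, ENNReal.ofReal (E S (u - c))) ∂(posDefVolume d) := by
        congr 1
        rw [lintegral_lintegral_swap]
        · refine lintegral_congr fun S => ?_
          rw [lintegral_const_mul]
          exact (hEm.comp (measurable_id.prodMk measurable_const)).ennreal_ofReal
        · exact ((hAm.comp measurable_snd).ennreal_ofReal.mul hEm.ennreal_ofReal).aemeasurable
    _ = ∫⁻ S, ENNReal.ofReal (s ^ (-((m - d) / 2) - 1) * Real.exp (-(ψ / 2 / s))) *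
          (ENNReal.ofReal ((2 * Real.pi) ^ ((d : ℝ) / 2) * ψ ^ (-((d : ℝ) / 2))) *
          ENNReal.ofReal (S.det ^ (-((m + d + 1) / 2)) *
            Real.exp (-(1 / 2) * (P * S⁻¹).trace))) ∂(posDefVolume d) := by
        rw [← lintegral_const_mul']
        swap
        · exact ENNReal.ofReal_ne_top
        refine setLIntegral_congr_fun (measurableSet_posDef d) fun S hS => ?_
        have hS : S.PosDef := hS
        have hdet := hS.det_pos
        have hApos : 0 ≤ A S := by positivity
        rw [hgauss S hS, ← ENNReal.ofReal_mul hApos, ← ENNReal.ofReal_mul (by positivity),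
          ← ENNReal.ofReal_mul (by positivity), ← ENNReal.ofReal_mul (by positivity)]
        congr 1
        simp only [hA]
        rw [Real.mul_rpow hs.le hdet.le,
          Real.mul_rpow (x := ψ ^ d) (by positivity) (by positivity),
          Real.inv_rpow hdet.le, ← Real.rpow_neg hdet.le, neg_neg, ← Real.rpow_natCast ψ,
          ← Real.rpow_mul hψ.le,
          show -((m + (d + 1 : ℕ) + 1) / 2) = -((m - d) / 2) - 1 - d by push_cast; ring,
          Real.rpow_sub hs, Real.rpow_natCast,
          show -((m + d + 1) / 2) = (-((m - d) / 2) - 1 - d) + 1 / 2 by ring,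
          Real.rpow_add hdet, show -(1 / 2) * (ψ / s) = -(ψ / 2 / s) by ring,
          show (d : ℝ) * (-(1 / 2)) = -((d : ℝ) / 2) by ring]
        field_simp
    _ = _ := by
        rw [lintegral_const_mul' _ _ ENNReal.ofReal_ne_top,
          lintegral_const_mul' _ _ ENNReal.ofReal_ne_top]

/-- The normalizing constant of the inverse Wishart distribution. -/
lemma lintegral_inverse_wishart_kernel {d : ℕ} {m : ℝ} (hm : (d : ℝ) - 1 < m)
    {Ψ : Matrix (Fin d) (Fin d) ℝ} (hΨ : Ψ.PosDef) :
    ∫⁻ w, ENNReal.ofReal (w.det ^ (-((m + d + 1) / 2)) *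
        Real.exp (-(1 / 2) * (Ψ * w⁻¹).trace)) ∂(posDefVolume d) =
      ENNReal.ofReal (2 ^ (m * d / 2) * Real.pi ^ ((d : ℝ) * ((d : ℝ) - 1) / 4) *
        Ψ.det ^ (-(m / 2)) * ∏ i ∈ Finset.Icc 1 d, Real.Gamma ((m + 1 - (i : ℝ)) / 2)) := by
  induction d with
  | zero => rw [lintegral_inverse_wishart_zero]; simp [Matrix.trace]
  | succ d ih =>
    push_cast at hm
    have hm' : (d : ℝ) < m := by linarith
    set ψ : ℝ := Ψ 0 0 with hψdef
    have hψ : 0 < ψ := hΨ.diag_pos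
    set c : Fin d → ℝ := fun j => ψ⁻¹ * Ψ 0 j.succ with hc
    set P : Matrix (Fin d) (Fin d) ℝ :=
      Ψ.submatrix Fin.succ Fin.succ - ψ • Matrix.vecMulVec c c with hP
    have hΨeq : Ψ = border ψ (ψ • c) (P + ψ • Matrix.vecMulVec c c) := by
      have hsym : Ψᵀ = Ψ := by
        rw [← Matrix.conjTranspose_eq_transpose_of_trivial]; exact hΨ.isHermitian.eq
      rw [hP, sub_add_cancel]
      conv_lhs => rw [border_eq_of_transpose_eq hsym]
      congr 1
      ext j
      simp [hc, hψ.ne']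
    have hPpos : P.PosDef := ((posDef_border_conj_iff ψ c P).1 (hΨeq ▸ hΨ)).2
    have hdetP := hPpos.det_pos
    have hdet : Ψ.det = ψ * P.det := by rw [hΨeq, det_border_conj]
    have hFm : Measurable ({w : Matrix (Fin (d + 1)) (Fin (d + 1)) ℝ | w.PosDef}.indicator
        (fun w => ENNReal.ofReal (w.det ^ (-((m + (d + 1 : ℕ) + 1) / 2)) *
          Real.exp (-(1 / 2) * (Ψ * w⁻¹).trace)))) := by
      refine Measurable.indicator ?_ (measurableSet_posDef (d + 1))
      fun_prop
    rw [posDefVolume, ← lintegral_indicator (measurableSet_posDef _), lintegral_symVolume_succ hFm]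
    set I := ∫⁻ S, ENNReal.ofReal (S.det ^ (-((m + d + 1) / 2)) *
        Real.exp (-(1 / 2) * (P * S⁻¹).trace)) ∂(posDefVolume d) with hI
    have hcorner : ∀ s : ℝ, ∫⁻ v, ∫⁻ W,
        {w : Matrix (Fin (d + 1)) (Fin (d + 1)) ℝ | w.PosDef}.indicator
        (fun w => ENNReal.ofReal (w.det ^ (-((m + (d + 1 : ℕ) + 1) / 2)) *
          Real.exp (-(1 / 2) * (Ψ * w⁻¹).trace))) (border s v W) ∂(symVolume d) =
        (Ioi (0 : ℝ)).indicator (fun s =>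
          ENNReal.ofReal (s ^ (-((m - d) / 2) - 1) * Real.exp (-(ψ / 2 / s))) *
          (ENNReal.ofReal ((2 * Real.pi) ^ ((d : ℝ) / 2) * ψ ^ (-((d : ℝ) / 2))) * I)) s := by
      intro s
      by_cases hs : 0 < s
      · rw [indicator_of_mem (show s ∈ Ioi (0 : ℝ) from hs), hI,
          ← lintegral_inverse_wishart_corner m hψ c P hs, ← hΨeq]
      · rw [indicator_of_notMem (show s ∉ Ioi (0 : ℝ) from hs)]
        have : ∀ v W, ¬ (border (d := d) s v W).PosDef := fun v W h => hs (h.diag_pos (i := 0))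
        simp [this]
    simp only [hcorner]
    rw [lintegral_indicator measurableSet_Ioi, lintegral_mul_const _ (by fun_prop),
      lintegral_inverse_gamma (by linarith) (by positivity), hI, ih (by linarith) hPpos]
    have hΓ : ∀ i ∈ Finset.Icc 1 d, 0 < Real.Gamma ((m + 1 - (i : ℝ)) / 2) := by
      intro i hi
      have : (i : ℝ) ≤ d := by exact_mod_cast (Finset.mem_Icc.1 hi).2
      exact Real.Gamma_pos_of_pos (by linarith)
    have hprod := Finset.prod_pos hΓ
    have hΓ' : 0 < Real.Gamma ((m - d) / 2) := Real.Gamma_pos_of_pos (by linarith)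
    rw [← ENNReal.ofReal_mul (by positivity), ← ENNReal.ofReal_mul (by positivity)]
    congr 1
    rw [Finset.prod_Icc_succ_top (by omega), hdet, Real.mul_rpow hψ.le hdetP.le,
      Real.div_rpow hψ.le zero_le_two, Real.mul_rpow zero_le_two Real.pi_pos.le]
    push_cast
    rw [show (m + 1 - ((d : ℝ) + 1)) / 2 = (m - d) / 2 by ring,
      show m * ((d : ℝ) + 1) / 2 = m * d / 2 + d / 2 + (m - d) / 2 by ring,
      show ((d : ℝ) + 1) * ((d : ℝ) + 1 - 1) / 4 = d * (d - 1) / 4 + d / 2 by ring,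
      show -(m / 2) = -((m - d) / 2) + -((d : ℝ) / 2) by ring,
      Real.rpow_add hψ, Real.rpow_add zero_lt_two, Real.rpow_add zero_lt_two,
      Real.rpow_add Real.pi_pos, Real.rpow_neg zero_le_two ((m - d) / 2)]
    have : (0 : ℝ) < 2 ^ ((m - d) / 2) := by positivity
    field_simp

lemma lintegral_invWishartDensity {d : ℕ} {m : ℝ} (hm : (d : ℝ) - 1 < m)
    {Θ : Matrix (Fin d) (Fin d) ℝ} (hΘ : Θ.PosDef) :
    ∫⁻ w, ENNReal.ofReal (invWishartDensity m Θ w) ∂(posDefVolume d) = 1 := by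
  have hΓ : ∀ i ∈ Finset.Icc 1 d, 0 < Real.Gamma ((m + 1 - (i : ℝ)) / 2) := by
    intro i hi
    have : (i : ℝ) ≤ d := by exact_mod_cast (Finset.mem_Icc.1 hi).2
    exact Real.Gamma_pos_of_pos (by linarith)
  have hprod := Finset.prod_pos hΓ
  have hdet := hΘ.det_pos
  set D : ℝ := 2 ^ (m * d / 2) * Real.pi ^ ((d : ℝ) * ((d : ℝ) - 1) / 4) * Θ.det ^ (m / 2) *
      ∏ i ∈ Finset.Icc 1 d, Real.Gamma ((m + 1 - (i : ℝ)) / 2) with hD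
  have hDpos : 0 < D := by positivity
  have h1 : ∀ w, ENNReal.ofReal (invWishartDensity m Θ w) =
      ENNReal.ofReal D⁻¹ * ENNReal.ofReal (w.det ^ (-((m + d + 1) / 2)) *
        Real.exp (-(1 / 2) * (Θ⁻¹ * w⁻¹).trace)) := by
    intro w
    rw [← ENNReal.ofReal_mul (by positivity), invWishartDensity, ← hD, div_eq_inv_mul]
  simp only [h1]
  rw [lintegral_const_mul' _ _ ENNReal.ofReal_ne_top, lintegral_inverse_wishart_kernel hm hΘ.inv,
    Matrix.det_nonsing_inv, Ring.inverse_eq_inv', Real.inv_rpow hdet.le, ← Real.rpow_neg hdet.le,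
    neg_neg, ← hD, ← ENNReal.ofReal_mul (by positivity), inv_mul_cancel₀ hDpos.ne',
    ENNReal.ofReal_one]

/-! ### Weighted Gram matrices -/

/-- The weighted Gram matrix `Uᵀ diag(z) U`. -/
def gram {n : ℕ} {κ : Type*} (U : Matrix (Fin n) κ ℝ) (z : Fin n → ℝ) : Matrix κ κ ℝ :=
  Uᵀ * Matrix.diagonal z * U

section Gram

variable {n : ℕ} {κ : Type*} [Fintype κ] [DecidableEq κ]

omit [DecidableEq κ] in
lemma gram_posSemidef (U : Matrix (Fin n) κ ℝ) {z : Fin n → ℝ} (hz : ∀ i, 0 ≤ z i) :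
    (gram U z).PosSemidef := by
  have h : (Matrix.diagonal z).PosSemidef := Matrix.PosSemidef.diagonal hz
  have := h.conjTranspose_mul_mul_same U
  rwa [Matrix.conjTranspose_eq_transpose_of_trivial] at this

omit [DecidableEq κ] in
lemma gram_posDef {U : Matrix (Fin n) κ ℝ} (hU : Function.Injective U.mulVec) {z : Fin n → ℝ}
    (hz : ∀ i, 0 < z i) : (gram U z).PosDef := by
  have h : (Matrix.diagonal z).PosDef := Matrix.PosDef.diagonal hz
  have := h.conjTranspose_mul_mul_same hU
  rwa [Matrix.conjTranspose_eq_transpose_of_trivial] at this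

omit [Fintype κ] [DecidableEq κ] in
lemma gram_apply (U : Matrix (Fin n) κ ℝ) (z : Fin n → ℝ) (j l : κ) :
    gram U z j l = ∑ x, U x j * z x * U x l := by
  rw [gram, Matrix.mul_apply]
  simp only [Matrix.mul_diagonal, Matrix.transpose_apply]

omit [Fintype κ] [DecidableEq κ] in
lemma gram_update (U : Matrix (Fin n) κ ℝ) (z : Fin n → ℝ) (i : Fin n) (t : ℝ) :
    gram U (Function.update z i ((1 - t) * z i)) =
      gram U z - (t * z i) • Matrix.vecMulVec (U i) (U i) := by
  ext j l
  simp only [gram_apply, Matrix.sub_apply, Matrix.smul_apply, Matrix.vecMulVec_apply, smul_eq_mul]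
  rw [← Finset.sum_erase_add _ _ (Finset.mem_univ i),
    ← Finset.sum_erase_add (a := i) (f := fun x => U x j * z x * U x l) _ (Finset.mem_univ i)]
  have : ∀ x ∈ Finset.univ.erase i,
      U x j * Function.update z i ((1 - t) * z i) x * U x l = U x j * z x * U x l := by
    intro x hx
    rw [Function.update_of_ne (Finset.ne_of_mem_erase hx)]
  rw [Finset.sum_congr rfl this, Function.update_self]
  ring

lemma det_sub_smul_vecMulVec {M : Matrix κ κ ℝ} (hM : M.PosDef) (v : κ → ℝ) (s : ℝ) :
    (M - s • Matrix.vecMulVec v v).det = M.det * (1 - s * (v ⬝ᵥ (M⁻¹ *ᵥ v))) := by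
  have h := Matrix.det_add_replicateCol_mul_replicateRow (ι := Unit) (A := M)
    (Ne.isUnit hM.det_pos.ne') (-(s • v)) v
  have h1 : M - s • Matrix.vecMulVec v v =
      M + Matrix.replicateCol Unit (-(s • v)) * Matrix.replicateRow Unit v := by
    ext i j
    simp [Matrix.mul_apply, Matrix.vecMulVec_apply]
    ring
  rw [h1, h, Matrix.det_unique (n := Unit)]
  congr 1
  rw [Matrix.mul_assoc, Matrix.add_apply, Matrix.one_apply_eq, Matrix.mul_apply, sub_eq_add_neg]
  congr 1
  simp only [Matrix.replicateRow_apply, Matrix.mul_apply, Matrix.replicateCol_apply, dotProduct,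
    Matrix.mulVec, Finset.mul_sum, Pi.neg_apply, Pi.smul_apply, smul_eq_mul]
  rw [← Finset.sum_neg_distrib]
  refine Finset.sum_congr rfl fun i _ => ?_
  rw [← Finset.sum_neg_distrib]
  exact Finset.sum_congr rfl fun j _ => by ring

/-- Shrinking one weight by the factor `1 - t` shrinks the Gram determinant at most by this
factor, since the determinant is an affine function of each weight. -/
lemma det_gram_update {U : Matrix (Fin n) κ ℝ} (hU : Function.Injective U.mulVec)
    {z : Fin n → ℝ} (hz : ∀ i, 0 < z i) (i : Fin n) {t : ℝ} (ht0 : 0 ≤ t) :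
    (1 - t) * (gram U z).det ≤ (gram U (Function.update z i ((1 - t) * z i))).det ∧
      (gram U (Function.update z i ((1 - t) * z i))).det ≤ (gram U z).det := by
  have hM := gram_posDef hU hz
  have hq : 0 ≤ U i ⬝ᵥ ((gram U z)⁻¹ *ᵥ U i) := by
    simpa using hM.inv.posSemidef.dotProduct_mulVec_nonneg (U i)
  -- semidefiniteness at `t = 1` bounds the slope of the determinant in the weight `z i`
  have h0 : 0 ≤ (gram U (Function.update z i ((1 - 1) * z i))).det := by
    refine (gram_posSemidef U fun j => ?_).det_nonneg
    rcases eq_or_ne j i with rfl | hj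
    · simp
    · rw [Function.update_of_ne hj]; exact (hz j).le
  rw [gram_update, det_sub_smul_vecMulVec hM] at h0 ⊢
  have hdet := hM.det_pos
  have h1 : z i * (U i ⬝ᵥ ((gram U z)⁻¹ *ᵥ U i)) ≤ 1 := by
    have := nonneg_of_mul_nonneg_right h0 hdet
    linarith
  have h2 : 0 ≤ z i * (U i ⬝ᵥ ((gram U z)⁻¹ *ᵥ U i)) := mul_nonneg (hz i).le hq
  constructor
  · rw [mul_comm]
    refine mul_le_mul_of_nonneg_left ?_ hdet.le
    nlinarith
  · refine mul_le_of_le_one_right hdet.le ?_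
    nlinarith

end Gram

/-! ### The conditional distribution of the parameters given the latent variables -/

section Param

variable {n p d : ℕ} {X : Matrix (Fin n) (Fin p) ℝ} {y : Matrix (Fin n) (Fin d) ℝ}

lemma injective_mulVec_fromCols (h : (Matrix.fromCols X y).rank = p + d) :
    Function.Injective (Matrix.fromCols X y).mulVec := by
  have h1 := (Matrix.fromCols X y).mulVecLin.finrank_range_add_finrank_ker
  rw [Module.finrank_pi, Fintype.card_sum, Fintype.card_fin, Fintype.card_fin] at h1
  have h2 : Module.finrank ℝ (LinearMap.ker (Matrix.fromCols X y).mulVecLin) = 0 := by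
    rw [Matrix.rank] at h
    omega
  have h3 := Submodule.finrank_eq_zero.1 h2
  exact LinearMap.ker_eq_bot.1 h3

lemma inv_Qmat {z : Fin n → ℝ} (hz : ∀ i, 0 < z i) : (Qmat z)⁻¹ = Matrix.diagonal z := by
  refine Matrix.inv_eq_right_inv ?_
  rw [Qmat, Matrix.diagonal_mul_diagonal, ← Matrix.diagonal_one]
  congr 1
  ext i
  exact inv_mul_cancel₀ (hz i).ne'

/-- The residual matrix `y - X μ` of the weighted least squares fit. -/
def lsResidual (X : Matrix (Fin n) (Fin p) ℝ) (y : Matrix (Fin n) (Fin d) ℝ) (z : Fin n → ℝ) :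
    Matrix (Fin n) (Fin d) ℝ :=
  y - X * muMat X y z

/-- The matrix `yᵀ Q⁻¹ y - μᵀ Ω⁻¹ μ`. -/
def schurMat (X : Matrix (Fin n) (Fin p) ℝ) (y : Matrix (Fin n) (Fin d) ℝ) (z : Fin n → ℝ) :
    Matrix (Fin d) (Fin d) ℝ :=
  yᵀ * (Qmat z)⁻¹ * y - (muMat X y z)ᵀ * (OmegaMat X z)⁻¹ * muMat X y z

variable (hinj : Function.Injective (Matrix.fromCols X y).mulVec)
include hinj

lemma injective_mulVec_left : Function.Injective X.mulVec := by
  intro v w hvw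
  have := @hinj (Sum.elim v 0) (Sum.elim w 0) (by
    rw [Matrix.fromCols_mulVec, Matrix.fromCols_mulVec]
    simpa using hvw)
  exact funext fun i => congrFun this (Sum.inl i)

lemma injective_mulVec_lsResidual (z : Fin n → ℝ) :
    Function.Injective (lsResidual X y z).mulVec := by
  intro v w hvw
  have := @hinj (Sum.elim (-(muMat X y z *ᵥ v)) v) (Sum.elim (-(muMat X y z *ᵥ w)) w) (by
    rw [Matrix.fromCols_mulVec, Matrix.fromCols_mulVec]
    simp only [Sum.elim_comp_inl, Sum.elim_comp_inr, Matrix.mulVec_neg, Matrix.mulVec_mulVec]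
    simp only [lsResidual, Matrix.sub_mulVec] at hvw
    rw [neg_add_eq_sub, neg_add_eq_sub]
    exact hvw)
  exact funext fun i => congrFun this (Sum.inr i)

variable {z : Fin n → ℝ} (hz : ∀ i, 0 < z i)
include hz

lemma posDef_gram_left : (gram X z).PosDef := gram_posDef (injective_mulVec_left hinj) hz

lemma gram_mul_muMat : gram X z * muMat X y z = Xᵀ * Matrix.diagonal z * y := by
  have h := (posDef_gram_left hinj hz).det_pos.ne'
  rw [muMat, inv_Qmat hz]
  change gram X z * ((gram X z)⁻¹ * Xᵀ * Matrix.diagonal z * y) = _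
  rw [Matrix.mul_assoc (gram X z)⁻¹, Matrix.mul_assoc (gram X z)⁻¹, ← Matrix.mul_assoc,
    Matrix.mul_nonsing_inv _ (Ne.isUnit h), Matrix.one_mul]

omit hinj in
lemma OmegaMat_eq : OmegaMat X z = (gram X z)⁻¹ := by
  rw [OmegaMat, inv_Qmat hz, gram]

lemma inv_OmegaMat : (OmegaMat X z)⁻¹ = gram X z := by
  rw [OmegaMat_eq hz, Matrix.nonsing_inv_nonsing_inv _
    (Ne.isUnit (posDef_gram_left hinj hz).det_pos.ne')]

/-- The normal equations. -/
lemma transpose_mul_lsResidual : Xᵀ * Matrix.diagonal z * lsResidual X y z = 0 := by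
  rw [lsResidual, Matrix.mul_sub, ← gram_mul_muMat hinj hz, gram, ← Matrix.mul_assoc, sub_self]

/-- The scale matrix of the inverse Wishart step is the weighted residual sum of squares. -/
lemma schurMat_eq_gram : schurMat X y z = gram (lsResidual X y z) z := by
  have h := transpose_mul_lsResidual hinj hz
  have h1 : gram (lsResidual X y z) z = yᵀ * Matrix.diagonal z * lsResidual X y z := by
    rw [gram]
    conv_lhs => rw [show (lsResidual X y z)ᵀ = yᵀ - (muMat X y z)ᵀ * Xᵀ by
      rw [lsResidual, Matrix.transpose_sub, Matrix.transpose_mul]]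
    rw [Matrix.sub_mul, Matrix.sub_mul, Matrix.mul_assoc (muMat X y z)ᵀ,
      Matrix.mul_assoc (muMat X y z)ᵀ, h, Matrix.mul_zero, sub_zero]
  have h2 : (muMat X y z)ᵀ * gram X z = yᵀ * Matrix.diagonal z * X := by
    have h3 : (gram X z)ᵀ = gram X z := by
      simp [gram, Matrix.mul_assoc]
    have := congrArg Matrix.transpose (gram_mul_muMat hinj hz)
    rw [Matrix.transpose_mul, h3] at this
    rw [this]
    simp [Matrix.mul_assoc]
  rw [schurMat, inv_OmegaMat hinj hz, inv_Qmat hz, h1, h2, lsResidual, Matrix.mul_sub,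
    Matrix.mul_assoc (yᵀ * Matrix.diagonal z)]

lemma posDef_schurMat : (schurMat X y z).PosDef := by
  rw [schurMat_eq_gram hinj hz]
  exact gram_posDef (injective_mulVec_lsResidual hinj z) hz

/-- The Schur complement formula for the weighted Gram matrix of `(X : y)`. -/
lemma det_gram_fromCols :
    (gram (Matrix.fromCols X y) z).det = (gram X z).det * (schurMat X y z).det := by
  have hG := posDef_gram_left hinj hz
  let _ := Matrix.invertibleOfIsUnitDet (gram X z) (Ne.isUnit hG.det_pos.ne')
  have h1 : gram (Matrix.fromCols X y) z = Matrix.fromBlocks (gram X z)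
      (Xᵀ * Matrix.diagonal z * y) (yᵀ * Matrix.diagonal z * X) (yᵀ * Matrix.diagonal z * y) := by
    rw [gram, Matrix.transpose_fromCols, Matrix.fromRows_mul, Matrix.fromRows_mul_fromCols, gram]
  rw [h1, Matrix.det_fromBlocks₁₁, schurMat_eq_gram hinj hz, Matrix.invOf_eq_nonsing_inv,
    ← schurMat_eq_gram hinj hz, schurMat, inv_OmegaMat hinj hz, inv_Qmat hz,
    Matrix.mul_assoc _ (gram X z), gram_mul_muMat hinj hz]
  congr 3
  have h3 : ((gram X z)⁻¹)ᵀ = (gram X z)⁻¹ := by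
    rw [← Matrix.conjTranspose_eq_transpose_of_trivial]; exact hG.inv.isHermitian.eq
  rw [show muMat X y z = (gram X z)⁻¹ * Xᵀ * Matrix.diagonal z * y by
    rw [muMat, inv_Qmat hz, gram]]
  simp only [Matrix.transpose_mul, h3, Matrix.transpose_transpose, Matrix.diagonal_transpose,
    Matrix.mul_assoc]

omit hinj hz in
lemma residualForm_eq (θ : State p d) (i : Fin n) :
    residualForm X y θ i = ((X * θ.1 - y) * θ.2⁻¹ * (X * θ.1 - y)ᵀ) i i := by
  have h : θ.1ᵀ *ᵥ X i - y i = (X * θ.1 - y) i := by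
    ext j
    simp [Matrix.mulVec, dotProduct, Matrix.mul_apply, mul_comm]
  rw [residualForm, h, Matrix.dotProduct_mulVec]
  rfl

omit hinj hz in
lemma sum_mul_residualForm_eq (θ : State p d) (z : Fin n → ℝ) :
    ∑ i, z i * residualForm X y θ i = (gram (X * θ.1 - y) z * θ.2⁻¹).trace := by
  rw [gram, Matrix.mul_assoc, Matrix.mul_assoc, Matrix.trace_mul_comm, Matrix.mul_assoc,
    Matrix.trace]
  simp only [Matrix.diag_apply, Matrix.diagonal_mul, residualForm_eq]

/-- Completing the square in `β`. -/
lemma sum_mul_residualForm (θ : State p d) :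
    ∑ i, z i * residualForm X y θ i =
      (gram X z * (θ.1 - muMat X y z) * θ.2⁻¹ * (θ.1 - muMat X y z)ᵀ).trace +
        (schurMat X y z * θ.2⁻¹).trace := by
  have hn := transpose_mul_lsResidual hinj hz
  have hn' : (lsResidual X y z)ᵀ * (Matrix.diagonal z * X) = 0 := by
    have := congrArg Matrix.transpose hn
    simpa [Matrix.mul_assoc] using this
  have h1 : X * θ.1 - y = X * (θ.1 - muMat X y z) - lsResidual X y z := by
    rw [lsResidual, Matrix.mul_sub]; abel
  have h2 : gram (X * θ.1 - y) z =
      (θ.1 - muMat X y z)ᵀ * gram X z * (θ.1 - muMat X y z) + schurMat X y z := by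
    rw [h1, schurMat_eq_gram hinj hz]
    set δ := θ.1 - muMat X y z
    set ρ := lsResidual X y z
    have e1 : gram (X * δ - ρ) z = δᵀ * (Xᵀ * Matrix.diagonal z * X) * δ -
        δᵀ * (Xᵀ * Matrix.diagonal z * ρ) - ρᵀ * (Matrix.diagonal z * X) * δ +
        ρᵀ * Matrix.diagonal z * ρ := by
      rw [gram, Matrix.transpose_sub, Matrix.transpose_mul]
      simp only [Matrix.sub_mul, Matrix.mul_sub, Matrix.mul_assoc]
      abel
    rw [e1, hn, hn']
    simp [gram]
  rw [sum_mul_residualForm_eq, h2, Matrix.add_mul, Matrix.trace_add]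
  congr 1
  rw [Matrix.mul_assoc, Matrix.mul_assoc, Matrix.trace_mul_comm]
  simp only [Matrix.mul_assoc]

end Param

/-! ### The conditional density of the parameters and its moments -/

section ParamDensity

/-- The exponential kernel `|Σ|^(-(n + 2a)/2) exp(-½ ∑ zᵢ rᵢ)`, proportional to the conditional
density of `(β, Σ)` given the latent variables `z`. -/
def paramKernel {n p d : ℕ} (a : ℝ) (X : Matrix (Fin n) (Fin p) ℝ) (y : Matrix (Fin n) (Fin d) ℝ)
    (z : Fin n → ℝ) (θ : State p d) : ℝ :=
  θ.2.det ^ (-((n + 2 * a) / 2)) * Real.exp (-(1 / 2) * ∑ i, z i * residualForm X y θ i)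

/-- The factor of the normalizing constant of `paramKernel` that does not depend on `z`. -/
def paramConst (n p d : ℕ) (a : ℝ) : ℝ :=
  (2 * Real.pi) ^ ((p : ℝ) * d / 2) * (2 ^ (((n : ℝ) - p + 2 * a - d - 1) * d / 2) *
    Real.pi ^ ((d : ℝ) * ((d : ℝ) - 1) / 4) *
      ∏ i ∈ Finset.Icc 1 d, Real.Gamma (((n : ℝ) - p + 2 * a - d - 1 + 1 - (i : ℝ)) / 2))

/-- The normalizing constant of `paramKernel`. -/
def paramNorm {n p d : ℕ} (a : ℝ) (X : Matrix (Fin n) (Fin p) ℝ) (y : Matrix (Fin n) (Fin d) ℝ)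
    (z : Fin n → ℝ) : ℝ :=
  paramConst n p d a * (gram X z).det ^ (-((d : ℝ) / 2)) *
    (schurMat X y z).det ^ (-(((n : ℝ) - p + 2 * a - d - 1) / 2))

variable {n p d : ℕ} {a : ℝ} {X : Matrix (Fin n) (Fin p) ℝ} {y : Matrix (Fin n) (Fin d) ℝ}

@[fun_prop]
lemma measurable_residualForm {α : Type*} [MeasurableSpace α] {f : α → State p d}
    (hf : Measurable f) (i : Fin n) : Measurable fun x => residualForm X y (f x) i := by
  unfold residualForm
  fun_prop

@[fun_prop]
lemma measurable_Qmat : Measurable (Qmat (n := n)) := by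
  refine measurable_matrix_iff.2 fun i j => ?_
  unfold Qmat
  rcases eq_or_ne i j with rfl | h
  · simp only [Matrix.diagonal_apply_eq]
    fun_prop
  · simp only [Matrix.diagonal_apply_ne _ h]
    fun_prop

@[fun_prop]
lemma measurable_muMat : Measurable (muMat X y) := by
  unfold muMat
  fun_prop

@[fun_prop]
lemma measurable_OmegaMat : Measurable (OmegaMat X) := by
  unfold OmegaMat
  fun_prop

@[fun_prop]
lemma measurable_paramDensity {α : Type*} [MeasurableSpace α] {f : α → Fin n → ℝ}
    {g : α → State p d} (hf : Measurable f) (hg : Measurable g) :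
    Measurable fun x => paramDensity a X y (f x) (g x) := by
  unfold paramDensity matrixNormalDensity invWishartDensity
  fun_prop

lemma residualForm_nonneg {θ : State p d} (hθ : θ ∈ stateSpace p d) (i : Fin n) :
    0 ≤ residualForm X y θ i := by
  have := (Matrix.PosDef.inv hθ).posSemidef.dotProduct_mulVec_nonneg (θ.1ᵀ *ᵥ X i - y i)
  simpa [residualForm] using this

lemma ae_mem_stateSpace (p d : ℕ) : ∀ᵐ θ ∂(stateVolume p d), θ ∈ stateSpace p d := by
  have h : ∀ᵐ S ∂(posDefVolume d), S.PosDef := ae_restrict_mem (measurableSet_posDef d)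
  exact Measure.quasiMeasurePreserving_snd.ae h

instance (p d : ℕ) : SFinite (stateVolume p d) := by
  unfold stateVolume; infer_instance

lemma paramConst_pos (hm : (d : ℝ) - 1 < (n : ℝ) - p + 2 * a - d - 1) :
    0 < paramConst n p d a := by
  have hΓ : ∀ i ∈ Finset.Icc 1 d,
      0 < Real.Gamma (((n : ℝ) - p + 2 * a - d - 1 + 1 - (i : ℝ)) / 2) := by
    intro i hi
    have : (i : ℝ) ≤ d := by exact_mod_cast (Finset.mem_Icc.1 hi).2
    exact Real.Gamma_pos_of_pos (by linarith)
  have := Finset.prod_pos hΓ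
  unfold paramConst
  positivity

variable (hm : (d : ℝ) - 1 < (n : ℝ) - p + 2 * a - d - 1)
  (hinj : Function.Injective (Matrix.fromCols X y).mulVec) {z : Fin n → ℝ} (hz : ∀ i, 0 < z i)
include hm hinj hz

lemma paramNorm_pos : 0 < paramNorm a X y z := by
  have h1 := (posDef_gram_left hinj hz).det_pos
  have h2 := (posDef_schurMat hinj hz).det_pos
  have h3 := paramConst_pos hm
  unfold paramNorm
  positivity

omit hm in
/-- Steps 2 and 3 together draw from the normalized `paramKernel`. -/
lemma paramDensity_eq {θ : State p d} (hθ : θ ∈ stateSpace p d) :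
    paramDensity a X y z θ = ENNReal.ofReal (paramKernel a X y z θ / paramNorm a X y z) := by
  have hG := posDef_gram_left hinj hz
  have hS := posDef_schurMat hinj hz
  have hdet : 0 < θ.2.det := Matrix.PosDef.det_pos hθ
  have hGdet := hG.det_pos
  have hSdet := hS.det_pos
  have hN : 0 ≤ matrixNormalDensity (muMat X y z) (OmegaMat X z) θ.2 θ.1 := by
    rw [matrixNormalDensity, OmegaMat_eq hz]
    have := hG.inv.det_pos
    positivity
  rw [paramDensity, ← ENNReal.ofReal_mul hN]
  congr 1
  change matrixNormalDensity (muMat X y z) (OmegaMat X z) θ.2 θ.1 *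
    invWishartDensity _ (schurMat X y z)⁻¹ θ.2 = _
  rw [matrixNormalDensity, invWishartDensity, paramKernel, paramNorm, paramConst,
    inv_OmegaMat hinj hz, OmegaMat_eq hz,
    Matrix.nonsing_inv_nonsing_inv _ (Ne.isUnit hSdet.ne'), sum_mul_residualForm hinj hz,
    Matrix.det_nonsing_inv, Matrix.det_nonsing_inv, Ring.inverse_eq_inv',
    Real.inv_rpow hGdet.le, Real.inv_rpow hSdet.le, Real.rpow_neg hGdet.le,
    Real.rpow_neg hSdet.le, mul_add, Real.exp_add,
    show -(((n : ℝ) + 2 * a) / 2) =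
      -(((n : ℝ) - p + 2 * a - d - 1 + d + 1) / 2) + -((p : ℝ) / 2) by ring,
    Real.rpow_add hdet, Real.rpow_neg hdet.le ((p : ℝ) / 2)]
  simp only [div_eq_mul_inv, mul_inv]
  ring

lemma lintegral_paramDensity : ∫⁻ θ, paramDensity a X y z θ ∂(stateVolume p d) = 1 := by
  have hG := posDef_gram_left hinj hz
  have hS := posDef_schurMat hinj hz
  have hmeas : Measurable (paramDensity a X y z) := by fun_prop
  have hΩ : (OmegaMat X z).PosDef := by rw [OmegaMat_eq hz]; exact hG.inv
  have hae : ∀ᵐ S ∂(posDefVolume d), S.PosDef := ae_restrict_mem (measurableSet_posDef d)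
  have h1 : ∀ S : Matrix (Fin d) (Fin d) ℝ, S.PosDef →
      ∫⁻ β, paramDensity a X y z (β, S) ∂(matrixVolume p d) =
        ENNReal.ofReal (invWishartDensity ((n : ℝ) - p + 2 * a - d - 1) (schurMat X y z)⁻¹ S) := by
    intro S hS'
    have h2 := lintegral_matrixNormalDensity (muMat X y z) hΩ hS'
    simp only [paramDensity]
    rw [lintegral_mul_const' _ _ ENNReal.ofReal_ne_top, h2, one_mul, schurMat]
  calc ∫⁻ θ, paramDensity a X y z θ ∂(stateVolume p d)
      = ∫⁻ S, ∫⁻ β, paramDensity a X y z (β, S) ∂(matrixVolume p d) ∂(posDefVolume d) :=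
        lintegral_prod_symm _ hmeas.aemeasurable
    _ = ∫⁻ S, ENNReal.ofReal (invWishartDensity ((n : ℝ) - p + 2 * a - d - 1)
          (schurMat X y z)⁻¹ S) ∂(posDefVolume d) := lintegral_congr_ae (hae.mono h1)
    _ = 1 := lintegral_invWishartDensity hm hS.inv

lemma lintegral_paramKernel :
    ∫⁻ θ, ENNReal.ofReal (paramKernel a X y z θ) ∂(stateVolume p d) =
      ENNReal.ofReal (paramNorm a X y z) := by
  have hC := paramNorm_pos hm hinj hz
  have h1 : ∫⁻ θ, ENNReal.ofReal (paramKernel a X y z θ) ∂(stateVolume p d) =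
      ∫⁻ θ, ENNReal.ofReal (paramNorm a X y z) * paramDensity a X y z θ ∂(stateVolume p d) := by
    refine lintegral_congr_ae ((ae_mem_stateSpace p d).mono fun θ hθ => ?_)
    simp only
    rw [paramDensity_eq hinj hz hθ, ← ENNReal.ofReal_mul hC.le, mul_div_cancel₀ _ hC.ne']
  rw [h1, lintegral_const_mul' _ _ ENNReal.ofReal_ne_top, lintegral_paramDensity hm hinj hz,
    mul_one]

/-- Shrinking one latent variable by `1 - t` increases the normalizing constant at most by the
factor `(1 - t)^(-(m + d)/2)`. -/
lemma paramNorm_update_le (hm0 : 0 ≤ (n : ℝ) - p + 2 * a - d - 1) (i : Fin n) {t : ℝ}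
    (ht0 : 0 ≤ t) (ht1 : t < 1) :
    paramNorm a X y (Function.update z i ((1 - t) * z i)) ≤
      (1 - t) ^ (-(((n : ℝ) - p + 2 * a - 1) / 2)) * paramNorm a X y z := by
  set m : ℝ := (n : ℝ) - p + 2 * a - d - 1 with hmdef
  set z' := Function.update z i ((1 - t) * z i) with hz'def
  have ht : 0 < 1 - t := by linarith
  have hz' : ∀ j, 0 < z' j := by
    intro j
    rcases eq_or_ne j i with rfl | hj
    · rw [hz'def, Function.update_self]; exact mul_pos ht (hz j)
    · rw [hz'def, Function.update_of_ne hj]; exact hz j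
  have hX := (posDef_gram_left hinj hz).det_pos
  have hX' := (posDef_gram_left hinj hz').det_pos
  have hS := (posDef_schurMat hinj hz).det_pos
  have hS' := (posDef_schurMat hinj hz').det_pos
  obtain ⟨hX1, hX2⟩ := det_gram_update (injective_mulVec_left hinj) hz i ht0
  obtain ⟨hW1, -⟩ := det_gram_update hinj hz i ht0
  rw [← hz'def] at hX1 hX2 hW1
  rw [det_gram_fromCols hinj hz, det_gram_fromCols hinj hz'] at hW1
  have hS1 : (1 - t) * (schurMat X y z).det ≤ (schurMat X y z').det := by
    refine le_of_mul_le_mul_left ?_ hX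
    calc _ = (1 - t) * ((gram X z).det * (schurMat X y z).det) := by ring
      _ ≤ (gram X z').det * (schurMat X y z').det := hW1
      _ ≤ _ := by gcongr
  have hK := paramConst_pos hm
  calc paramNorm a X y z'
      ≤ paramConst n p d a * ((1 - t) * (gram X z).det) ^ (-((d : ℝ) / 2)) *
        ((1 - t) * (schurMat X y z).det) ^ (-(m / 2)) := by
        unfold paramNorm
        gcongr ?_ * ?_ * ?_
        · exact Real.rpow_le_rpow_of_nonpos (by positivity) hX1
            (by rw [neg_nonpos]; positivity)
        · exact Real.rpow_le_rpow_of_nonpos (by positivity) hS1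
            (by rw [neg_nonpos]; positivity)
    _ = _ := by
        rw [Real.mul_rpow ht.le hX.le, Real.mul_rpow ht.le hS.le, paramNorm,
          show -(((n : ℝ) - p + 2 * a - 1) / 2) = -((d : ℝ) / 2) + -(m / 2) by
            rw [hmdef]; ring, Real.rpow_add ht]
        ring

/-- A bound for the conditional mean of `rᵢ` given `z`, obtained from the Laplace transform
`E[exp(t zᵢ rᵢ / 2) | z]`, which is a ratio of normalizing constants. -/
lemma lintegral_residualForm_mul_paramDensity_le (hm0 : 0 ≤ (n : ℝ) - p + 2 * a - d - 1)
    (i : Fin n) {t : ℝ} (ht0 : 0 < t) (ht1 : t < 1) :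
    ∫⁻ θ, ENNReal.ofReal (residualForm X y θ i) * paramDensity a X y z θ ∂(stateVolume p d) ≤
      ENNReal.ofReal (2 / t * ((1 - t) ^ (-(((n : ℝ) - p + 2 * a - 1) / 2)) - 1) * (z i)⁻¹) := by
  set z' := Function.update z i ((1 - t) * z i) with hz'def
  have ht : 0 < 1 - t := by linarith
  have hz' : ∀ j, 0 < z' j := by
    intro j
    rcases eq_or_ne j i with rfl | hj
    · rw [hz'def, Function.update_self]; exact mul_pos ht (hz j)
    · rw [hz'def, Function.update_of_ne hj]; exact hz j
  have hC := paramNorm_pos hm hinj hz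
  set R : ℝ := (1 - t) ^ (-(((n : ℝ) - p + 2 * a - 1) / 2)) with hR
  set J := ∫⁻ θ, ENNReal.ofReal (residualForm X y θ i) * paramDensity a X y z θ
    ∂(stateVolume p d) with hJ
  have hzi := hz i
  set b : ℝ := t / 2 * z i with hb
  have hb0 : 0 < b := by positivity
  have hker : ∀ θ : State p d, paramKernel a X y z' θ =
      Real.exp (b * residualForm X y θ i) * paramKernel a X y z θ := by
    intro θ
    have hsum : ∑ j, z' j * residualForm X y θ j =
        ∑ j, z j * residualForm X y θ j - t * z i * residualForm X y θ i := by
      rw [← Finset.sum_erase_add _ _ (Finset.mem_univ i), ← Finset.sum_erase_add (a := i)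
        (f := fun j => z j * residualForm X y θ j) _ (Finset.mem_univ i)]
      have : ∀ j ∈ Finset.univ.erase i,
          z' j * residualForm X y θ j = z j * residualForm X y θ j := by
        intro j hj
        rw [hz'def, Function.update_of_ne (Finset.ne_of_mem_erase hj)]
      rw [Finset.sum_congr rfl this, hz'def, Function.update_self]
      ring
    rw [paramKernel, paramKernel, hsum, mul_left_comm, ← Real.exp_add]
    congr 2
    rw [hb]; ring
  have hpm : Measurable (paramDensity a X y z) := by fun_prop
  have hmain : ENNReal.ofReal b * J + 1 ≤ ENNReal.ofReal R := by
    calc ENNReal.ofReal b * J + 1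
        = ∫⁻ θ, (ENNReal.ofReal b * (ENNReal.ofReal (residualForm X y θ i) *
            paramDensity a X y z θ) + paramDensity a X y z θ) ∂(stateVolume p d) := by
          rw [lintegral_add_right _ hpm, lintegral_const_mul' _ _ ENNReal.ofReal_ne_top,
            lintegral_paramDensity hm hinj hz]
      _ ≤ ∫⁻ θ, ENNReal.ofReal (paramNorm a X y z)⁻¹ *
            ENNReal.ofReal (paramKernel a X y z' θ) ∂(stateVolume p d) := by
          refine lintegral_mono_ae ((ae_mem_stateSpace p d).mono fun θ hθ => ?_)
          have hr := residualForm_nonneg (X := X) (y := y) hθ i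
          have hk : 0 ≤ paramKernel a X y z θ := by
            have : 0 < θ.2.det := Matrix.PosDef.det_pos hθ
            unfold paramKernel
            positivity
          rw [paramDensity_eq hinj hz hθ, hker, ← ENNReal.ofReal_mul hr,
            ← ENNReal.ofReal_mul hb0.le, ← ENNReal.ofReal_add (by positivity) (by positivity),
            ← ENNReal.ofReal_mul (by positivity)]
          refine ENNReal.ofReal_le_ofReal ?_
          have hexp := Real.add_one_le_exp (b * residualForm X y θ i)
          calc _ = (b * residualForm X y θ i + 1) *
                (paramKernel a X y z θ / paramNorm a X y z) := by ring
            _ ≤ Real.exp (b * residualForm X y θ i) *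
                (paramKernel a X y z θ / paramNorm a X y z) := by gcongr
            _ = _ := by ring
      _ = ENNReal.ofReal ((paramNorm a X y z)⁻¹ * paramNorm a X y z') := by
          rw [lintegral_const_mul' _ _ ENNReal.ofReal_ne_top, lintegral_paramKernel hm hinj hz',
            ENNReal.ofReal_mul (by positivity)]
      _ ≤ ENNReal.ofReal R := by
          refine ENNReal.ofReal_le_ofReal ?_
          rw [inv_mul_le_iff₀ hC, mul_comm]
          exact paramNorm_update_le hm hinj hz hm0 i ht0.le ht1
  have h2 : ENNReal.ofReal b * J ≤ ENNReal.ofReal (R - 1) := by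
    rw [ENNReal.ofReal_sub _ zero_le_one, ENNReal.ofReal_one]
    exact ENNReal.le_sub_of_add_le_right ENNReal.one_ne_top hmain
  calc J = ENNReal.ofReal b⁻¹ * (ENNReal.ofReal b * J) := by
        rw [← mul_assoc, ← ENNReal.ofReal_mul (by positivity), inv_mul_cancel₀ hb0.ne',
          ENNReal.ofReal_one, one_mul]
    _ ≤ ENNReal.ofReal b⁻¹ * ENNReal.ofReal (R - 1) := by gcongr
    _ = _ := by
        rw [← ENNReal.ofReal_mul (by positivity)]
        congr 1
        rw [hb]
        field_simp

end ParamDensity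

/-- `(2/t) ((1 - t)^(-κ/2) - 1)` tends to `κ` as `t ↓ 0`. -/
lemma exists_laplace_parameter {κ K : ℝ} (hK : κ < K) :
    ∃ t : ℝ, 0 < t ∧ t < 1 ∧ 2 / t * ((1 - t) ^ (-(κ / 2)) - 1) ≤ K := by
  have hd : HasDerivAt (fun t : ℝ => (1 - t) ^ (-(κ / 2))) (κ / 2) 0 := by
    have h1 : HasDerivAt (fun t : ℝ => 1 - t) (-1) 0 := by
      simpa using (hasDerivAt_id (0 : ℝ)).const_sub 1
    have h2 := h1.rpow_const (p := -(κ / 2)) (Or.inl (by norm_num))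
    convert h2 using 1
    norm_num
  have h3 := (hd.tendsto_slope.mono_left (nhdsWithin_mono _ (fun x (hx : x ∈ Ioi (0:ℝ)) =>
    (ne_of_gt hx : x ≠ 0)))).eventually_lt_const (show κ / 2 < K / 2 by linarith)
  have h4 : ∀ᶠ t : ℝ in 𝓝[>] 0, t < 1 :=
    (eventually_lt_nhds one_pos).filter_mono nhdsWithin_le_nhds
  obtain ⟨t, ⟨ht, ht1⟩, ht0⟩ := ((h3.and h4).and self_mem_nhdsWithin).exists
  have ht0 : 0 < t := ht0
  refine ⟨t, ht0, ht1, ?_⟩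
  rw [slope_def_field] at ht
  simp only [sub_zero, Real.one_rpow] at ht
  have : 2 / t * ((1 - t) ^ (-(κ / 2)) - 1) = 2 * (((1 - t) ^ (-(κ / 2)) - 1) / t) := by ring
  rw [this]
  linarith

/-! ### Inverse moments of the latent variables -/

/-- The normalizing constant `∫₀^∞ u^(d/2) e^(-su/2) h(u) du` of `psi d h s`. -/
def psiNorm (d : ℕ) (h : ℝ → ℝ) (s : ℝ) : ℝ≥0∞ :=
  ∫⁻ u in Ioi (0 : ℝ), ENNReal.ofReal (u ^ ((d : ℝ) / 2) * Real.exp (-(s * u / 2)) * h u)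

/-- The integral `∫₀^∞ u^(d/2 - 1) e^(-su/2) h(u) du`. -/
def psiInvMoment (d : ℕ) (h : ℝ → ℝ) (s : ℝ) : ℝ≥0∞ :=
  ∫⁻ u in Ioi (0 : ℝ), ENNReal.ofReal u⁻¹ *
    ENNReal.ofReal (u ^ ((d : ℝ) / 2) * Real.exp (-(s * u / 2)) * h u)

section Latent

variable {d : ℕ} {h : ℝ → ℝ}

lemma psiNorm_lt_top (hh : IsMixingDensity h) (hM : ConditionM d h) {s : ℝ} (hs : 0 ≤ s) :
    psiNorm d h s < ∞ := by
  refine lt_of_le_of_lt (setLIntegral_mono' measurableSet_Ioi fun u hu => ?_) hM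
  have hu : 0 < u := hu
  have h0 := hh.nonneg u hu
  refine ENNReal.ofReal_le_ofReal ?_
  have : Real.exp (-(s * u / 2)) ≤ 1 := Real.exp_le_one_iff.2 (by rw [neg_nonpos]; positivity)
  calc _ ≤ u ^ ((d : ℝ) / 2) * 1 * h u := by gcongr
    _ = _ := by rw [mul_one]

lemma psiNorm_pos (hh : IsMixingDensity h) (s : ℝ) : 0 < psiNorm d h s := by
  have hhm := hh.measurable
  rw [pos_iff_ne_zero]
  intro h0
  rw [psiNorm, lintegral_eq_zero_iff (by fun_prop)] at h0
  have h1 : ∫⁻ u in Ioi (0 : ℝ), ENNReal.ofReal (h u) = 0 := by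
    rw [lintegral_eq_zero_iff (by fun_prop)]
    filter_upwards [h0, ae_restrict_mem measurableSet_Ioi] with u hu hu0
    have hu0 : 0 < u := hu0
    simp only [Pi.zero_apply, ENNReal.ofReal_eq_zero] at hu ⊢
    exact nonpos_of_mul_nonpos_right hu (by positivity)
  rw [hh.total] at h1
  exact one_ne_zero h1

lemma lintegral_psi (hh : IsMixingDensity h) (hM : ConditionM d h) {s : ℝ} (hs : 0 ≤ s) :
    ∫⁻ u in Ioi (0 : ℝ), psi d h s u = 1 := by
  have hhm := hh.measurable
  unfold psi
  rw [lintegral_const_mul _ (by fun_prop)]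
  exact ENNReal.inv_mul_cancel (psiNorm_pos hh s).ne' (psiNorm_lt_top hh hM hs).ne

lemma lintegral_inv_mul_psi (hh : IsMixingDensity h) (s : ℝ) :
    ∫⁻ u in Ioi (0 : ℝ), ENNReal.ofReal u⁻¹ * psi d h s u =
      (psiNorm d h s)⁻¹ * psiInvMoment d h s := by
  have hhm := hh.measurable
  rw [psiInvMoment, ← lintegral_const_mul _ (by fun_prop)]
  refine lintegral_congr fun u => ?_
  rw [psi, psiNorm]
  ring

/-- For a nondecreasing weight `q`, integration by parts of `u^κ e^(-su/2)` bounds the integral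
with exponent `κ - 1` by the one with exponent `κ`: the derivative of `u^κ e^(-su/2)` changes sign
once, from positive to negative. -/
lemma lintegral_rpow_sub_one_mul_exp_le {κ η B s : ℝ} (hκ : 0 < κ) (hη : 0 < η) (hs : 0 ≤ s)
    {q : ℝ → ℝ} (hq : MonotoneOn q (Ioo 0 η)) (hq0 : ∀ u ∈ Ioo 0 η, 0 ≤ q u)
    (hqB : ∀ u ∈ Ioo 0 η, q u ≤ B) :
    ∫⁻ u in Ioo 0 η, ENNReal.ofReal (u ^ (κ - 1) * Real.exp (-(s * u / 2)) * q u) ≤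
      ENNReal.ofReal (s / (2 * κ)) *
        (∫⁻ u in Ioo 0 η, ENNReal.ofReal (u ^ κ * Real.exp (-(s * u / 2)) * q u)) +
      ENNReal.ofReal (B * η ^ κ / κ * Real.exp (-(s * η / 2))) := by
  have hB0 : 0 ≤ B := (hq0 (η / 2) ⟨by positivity, by linarith⟩).trans
    (hqB (η / 2) ⟨by positivity, by linarith⟩)
  set F' : ℝ → ℝ := fun u => (κ * u ^ (κ - 1) - s / 2 * u ^ κ) * Real.exp (-(s * u / 2)) with hF'
  have hqm : AEStronglyMeasurable q (volume.restrict (Ioo 0 η)) :=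
    (aemeasurable_restrict_of_monotoneOn measurableSet_Ioo hq).aestronglyMeasurable
  have hbase : IntegrableOn (fun u : ℝ => u ^ (κ - 1)) (Ioo 0 η) := by
    rw [← integrableOn_Ioc_iff_integrableOn_Ioo,
      ← intervalIntegrable_iff_integrableOn_Ioc_of_le hη.le]
    exact intervalIntegral.intervalIntegrable_rpow' (by linarith)
  have hpow : ∀ u : ℝ, 0 < u → u ^ κ = u * u ^ (κ - 1) := fun u hu => by
    rw [Real.rpow_sub_one hu.ne']; field_simp
  have hexp : ∀ u : ℝ, 0 < u → Real.exp (-(s * u / 2)) ≤ 1 := fun u hu =>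
    Real.exp_le_one_iff.2 (by rw [neg_nonpos]; positivity)
  have h1 : IntegrableOn (fun u => u ^ (κ - 1) * Real.exp (-(s * u / 2)) * q u) (Ioo 0 η) := by
    refine (hbase.mul_const B).mono' ((by fun_prop : Measurable fun u : ℝ =>
      u ^ (κ - 1) * Real.exp (-(s * u / 2))).aestronglyMeasurable.mul hqm) ?_
    filter_upwards [ae_restrict_mem measurableSet_Ioo] with u hu
    have hu0 : 0 < u := hu.1
    rw [Real.norm_of_nonneg (mul_nonneg (by positivity) (hq0 u hu))]
    calc _ ≤ u ^ (κ - 1) * 1 * B := by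
          gcongr
          · exact hq0 u hu
          · exact hexp u hu0
          · exact hqB u hu
      _ = _ := by ring
  have h2 : IntegrableOn (fun u => u ^ κ * Real.exp (-(s * u / 2)) * q u) (Ioo 0 η) := by
    refine (hbase.mul_const (η * B)).mono' ((by fun_prop : Measurable fun u : ℝ =>
      u ^ κ * Real.exp (-(s * u / 2))).aestronglyMeasurable.mul hqm) ?_
    filter_upwards [ae_restrict_mem measurableSet_Ioo] with u hu
    have hu0 : 0 < u := hu.1
    rw [Real.norm_of_nonneg (mul_nonneg (by positivity) (hq0 u hu)), hpow u hu0]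
    calc _ ≤ η * u ^ (κ - 1) * 1 * B := by
          gcongr
          · exact hq0 u hu
          · exact hu.2.le
          · exact hexp u hu0
          · exact hqB u hu
      _ = _ := by ring
  have h3 : IntegrableOn F' (Ioo 0 η) := by
    refine (hbase.mul_const (κ + s / 2 * η)).mono'
      (by fun_prop : Measurable F').aestronglyMeasurable ?_
    filter_upwards [ae_restrict_mem measurableSet_Ioo] with u hu
    have hu0 : 0 < u := hu.1
    rw [hF', norm_mul, Real.norm_of_nonneg (Real.exp_pos _).le]
    have ha : ‖κ * u ^ (κ - 1) - s / 2 * u ^ κ‖ ≤ u ^ (κ - 1) * (κ + s / 2 * η) := by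
      rw [hpow u hu0, show κ * u ^ (κ - 1) - s / 2 * (u * u ^ (κ - 1)) =
        u ^ (κ - 1) * (κ - s / 2 * u) by ring, norm_mul, Real.norm_of_nonneg (by positivity)]
      gcongr
      rw [Real.norm_eq_abs, abs_le]
      have : s / 2 * u ≤ s / 2 * η := by gcongr; exact hu.2.le
      have : 0 ≤ s / 2 * u := by positivity
      constructor <;> nlinarith
    calc _ ≤ u ^ (κ - 1) * (κ + s / 2 * η) * 1 := by
          gcongr
          exact hexp u hu0
      _ = _ := mul_one _
  have hFTC : ∫ u in Ioo 0 η, F' u = η ^ κ * Real.exp (-(s * η / 2)) := by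
    rw [← integral_Ioc_eq_integral_Ioo, ← intervalIntegral.integral_of_le hη.le]
    have := intervalIntegral.integral_eq_sub_of_hasDerivAt_of_le hη.le
      (f := fun u : ℝ => u ^ κ * Real.exp (-(s * u / 2))) (f' := F')
      ((Real.continuous_rpow_const hκ.le).mul (by fun_prop)).continuousOn
      (fun u hu => by
        have hd1 := Real.hasDerivAt_rpow_const (x := u) (p := κ) (Or.inl hu.1.ne')
        have hd2 : HasDerivAt (fun u : ℝ => -(s * u / 2)) (-(s / 2)) u := by
          have := (((hasDerivAt_id u).const_mul s).div_const 2).fun_neg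
          simpa using this
        have hF'u : F' u = κ * u ^ (κ - 1) * Real.exp (-(s * u / 2)) +
            u ^ κ * (Real.exp (-(s * u / 2)) * -(s / 2)) := by
          simp only [hF']
          ring
        rw [hF'u]
        exact hd1.fun_mul hd2.exp)
      ((intervalIntegrable_iff_integrableOn_Ioo_of_le hη.le).2 h3)
    rw [this, Real.zero_rpow hκ.ne']
    ring
  -- `Q` is the value of `q` at the maximum `2κ/s` of `u^κ e^(-su/2)`, or the bound `B` if that
  -- maximum is not in `(0, η)`
  obtain ⟨Q, hQB, hQ⟩ : ∃ Q : ℝ, Q ≤ B ∧ ∀ u ∈ Ioo 0 η, F' u * q u ≤ F' u * Q := by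
    have hF'eq : ∀ u : ℝ, 0 < u →
        F' u = (κ - s / 2 * u) * (u ^ (κ - 1) * Real.exp (-(s * u / 2))) := by
      intro u hu
      simp only [hF']
      rw [hpow u hu]
      ring
    by_cases hcase : η * s ≤ 2 * κ
    · refine ⟨B, le_rfl, fun u hu => mul_le_mul_of_nonneg_left (hqB u hu) ?_⟩
      have hu0 : 0 < u := hu.1
      rw [hF'eq u hu0]
      have : s / 2 * u ≤ s / 2 * η := by gcongr; exact hu.2.le
      exact mul_nonneg (by linarith) (by positivity)
    · have hs0 : 0 < s := by
        rcases hs.eq_or_lt with h | h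
        · rw [← h] at hcase; simp at hcase; linarith
        · exact h
      have hu₀ : 2 * κ / s ∈ Ioo 0 η :=
        ⟨by positivity, by rw [div_lt_iff₀ hs0]; linarith [not_le.1 hcase]⟩
      refine ⟨q (2 * κ / s), hqB _ hu₀, fun u hu => ?_⟩
      have hu0 : 0 < u := hu.1
      rw [hF'eq u hu0]
      have hw : 0 ≤ u ^ (κ - 1) * Real.exp (-(s * u / 2)) := by positivity
      rcases le_total u (2 * κ / s) with hle | hle
      · have h5 : u * s ≤ 2 * κ := (le_div_iff₀ hs0).1 hle
        exact mul_le_mul_of_nonneg_left (hq hu hu₀ hle) (mul_nonneg (by linarith) hw)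
      · have h5 : 2 * κ ≤ u * s := (div_le_iff₀ hs0).1 hle
        exact mul_le_mul_of_nonpos_left (hq hu₀ hu hle)
          (mul_nonpos_of_nonpos_of_nonneg (by linarith) hw)
  have hreal : ∫ u in Ioo 0 η, u ^ (κ - 1) * Real.exp (-(s * u / 2)) * q u ≤
      s / (2 * κ) * (∫ u in Ioo 0 η, u ^ κ * Real.exp (-(s * u / 2)) * q u) +
      B * η ^ κ / κ * Real.exp (-(s * η / 2)) := by
    calc ∫ u in Ioo 0 η, u ^ (κ - 1) * Real.exp (-(s * u / 2)) * q u
        ≤ ∫ u in Ioo 0 η, (s / (2 * κ) * (u ^ κ * Real.exp (-(s * u / 2)) * q u) +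
            F' u * (Q / κ)) := by
          refine setIntegral_mono_on h1 ((h2.const_mul _).add (h3.mul_const _)) measurableSet_Ioo
            fun u hu => ?_
          have h6 := hQ u hu
          have h7 : κ * (u ^ (κ - 1) * Real.exp (-(s * u / 2)) * q u) =
              s / 2 * (u ^ κ * Real.exp (-(s * u / 2)) * q u) + F' u * q u := by
            simp only [hF']; ring
          refine le_of_mul_le_mul_left ?_ hκ
          calc _ ≤ s / 2 * (u ^ κ * Real.exp (-(s * u / 2)) * q u) + F' u * Q := by linarith
            _ = _ := by field_simp
      _ = s / (2 * κ) * (∫ u in Ioo 0 η, u ^ κ * Real.exp (-(s * u / 2)) * q u) +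
            η ^ κ * Real.exp (-(s * η / 2)) * (Q / κ) := by
          rw [integral_add (h2.const_mul _) (h3.mul_const _), integral_const_mul,
            integral_mul_const, hFTC]
      _ ≤ s / (2 * κ) * (∫ u in Ioo 0 η, u ^ κ * Real.exp (-(s * u / 2)) * q u) +
            η ^ κ * Real.exp (-(s * η / 2)) * (B / κ) := by gcongr
      _ = _ := by ring
  have hn1 : 0 ≤ᵐ[volume.restrict (Ioo 0 η)]
      fun u => u ^ (κ - 1) * Real.exp (-(s * u / 2)) * q u := by
    filter_upwards [ae_restrict_mem measurableSet_Ioo] with u hu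
    have hu0 : 0 < u := hu.1
    exact mul_nonneg (by positivity) (hq0 u hu)
  have hn2 : 0 ≤ᵐ[volume.restrict (Ioo 0 η)]
      fun u => u ^ κ * Real.exp (-(s * u / 2)) * q u := by
    filter_upwards [ae_restrict_mem measurableSet_Ioo] with u hu
    have hu0 : 0 < u := hu.1
    exact mul_nonneg (by positivity) (hq0 u hu)
  rw [← ofReal_integral_eq_lintegral_ofReal h1 hn1, ← ofReal_integral_eq_lintegral_ofReal h2 hn2,
    ← ENNReal.ofReal_mul (by positivity), ← ENNReal.ofReal_add
      (mul_nonneg (by positivity) (integral_nonneg_of_ae hn2)) (by positivity)]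
  exact ENNReal.ofReal_le_ofReal hreal

/-- If `h` is, up to a factor `r`, equal to `u^c` times a nondecreasing function near the origin,
then `∫ u^(d/2 - 1) e^(-su/2) h ≤ (r s / (d + 2c) + L) ∫ u^(d/2) e^(-su/2) h`. -/
lemma exists_psiInvMoment_le (hh : IsMixingDensity h) (hM : ConditionM d h) {c η B r : ℝ}
    (hc : 0 < c) (hη : 0 < η) (hr : 0 ≤ r) {q : ℝ → ℝ} (hq : MonotoneOn q (Ioo 0 η))
    (hq0 : ∀ u ∈ Ioo 0 η, 0 < q u) (hqB : ∀ u ∈ Ioo 0 η, q u ≤ B)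
    (hlow : ∀ u ∈ Ioo 0 η, q u * u ^ c ≤ h u) (hup : ∀ u ∈ Ioo 0 η, h u ≤ r * (q u * u ^ c)) :
    ∃ L : ℝ, 0 ≤ L ∧ ∀ s : ℝ, 0 ≤ s →
      psiInvMoment d h s ≤ ENNReal.ofReal (r / (d + 2 * c) * s + L) * psiNorm d h s := by
  have hhm := hh.measurable
  set κ : ℝ := d / 2 + c with hκdef
  have hκ : 0 < κ := by positivity
  have hB0 : 0 < B := (hq0 (η / 2) ⟨by positivity, by linarith⟩).trans_le
    (hqB (η / 2) ⟨by positivity, by linarith⟩)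
  set D₀ : ℝ≥0∞ := ∫⁻ u in Ioo 0 η, ENNReal.ofReal (u ^ ((d : ℝ) / 2) * h u) with hD₀
  have hD₀fin : D₀ < ∞ := (lintegral_mono_set Ioo_subset_Ioi_self).trans_lt hM
  have hhpos : ∀ u ∈ Ioo 0 η, 0 < h u := fun u hu =>
    (mul_pos (hq0 u hu) (Real.rpow_pos_of_pos hu.1 _)).trans_le (hlow u hu)
  have hD₀pos : 0 < D₀ := by
    rw [hD₀, setLIntegral_pos_iff (by fun_prop)]
    have : (Function.support fun u => ENNReal.ofReal (u ^ ((d : ℝ) / 2) * h u)) ∩ Ioo 0 η =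
        Ioo 0 η := by
      refine inter_eq_right.2 fun u hu => ?_
      have := mul_pos (Real.rpow_pos_of_pos hu.1 ((d : ℝ) / 2)) (hhpos u hu)
      simpa [Function.mem_support] using this
    rw [this, Real.volume_Ioo, ENNReal.ofReal_pos]
    linarith
  set E : ℝ := r * (B * η ^ κ / κ) * D₀.toReal⁻¹ with hE
  have hE0 : 0 ≤ E := by positivity
  refine ⟨η⁻¹ + E, by positivity, fun s hs => ?_⟩
  set f : ℝ → ℝ≥0∞ := fun u =>
    ENNReal.ofReal (u ^ ((d : ℝ) / 2) * Real.exp (-(s * u / 2)) * h u) with hf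
  have hsplit : psiInvMoment d h s ≤ (∫⁻ u in Ioo 0 η, ENNReal.ofReal u⁻¹ * f u) +
      ENNReal.ofReal η⁻¹ * psiNorm d h s := by
    rw [psiInvMoment, psiNorm, ← lintegral_const_mul _ (by fun_prop), ← Ioo_union_Ici_eq_Ioi hη]
    refine (lintegral_union_le _ _ _).trans ?_
    -- away from the origin `u⁻¹ ≤ η⁻¹`
    refine add_le_add le_rfl ?_
    calc _ ≤ ∫⁻ u in Ici η, ENNReal.ofReal η⁻¹ * f u := by
          refine setLIntegral_mono' measurableSet_Ici fun u hu => ?_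
          have hu : η ≤ u := hu
          gcongr
      _ ≤ _ := lintegral_mono_set (subset_union_right)
  have hnear : ∫⁻ u in Ioo 0 η, ENNReal.ofReal u⁻¹ * f u ≤
      ENNReal.ofReal r *
        ∫⁻ u in Ioo 0 η, ENNReal.ofReal (u ^ (κ - 1) * Real.exp (-(s * u / 2)) * q u) := by
    rw [← lintegral_const_mul' _ _ ENNReal.ofReal_ne_top]
    refine setLIntegral_mono' measurableSet_Ioo fun u hu => ?_
    have hu0 : 0 < u := hu.1
    rw [hf, ← ENNReal.ofReal_mul (by positivity), ← ENNReal.ofReal_mul hr]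
    refine ENNReal.ofReal_le_ofReal ?_
    calc _ ≤ u⁻¹ * (u ^ ((d : ℝ) / 2) * Real.exp (-(s * u / 2)) * (r * (q u * u ^ c))) := by
          gcongr; exact hup u hu
      _ = _ := by
          rw [hκdef, Real.rpow_sub_one hu0.ne', Real.rpow_add hu0]
          field_simp
  have hfar : ∫⁻ u in Ioo 0 η, ENNReal.ofReal (u ^ κ * Real.exp (-(s * u / 2)) * q u) ≤
      psiNorm d h s := by
    refine le_trans (setLIntegral_mono' measurableSet_Ioo fun u hu => ?_)
      (lintegral_mono_set Ioo_subset_Ioi_self)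
    have hu0 : 0 < u := hu.1
    refine ENNReal.ofReal_le_ofReal ?_
    calc _ = u ^ ((d : ℝ) / 2) * Real.exp (-(s * u / 2)) * (q u * u ^ c) := by
          rw [hκdef, Real.rpow_add hu0]; ring
      _ ≤ _ := by gcongr; exact hlow u hu
  have hexp : ENNReal.ofReal (Real.exp (-(s * η / 2))) * D₀ ≤ psiNorm d h s := by
    rw [hD₀, ← lintegral_const_mul' _ _ ENNReal.ofReal_ne_top]
    refine le_trans (setLIntegral_mono' measurableSet_Ioo fun u hu => ?_)
      (lintegral_mono_set Ioo_subset_Ioi_self)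
    have hu0 : 0 < u := hu.1
    rw [← ENNReal.ofReal_mul (Real.exp_pos _).le]
    refine ENNReal.ofReal_le_ofReal ?_
    have h0 := (hhpos u hu).le
    calc _ = u ^ ((d : ℝ) / 2) * Real.exp (-(s * η / 2)) * h u := by ring
      _ ≤ _ := by
        gcongr
        exact hu.2.le
  have hexp' : ENNReal.ofReal (r * (B * η ^ κ / κ * Real.exp (-(s * η / 2)))) ≤
      ENNReal.ofReal E * psiNorm d h s := by
    calc ENNReal.ofReal (r * (B * η ^ κ / κ * Real.exp (-(s * η / 2))))
        = ENNReal.ofReal E * (ENNReal.ofReal (Real.exp (-(s * η / 2))) * D₀) := by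
          have hD₀' := ENNReal.toReal_pos hD₀pos.ne' hD₀fin.ne
          conv_rhs => rw [← ENNReal.ofReal_toReal hD₀fin.ne]
          rw [← ENNReal.ofReal_mul (Real.exp_pos _).le, ← ENNReal.ofReal_mul hE0]
          congr 1
          rw [hE]
          field_simp
      _ ≤ _ := by gcongr
  have hcore := lintegral_rpow_sub_one_mul_exp_le hκ hη hs hq (fun u hu => (hq0 u hu).le) hqB
  calc psiInvMoment d h s
      ≤ ENNReal.ofReal r * (ENNReal.ofReal (s / (2 * κ)) * psiNorm d h s +
          ENNReal.ofReal (B * η ^ κ / κ * Real.exp (-(s * η / 2)))) +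
          ENNReal.ofReal η⁻¹ * psiNorm d h s := by
        refine hsplit.trans ?_
        gcongr
        refine hnear.trans ?_
        gcongr
        refine hcore.trans ?_
        gcongr
    _ ≤ ENNReal.ofReal (r * (s / (2 * κ))) * psiNorm d h s + ENNReal.ofReal E * psiNorm d h s +
          ENNReal.ofReal η⁻¹ * psiNorm d h s := by
        rw [mul_add, ← mul_assoc, ← ENNReal.ofReal_mul hr, ← ENNReal.ofReal_mul hr]
        gcongr
    _ = _ := by
        rw [← add_mul, ← add_mul, ← ENNReal.ofReal_add (by positivity) hE0,
          ← ENNReal.ofReal_add (by positivity) (by positivity)]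
        congr 2
        rw [hκdef]
        field_simp
        ring

/-- Each of the three conditions at the origin bounds the conditional mean of `1 / z`, given the
residual form `s`, by an affine function of `s` with slope below `1 / K`. -/
lemma exists_psiInvMoment_le_of_origin (hh : IsMixingDensity h) (hM : ConditionM d h) {K : ℝ}
    (hK : (d : ℝ) ≤ K) (hK0 : 0 < K)
    (horigin : ZeroNearOrigin h ∨ FasterThanPolynomialNearOrigin h ∨
      ∃ c : ℝ, (K - d) / 2 < c ∧ PolynomialNearOrigin h c) :
    ∃ b L : ℝ, 0 ≤ b ∧ 0 ≤ L ∧ K * b < 1 ∧ ∀ s : ℝ, 0 ≤ s →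
      psiInvMoment d h s ≤ ENNReal.ofReal (b * s + L) * psiNorm d h s := by
  have hhm := hh.measurable
  rcases horigin with ⟨δ, hδ, hzero⟩ | ⟨⟨δ, hδ, hpos⟩, hfast⟩ |
    ⟨c, hcK, ⟨δ, hδ, hpos⟩, -, l, hl, hlim⟩
  · refine ⟨0, δ⁻¹, le_rfl, by positivity, by simp, fun s hs => ?_⟩
    rw [zero_mul, zero_add, psiInvMoment, psiNorm, ← lintegral_const_mul _ (by fun_prop)]
    refine setLIntegral_mono' measurableSet_Ioi fun u hu => ?_
    have hu : 0 < u := hu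
    by_cases huδ : u < δ
    · simp [hzero u ⟨hu, huδ⟩]
    · gcongr
      exact not_lt.1 huδ
  · -- any exponent above `(K - d) / 2` would do, for instance `K`
    have hc : 0 < K := hK0
    obtain ⟨η₁, hη₁, hmono⟩ := hfast K hc
    set η := min η₁ δ / 2 with hη
    have hmin : 0 < min η₁ δ := lt_min hη₁ hδ
    have hη0 : 0 < η := by positivity
    have hηη₁ : η < η₁ := by have := min_le_left η₁ δ; linarith
    have hηδ : η < δ := by have := min_le_right η₁ δ; linarith
    obtain ⟨L, hL, hb⟩ := exists_psiInvMoment_le (r := 1) (η := η) (B := h η / η ^ K)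
      (q := fun u => h u / u ^ K) hh hM hc hη0 zero_le_one
      (fun u hu v hv huv => hmono.monotoneOn ⟨hu.1, hu.2.trans hηη₁⟩ ⟨hv.1, hv.2.trans hηη₁⟩ huv)
      (fun u hu => div_pos (hpos u ⟨hu.1, hu.2.trans hηδ⟩) (Real.rpow_pos_of_pos hu.1 _))
      (fun u hu => hmono.monotoneOn ⟨hu.1, hu.2.trans hηη₁⟩ ⟨hη0, hηη₁⟩ hu.2.le)
      (fun u hu => (div_mul_cancel₀ _ (Real.rpow_pos_of_pos hu.1 _).ne').le)
      (fun u hu => by rw [one_mul, div_mul_cancel₀ _ (Real.rpow_pos_of_pos hu.1 _).ne'])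
    refine ⟨1 / (d + 2 * K), L, by positivity, hL, ?_, hb⟩
    rw [mul_one_div, div_lt_one (by positivity)]
    have : (0 : ℝ) ≤ d := by positivity
    linarith
  · have hc : 0 < c := by linarith
    have hd0 : (0 : ℝ) ≤ d := by positivity
    -- near the origin `h u / u ^ c` stays within a factor `r` of a constant; the slope is then
    -- `r / (d + 2c)`, and `1 < r < (d + 2c) / K`
    set r : ℝ := (1 + (d + 2 * c) / K) / 2 with hr
    have hρ : 1 < (d + 2 * c) / K := by rw [one_lt_div hK0]; linarith
    have hr1 : 1 < r := by rw [hr]; linarith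
    have hrρ : r < (d + 2 * c) / K := by rw [hr]; linarith
    have hα : l * (2 / (1 + r)) < l := by
      refine mul_lt_of_lt_one_right hl ?_
      rw [div_lt_one (by linarith)]; linarith
    have hβ : l < r * (l * (2 / (1 + r))) := by
      rw [show r * (l * (2 / (1 + r))) = l * (2 * r / (1 + r)) by ring]
      refine lt_mul_of_one_lt_right hl ?_
      rw [one_lt_div (by linarith)]; linarith
    have hev := (hlim.eventually_const_lt hα).and (hlim.eventually_lt_const hβ)
    rw [eventually_nhdsWithin_iff, Metric.eventually_nhds_iff] at hev
    obtain ⟨η, hη, hball⟩ := hev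
    have hbd : ∀ u ∈ Ioo 0 η, l * (2 / (1 + r)) < h u / u ^ c ∧
        h u / u ^ c < r * (l * (2 / (1 + r))) := fun u hu =>
      hball (by rw [Real.dist_eq, sub_zero, abs_of_pos hu.1]; exact hu.2) hu.1
    obtain ⟨L, hL, hb⟩ := exists_psiInvMoment_le (r := r) (η := η) (B := l * (2 / (1 + r)))
      (q := fun _ => l * (2 / (1 + r))) hh hM hc hη (by linarith)
      (fun u hu v hv huv => le_rfl) (fun u hu => by positivity) (fun u hu => le_rfl)
      (fun u hu => ((lt_div_iff₀ (Real.rpow_pos_of_pos hu.1 _)).1 (hbd u hu).1).le)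
      (fun u hu => by
        rw [← mul_assoc]
        exact ((div_lt_iff₀ (Real.rpow_pos_of_pos hu.1 _)).1 (hbd u hu).2).le)
    refine ⟨r / (d + 2 * c), L, by positivity, hL, ?_, hb⟩
    rw [lt_div_iff₀ hK0] at hrρ
    rw [← mul_div_assoc, div_lt_one (by positivity)]
    linarith

end Latent

/-! ### Reversibility, one-step means and minorants of the chain -/

section Chain

lemma setOf_forall_pos_eq_pi (n : ℕ) :
    {z : Fin n → ℝ | ∀ i, 0 < z i} = univ.pi fun _ => Ioi (0 : ℝ) := by
  ext z
  simp

lemma latentVolume_eq (n : ℕ) :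
    latentVolume n = Measure.pi fun _ : Fin n => volume.restrict (Ioi (0 : ℝ)) := by
  rw [latentVolume, setOf_forall_pos_eq_pi, ← Measure.restrict_pi_pi]
  rfl

instance (n : ℕ) : SFinite (latentVolume n) := by
  rw [latentVolume_eq]
  infer_instance

lemma ae_latentVolume_pos (n : ℕ) : ∀ᵐ z ∂(latentVolume n), ∀ i, 0 < z i := by
  have hs : MeasurableSet {z : Fin n → ℝ | ∀ i, 0 < z i} := by
    rw [setOf_forall_pos_eq_pi]
    exact MeasurableSet.univ_pi fun _ => measurableSet_Ioi
  exact ae_restrict_mem hs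

lemma psiNorm_anti {d : ℕ} {h : ℝ → ℝ} (hh : IsMixingDensity h) {s t : ℝ} (hst : s ≤ t) :
    psiNorm d h t ≤ psiNorm d h s := by
  refine setLIntegral_mono' measurableSet_Ioi fun u hu => ENNReal.ofReal_le_ofReal ?_
  have hu : 0 < u := hu
  have h0 := hh.nonneg u hu
  gcongr

@[fun_prop]
lemma measurable_psiNorm {d : ℕ} {h : ℝ → ℝ} (hhm : Measurable h) :
    Measurable (psiNorm d h) := by
  unfold psiNorm
  exact Measurable.lintegral_prod_right (by fun_prop)

@[fun_prop]
lemma measurable_psi {d : ℕ} {h : ℝ → ℝ} (hhm : Measurable h) {α : Type*} [MeasurableSpace α]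
    {f g : α → ℝ} (hf : Measurable f) (hg : Measurable g) :
    Measurable fun x => psi d h (f x) (g x) := by
  have h1 : Measurable fun x => (psiNorm d h (f x))⁻¹ :=
    ((measurable_psiNorm hhm).comp hf).inv
  exact h1.mul (by fun_prop)

variable {n p d : ℕ} {a : ℝ} {X : Matrix (Fin n) (Fin p) ℝ} {y : Matrix (Fin n) (Fin d) ℝ}
  {h : ℝ → ℝ}

@[fun_prop]
lemma measurable_latentDensity (hhm : Measurable h) {α : Type*} [MeasurableSpace α]
    {f : α → State p d} {g : α → Fin n → ℝ} (hf : Measurable f) (hg : Measurable g) :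
    Measurable fun x => latentDensity h X y (f x) (g x) := by
  unfold latentDensity
  fun_prop (disch := assumption)

lemma measurable_daStep (hhm : Measurable h) {α : Type*} [MeasurableSpace α]
    {f g : α → State p d} (hf : Measurable f) (hg : Measurable g) :
    Measurable fun x => daStep a h X y (f x) (g x) := by
  unfold daStep
  exact Measurable.lintegral_prod_right (by fun_prop (disch := assumption))

/-- The unnormalized posterior density, up to powers of `2π`: the integrals over the latent
variables are the normalizing constants `psiNorm`. -/
lemma likelihood_mul_prior (hh : IsMixingDensity h) {θ : State p d} (hθ : θ ∈ stateSpace p d) :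
    likelihood h X y θ * prior a θ =
      ENNReal.ofReal ((((2 * Real.pi) ^ ((d : ℝ) / 2))⁻¹) ^ n * θ.2.det ^ (-((n + 2 * a) / 2))) *
        ∏ i, psiNorm d h (residualForm X y θ i) := by
  have hhm := hh.measurable
  have hdet : 0 < θ.2.det := Matrix.PosDef.det_pos hθ
  set C : ℝ := ((2 * Real.pi) ^ ((d : ℝ) / 2))⁻¹ with hC
  have hfac : ∀ i, ∫⁻ u in Ioi (0 : ℝ), ENNReal.ofReal
      (u ^ ((d : ℝ) / 2) / ((2 * Real.pi) ^ ((d : ℝ) / 2) * θ.2.det ^ ((1 : ℝ) / 2)) *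
        Real.exp (-(u / 2) * residualForm X y θ i) * h u) =
      ENNReal.ofReal (C * θ.2.det ^ (-(1 / 2) : ℝ)) * psiNorm d h (residualForm X y θ i) := by
    intro i
    rw [psiNorm, ← lintegral_const_mul' _ _ ENNReal.ofReal_ne_top]
    refine lintegral_congr fun u => ?_
    rw [← ENNReal.ofReal_mul (by positivity)]
    congr 1
    rw [Real.rpow_neg hdet.le, hC,
      show -(u / 2) * residualForm X y θ i = -(residualForm X y θ i * u / 2) by ring]
    field_simp
  rw [likelihood, Finset.prod_congr rfl fun i _ => hfac i, Finset.prod_mul_distrib,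
    Finset.prod_const, Finset.card_univ, Fintype.card_fin, prior, mul_right_comm,
    ← ENNReal.ofReal_pow (by positivity), ← ENNReal.ofReal_mul (by positivity)]
  congr 2
  rw [mul_pow, mul_assoc]
  congr 1
  rw [← Real.rpow_natCast, ← Real.rpow_mul hdet.le, ← Real.rpow_add hdet]
  congr 1
  ring

lemma measurable_likelihood_mul_prior (hhm : Measurable h) :
    Measurable fun θ : State p d => likelihood h X y θ * prior a θ := by
  have h1 : Measurable fun θ : State p d => likelihood h X y θ := by
    unfold likelihood
    exact Finset.measurable_prod _ fun i _ => Measurable.lintegral_prod_right (by fun_prop)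
  have h2 : Measurable fun θ : State p d => prior a θ := by
    unfold prior
    fun_prop
  exact h1.mul h2

lemma lintegral_latentDensity (hh : IsMixingDensity h) (hM : ConditionM d h) {θ : State p d}
    (hθ : θ ∈ stateSpace p d) : ∫⁻ z, latentDensity h X y θ z ∂(latentVolume n) = 1 := by
  have hhm := hh.measurable
  unfold latentDensity
  rw [latentVolume_eq, lintegral_pi_prod _ (fun i => psi d h (residualForm X y θ i))
    fun i => by fun_prop (disch := assumption)]
  exact Finset.prod_eq_one fun i _ => lintegral_psi hh hM (residualForm_nonneg hθ i)

lemma lintegral_inv_mul_latentDensity (hh : IsMixingDensity h) (hM : ConditionM d h)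
    {θ : State p d} (hθ : θ ∈ stateSpace p d) (i : Fin n) :
    ∫⁻ z, ENNReal.ofReal (z i)⁻¹ * latentDensity h X y θ z ∂(latentVolume n) =
      (psiNorm d h (residualForm X y θ i))⁻¹ * psiInvMoment d h (residualForm X y θ i) := by
  have hhm := hh.measurable
  set g : Fin n → ℝ → ℝ≥0∞ := fun j u =>
    (if j = i then ENNReal.ofReal u⁻¹ else 1) * psi d h (residualForm X y θ j) u with hg
  have hgm : ∀ j, Measurable (g j) := fun j => by
    simp only [hg]
    split_ifs <;> fun_prop (disch := assumption)
  have h1 : ∀ z : Fin n → ℝ, ENNReal.ofReal (z i)⁻¹ * latentDensity h X y θ z =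
      ∏ j, g j (z j) := fun z => by
    simp only [hg, latentDensity, Finset.prod_mul_distrib, Finset.prod_ite_eq', Finset.mem_univ,
      if_true]
  simp only [h1]
  rw [latentVolume_eq, lintegral_pi_prod _ g hgm, Finset.prod_eq_single i]
  · simp only [hg, if_true]
    exact lintegral_inv_mul_psi hh _
  · intro j _ hj
    simp only [hg, if_neg hj, one_mul]
    exact lintegral_psi hh hM (residualForm_nonneg hθ j)
  · simp

lemma lintegral_mul_lintegral_paramDensity {g : State p d → ℝ≥0∞} (hg : Measurable g)
    {w : (Fin n → ℝ) → ℝ≥0∞} (hw : Measurable w) :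
    ∫⁻ θ, g θ * (∫⁻ z, paramDensity a X y z θ * w z ∂(latentVolume n)) ∂(stateVolume p d) =
      ∫⁻ z, (∫⁻ θ, g θ * paramDensity a X y z θ ∂(stateVolume p d)) * w z ∂(latentVolume n) := by
  calc _ = ∫⁻ θ, ∫⁻ z, g θ * paramDensity a X y z θ * w z ∂(latentVolume n) ∂(stateVolume p d) := by
        refine lintegral_congr fun θ => ?_
        rw [← lintegral_const_mul _ (by fun_prop)]
        simp only [mul_assoc]
    _ = ∫⁻ z, ∫⁻ θ, g θ * paramDensity a X y z θ * w z ∂(stateVolume p d) ∂(latentVolume n) :=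
        lintegral_lintegral_swap (by unfold Function.uncurry; fun_prop)
    _ = _ := by
        refine lintegral_congr fun z => ?_
        rw [lintegral_mul_const _ (by fun_prop)]

/-- The drift function `∑ rᵢ`. -/
def residualSum (X : Matrix (Fin n) (Fin p) ℝ) (y : Matrix (Fin n) (Fin d) ℝ) (θ : State p d) :
    ℝ≥0 :=
  ∑ i, (residualForm X y θ i).toNNReal

lemma coe_residualSum (θ : State p d) :
    (residualSum X y θ : ℝ≥0∞) = ∑ i, ENNReal.ofReal (residualForm X y θ i) := by
  simp only [residualSum, ENNReal.ofNNReal_finsetSum, ENNReal.ofReal]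

lemma residualForm_le {θ : State p d} {R : ℝ≥0} (hR : residualSum X y θ ≤ R) (i : Fin n) :
    residualForm X y θ i ≤ R :=
  Real.toNNReal_le_iff_le_coe.1 <|
    (Finset.single_le_sum (f := fun i => (residualForm X y θ i).toNNReal) (fun _ _ => zero_le)
      (Finset.mem_univ i)).trans hR

@[fun_prop]
lemma measurable_residualSum : Measurable (residualSum X y : State p d → ℝ≥0) := by
  unfold residualSum
  fun_prop

variable (hm : (d : ℝ) - 1 < (n : ℝ) - p + 2 * a - d - 1)
  (hinj : Function.Injective (Matrix.fromCols X y).mulVec)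

include hm hinj

lemma lintegral_daStep (hh : IsMixingDensity h) (hM : ConditionM d h) {θ₀ : State p d}
    (hθ₀ : θ₀ ∈ stateSpace p d) : ∫⁻ θ, daStep a h X y θ₀ θ ∂(stateVolume p d) = 1 := by
  have hhm := hh.measurable
  have h1 := lintegral_mul_lintegral_paramDensity (a := a) (X := X) (y := y) (g := fun _ => 1)
    measurable_const (w := latentDensity h X y θ₀) (by fun_prop (disch := assumption))
  simp only [one_mul] at h1
  unfold daStep
  rw [h1, ← lintegral_latentDensity (X := X) (y := y) hh hM hθ₀]
  refine lintegral_congr_ae ((ae_latentVolume_pos n).mono fun z hz => ?_)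
  simp only [lintegral_paramDensity hm hinj hz, one_mul]

omit hm in
/-- Reversibility of the chain with respect to the unnormalized posterior density: both sides are
the integral over `z` of the kernels at the two states against a common weight. -/
lemma likelihood_mul_prior_mul_daStep (hh : IsMixingDensity h) (hM : ConditionM d h)
    {θ₀ θ : State p d} (hθ₀ : θ₀ ∈ stateSpace p d) (hθ : θ ∈ stateSpace p d) :
    likelihood h X y θ₀ * prior a θ₀ * daStep a h X y θ₀ θ =
      likelihood h X y θ * prior a θ * daStep a h X y θ θ₀ := by
  have hhm := hh.measurable
  set C : ℝ := (((2 * Real.pi) ^ ((d : ℝ) / 2))⁻¹) ^ n with hC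
  have hC0 : 0 < C := by positivity
  have hjoint : ∀ θ₁ ∈ stateSpace p d, ∀ z : Fin n → ℝ, (∀ i, 0 < z i) →
      likelihood h X y θ₁ * prior a θ₁ * latentDensity h X y θ₁ z =
        ENNReal.ofReal (C * (∏ i, z i ^ ((d : ℝ) / 2) * h (z i)) * paramKernel a X y z θ₁) := by
    intro θ₁ hθ₁ z hz
    have hdet : 0 < θ₁.2.det := Matrix.PosDef.det_pos hθ₁
    have hcancel : ∀ i, psiNorm d h (residualForm X y θ₁ i) *
        psi d h (residualForm X y θ₁ i) (z i) = ENNReal.ofReal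
          (z i ^ ((d : ℝ) / 2) * Real.exp (-(residualForm X y θ₁ i * z i / 2)) * h (z i)) := by
      intro i
      have h1 : psi d h (residualForm X y θ₁ i) (z i) =
        (psiNorm d h (residualForm X y θ₁ i))⁻¹ * ENNReal.ofReal
          (z i ^ ((d : ℝ) / 2) * Real.exp (-(residualForm X y θ₁ i * z i / 2)) * h (z i)) := rfl
      rw [h1, ← mul_assoc, ENNReal.mul_inv_cancel (psiNorm_pos hh _).ne'
        (psiNorm_lt_top hh hM (residualForm_nonneg hθ₁ i)).ne, one_mul]
    rw [likelihood_mul_prior hh hθ₁, latentDensity, mul_assoc, ← Finset.prod_mul_distrib,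
      Finset.prod_congr rfl fun i _ => hcancel i, ← ENNReal.ofReal_prod_of_nonneg fun i _ => ?_,
      ← ENNReal.ofReal_mul (by positivity)]
    · congr 1
      have h2 : Real.exp (-(1 / 2) * ∑ i, z i * residualForm X y θ₁ i) =
          ∏ i, Real.exp (-(residualForm X y θ₁ i * z i / 2)) := by
        rw [← Real.exp_sum, Finset.mul_sum]
        congr 1
        exact Finset.sum_congr rfl fun i _ => by ring
      simp only [paramKernel, h2, Finset.prod_mul_distrib]
      ring
    · have := hz i
      have := hh.nonneg _ this
      positivity
  have hside : ∀ θ₁ ∈ stateSpace p d, ∀ θ₂ ∈ stateSpace p d,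
      likelihood h X y θ₁ * prior a θ₁ * daStep a h X y θ₁ θ₂ = ∫⁻ z,
        ENNReal.ofReal (C * (∏ i, z i ^ ((d : ℝ) / 2) * h (z i)) * paramKernel a X y z θ₁ *
          (paramKernel a X y z θ₂ / paramNorm a X y z)) ∂(latentVolume n) := by
    intro θ₁ hθ₁ θ₂ hθ₂
    have hdet : 0 < θ₁.2.det := Matrix.PosDef.det_pos hθ₁
    rw [daStep, ← lintegral_const_mul _ (by fun_prop (disch := assumption))]
    refine lintegral_congr_ae ((ae_latentVolume_pos n).mono fun z hz => ?_)
    simp only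
    have hW : 0 ≤ ∏ i, z i ^ ((d : ℝ) / 2) * h (z i) := Finset.prod_nonneg fun i _ => by
      have := hz i
      have := hh.nonneg _ this
      positivity
    rw [mul_left_comm, hjoint θ₁ hθ₁ z hz, paramDensity_eq hinj hz hθ₂, mul_comm,
      ← ENNReal.ofReal_mul]
    have : 0 ≤ paramKernel a X y z θ₁ := by
      unfold paramKernel
      positivity
    positivity
  rw [hside θ₀ hθ₀ θ hθ, hside θ hθ θ₀ hθ₀]
  refine lintegral_congr fun z => ?_
  congr 1
  ring

lemma lintegral_likelihood_mul_prior_mul_daStep (hh : IsMixingDensity h) (hM : ConditionM d h)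
    {θ : State p d} (hθ : θ ∈ stateSpace p d) :
    ∫⁻ x, likelihood h X y x * prior a x * daStep a h X y x θ ∂(stateVolume p d) =
      likelihood h X y θ * prior a θ := by
  have hhm := hh.measurable
  calc _ = ∫⁻ x, likelihood h X y θ * prior a θ * daStep a h X y θ x ∂(stateVolume p d) :=
        lintegral_congr_ae ((ae_mem_stateSpace p d).mono fun x hx =>
          likelihood_mul_prior_mul_daStep hinj hh hM hx hθ)
    _ = _ := by
        have hk : Measurable (daStep a h X y θ) :=
          measurable_daStep hhm measurable_const measurable_id
        rw [lintegral_const_mul _ hk,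
          lintegral_daStep hm hinj hh hM hθ, mul_one]

/-- The unnormalized posterior density has finite mass where the drift function is bounded: there
it is at most a multiple of the kernel with all latent variables equal to `1`. -/
lemma setLIntegral_likelihood_mul_prior_lt_top (hh : IsMixingDensity h) (hM : ConditionM d h)
    (R : ℝ≥0) :
    ∫⁻ θ in {θ | residualSum X y θ ≤ R}, likelihood h X y θ * prior a θ ∂(stateVolume p d) < ∞ := by
  have hhm := hh.measurable
  set C : ℝ := (((2 * Real.pi) ^ ((d : ℝ) / 2))⁻¹) ^ n * Real.exp (n * R / 2) with hC
  have hset : MeasurableSet {θ : State p d | residualSum X y θ ≤ R} :=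
    measurableSet_le (by fun_prop) measurable_const
  have hbd : ∀ θ ∈ stateSpace p d, residualSum X y θ ≤ R → likelihood h X y θ * prior a θ ≤
      ENNReal.ofReal C * psiNorm d h 0 ^ n * ENNReal.ofReal (paramKernel a X y (fun _ => 1) θ) := by
    intro θ hθ hR
    have hdet : 0 < θ.2.det := Matrix.PosDef.det_pos hθ
    rw [likelihood_mul_prior hh hθ, mul_right_comm, ← ENNReal.ofReal_mul (by positivity)]
    have h1 : ∑ i, (1 : ℝ) * residualForm X y θ i ≤ n * R := by
      calc _ ≤ ∑ _i : Fin n, (R : ℝ) := Finset.sum_le_sum fun i _ => by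
            rw [one_mul]; exact residualForm_le hR i
        _ = _ := by simp
    refine mul_le_mul' (ENNReal.ofReal_le_ofReal ?_) ?_
    · rw [hC]
      simp only [paramKernel]
      rw [mul_assoc, mul_left_comm (Real.exp _), ← Real.exp_add]
      refine mul_le_mul_of_nonneg_left (le_mul_of_one_le_right (by positivity) ?_) (by positivity)
      rw [Real.one_le_exp_iff]
      linarith
    · calc _ ≤ ∏ _i : Fin n, psiNorm d h 0 := Finset.prod_le_prod' fun i _ =>
            psiNorm_anti hh (residualForm_nonneg hθ i)
        _ = _ := by simp
  calc _ ≤ ∫⁻ θ in {θ | residualSum X y θ ≤ R}, ENNReal.ofReal C * psiNorm d h 0 ^ n *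
          ENNReal.ofReal (paramKernel a X y (fun _ => 1) θ) ∂(stateVolume p d) := by
        refine lintegral_mono_ae ?_
        filter_upwards [ae_restrict_mem hset, ae_restrict_of_ae (ae_mem_stateSpace p d)]
          with θ h1 h2 using hbd θ h2 h1
    _ ≤ ∫⁻ θ, ENNReal.ofReal C * psiNorm d h 0 ^ n *
          ENNReal.ofReal (paramKernel a X y (fun _ => 1) θ) ∂(stateVolume p d) :=
        setLIntegral_le_lintegral _ _
    _ = ENNReal.ofReal C * psiNorm d h 0 ^ n * ENNReal.ofReal (paramNorm a X y fun _ => 1) := by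
        rw [lintegral_const_mul' _ _ (by
          exact ENNReal.mul_ne_top ENNReal.ofReal_ne_top
            (ENNReal.pow_ne_top (psiNorm_lt_top hh hM le_rfl).ne)),
          lintegral_paramKernel hm hinj fun _ => one_pos]
    _ < ∞ := ENNReal.mul_lt_top (ENNReal.mul_lt_top ENNReal.ofReal_lt_top
        (ENNReal.pow_lt_top (psiNorm_lt_top hh hM le_rfl))) ENNReal.ofReal_lt_top

lemma marginal_ne_zero (hh : IsMixingDensity h) : marginal a h X y ≠ 0 := by
  have hhm := hh.measurable
  intro h0
  rw [marginal, lintegral_eq_zero_iff (measurable_likelihood_mul_prior hhm)] at h0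
  have h1 : ∀ᵐ θ ∂(stateVolume p d), paramDensity a X y (fun _ => 1) θ = 0 := by
    filter_upwards [h0, ae_mem_stateSpace p d] with θ hθ0 hθ
    have hdet : 0 < θ.2.det := Matrix.PosDef.det_pos hθ
    rw [likelihood_mul_prior hh hθ] at hθ0
    rcases mul_eq_zero.1 hθ0 with h2 | h2
    · have h3 := ENNReal.ofReal_eq_zero.1 h2
      exact absurd h3 (not_le.2 (by positivity))
    · obtain ⟨i, -, h3⟩ := Finset.prod_eq_zero_iff.1 h2
      exact absurd h3 (psiNorm_pos hh _).ne'
  have h2 := lintegral_paramDensity (z := fun _ => 1) hm hinj fun _ => one_pos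
  rw [lintegral_congr_ae h1] at h2
  simp at h2

/-- The drift condition: the mean of `rᵢ` given `z` is at most `K / zᵢ`, and the mean of `1 / zᵢ`
given the current state is at most `b rᵢ + L`. -/
lemma lintegral_residualSum_mul_daStep_le (hm0 : 0 ≤ (n : ℝ) - p + 2 * a - d - 1)
    (hh : IsMixingDensity h) (hM : ConditionM d h) {K b L : ℝ}
    (hK : (n : ℝ) - p + 2 * a - 1 < K) (hK0 : 0 ≤ K) (hb : 0 ≤ b) (hL : 0 ≤ L)
    (hmom : ∀ s : ℝ, 0 ≤ s → psiInvMoment d h s ≤ ENNReal.ofReal (b * s + L) * psiNorm d h s)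
    {θ₀ : State p d} (hθ₀ : θ₀ ∈ stateSpace p d) :
    ∫⁻ θ, residualSum X y θ * daStep a h X y θ₀ θ ∂(stateVolume p d) ≤
      (K * b).toNNReal * residualSum X y θ₀ + (n * (K * L)).toNNReal := by
  have hhm := hh.measurable
  obtain ⟨t, ht0, ht1, htK⟩ := exists_laplace_parameter hK
  have hstep : ∀ z : Fin n → ℝ, (∀ i, 0 < z i) →
      ∫⁻ θ, residualSum X y θ * paramDensity a X y z θ ∂(stateVolume p d) ≤
        ∑ i, ENNReal.ofReal K * ENNReal.ofReal (z i)⁻¹ := by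
    intro z hz
    simp only [coe_residualSum, Finset.sum_mul]
    rw [lintegral_finsetSum _ fun i _ => by fun_prop]
    refine Finset.sum_le_sum fun i _ => ?_
    refine (lintegral_residualForm_mul_paramDensity_le hm hinj hz hm0 i ht0 ht1).trans ?_
    rw [← ENNReal.ofReal_mul hK0]
    have := hz i
    gcongr
  have hinv : ∀ i, ∫⁻ z, ENNReal.ofReal (z i)⁻¹ * latentDensity h X y θ₀ z ∂(latentVolume n) ≤
      ENNReal.ofReal (b * residualForm X y θ₀ i + L) := by
    intro i
    have hr := residualForm_nonneg (X := X) (y := y) hθ₀ i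
    rw [lintegral_inv_mul_latentDensity hh hM hθ₀]
    calc _ ≤ (psiNorm d h (residualForm X y θ₀ i))⁻¹ *
          (ENNReal.ofReal (b * residualForm X y θ₀ i + L) *
            psiNorm d h (residualForm X y θ₀ i)) := by gcongr; exact hmom _ hr
      _ = _ := by
          rw [mul_left_comm, ENNReal.inv_mul_cancel (psiNorm_pos hh _).ne'
            (psiNorm_lt_top hh hM hr).ne, mul_one]
  unfold daStep
  rw [lintegral_mul_lintegral_paramDensity (by fun_prop) (by fun_prop (disch := assumption))]
  calc _ ≤ ∫⁻ z, (∑ i, ENNReal.ofReal K * ENNReal.ofReal (z i)⁻¹) * latentDensity h X y θ₀ z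
          ∂(latentVolume n) :=
        lintegral_mono_ae ((ae_latentVolume_pos n).mono fun z hz =>
          mul_le_mul_left (hstep z hz) _)
    _ = ∑ i, ENNReal.ofReal K *
          ∫⁻ z, ENNReal.ofReal (z i)⁻¹ * latentDensity h X y θ₀ z ∂(latentVolume n) := by
        simp only [Finset.sum_mul, mul_assoc]
        rw [lintegral_finsetSum _ fun i _ => by fun_prop (disch := assumption)]
        exact Finset.sum_congr rfl fun i _ =>
          lintegral_const_mul _ (by fun_prop (disch := assumption))
    _ ≤ ∑ i, (ENNReal.ofReal (K * b) * ENNReal.ofReal (residualForm X y θ₀ i) +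
          ENNReal.ofReal (K * L)) := by
        refine Finset.sum_le_sum fun i _ => ?_
        have hr := residualForm_nonneg (X := X) (y := y) hθ₀ i
        calc _ ≤ ENNReal.ofReal K * ENNReal.ofReal (b * residualForm X y θ₀ i + L) := by
              gcongr; exact hinv i
          _ = _ := by
              rw [← ENNReal.ofReal_mul hK0, ← ENNReal.ofReal_mul (by positivity),
                ← ENNReal.ofReal_add (by positivity) (by positivity)]
              congr 1
              ring
    _ = _ := by
        rw [Finset.sum_add_distrib, ← Finset.mul_sum, ← coe_residualSum, Finset.sum_const,
          Finset.card_univ, Fintype.card_fin, nsmul_eq_mul, ← ENNReal.ofReal_natCast,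
          ← ENNReal.ofReal_mul (by positivity)]
        rfl

/-- The minorization condition on sublevel sets of the drift function: for `rᵢ ≤ R` the density
of the latent variables dominates a multiple of the product of `u^(d/2) e^(-Ru/2) h(u)`. -/
lemma exists_minorant (hh : IsMixingDensity h) (hM : ConditionM d h) (R : ℝ≥0) :
    ∃ q : State p d → ℝ≥0∞, Measurable q ∧ 0 < ∫⁻ θ, q θ ∂(stateVolume p d) ∧
      ∀ θ₀ ∈ stateSpace p d, residualSum X y θ₀ ≤ R → ∀ θ ∈ stateSpace p d,
        q θ ≤ daStep a h X y θ₀ θ := by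
  have hhm := hh.measurable
  set g : ℝ → ℝ≥0∞ := fun u => (psiNorm d h 0)⁻¹ *
    ENNReal.ofReal (u ^ ((d : ℝ) / 2) * Real.exp (-(R * u / 2)) * h u) with hg
  have hgm : Measurable g := by
    simp only [hg]
    fun_prop
  have hw : Measurable fun z : Fin n → ℝ => ∏ i, g (z i) := by fun_prop
  refine ⟨fun θ => ∫⁻ z, paramDensity a X y z θ * ∏ i, g (z i) ∂(latentVolume n),
    Measurable.lintegral_prod_right (by fun_prop), ?_, ?_⟩
  · have h1 := lintegral_mul_lintegral_paramDensity (a := a) (X := X) (y := y) (g := fun _ => 1)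
      measurable_const hw
    simp only [one_mul] at h1
    rw [h1]
    have h2 : ∫⁻ z, (∫⁻ θ, paramDensity a X y z θ ∂(stateVolume p d)) * ∏ i, g (z i)
        ∂(latentVolume n) = ∏ _i : Fin n, (psiNorm d h 0)⁻¹ * psiNorm d h R := by
      rw [lintegral_congr_ae ((ae_latentVolume_pos n).mono fun z hz => by
        rw [lintegral_paramDensity hm hinj hz, one_mul]), latentVolume_eq,
        lintegral_pi_prod _ (fun _ => g) fun _ => hgm]
      refine Finset.prod_congr rfl fun _ _ => ?_
      simp only [hg]
      rw [lintegral_const_mul _ (by fun_prop)]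
      rfl
    rw [h2, pos_iff_ne_zero, Finset.prod_ne_zero_iff]
    exact fun _ _ => mul_ne_zero (ENNReal.inv_ne_zero.2 (psiNorm_lt_top hh hM le_rfl).ne)
      (psiNorm_pos hh _).ne'
  · intro θ₀ hθ₀ hR θ _
    refine lintegral_mono_ae ((ae_latentVolume_pos n).mono fun z hz => ?_)
    simp only [latentDensity]
    gcongr with i
    have hz0 := hz i
    have h0 := hh.nonneg _ hz0
    have h1 := psiNorm_anti (d := d) hh (residualForm_nonneg (X := X) (y := y) hθ₀ i)
    have h2 := residualForm_le hR i
    simp only [hg]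
    refine mul_le_mul' (ENNReal.inv_le_inv.2 h1) (ENNReal.ofReal_le_ofReal ?_)
    gcongr

end Chain

/-! ### The drift and minorization conditions for the chain -/

section Conclusion

variable {n p d : ℕ} {a : ℝ} {X : Matrix (Fin n) (Fin p) ℝ} {y : Matrix (Fin n) (Fin d) ℝ}
  {h : ℝ → ℝ}

lemma driftMinorization_daStep (hm : (d : ℝ) - 1 < (n : ℝ) - p + 2 * a - d - 1)
    (hm0 : 0 ≤ (n : ℝ) - p + 2 * a - d - 1) (hK₀ : 0 < (n : ℝ) - p + 2 * a - 1)
    (hinj : Function.Injective (Matrix.fromCols X y).mulVec)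
    (hh : IsMixingDensity h) (hM : ConditionM d h)
    (horigin : ZeroNearOrigin h ∨ FasterThanPolynomialNearOrigin h ∨
      ∃ c : ℝ, ((n : ℝ) - p + 2 * a - d - 1) / 2 < c ∧ PolynomialNearOrigin h c) :
    ∃ r L : ℝ≥0, DriftMinorization (stateVolume p d) (stateSpace p d) (daStep a h X y)
      (residualSum X y) r L := by
  obtain ⟨b, L, hb, hL, hKb, hmom⟩ := exists_psiInvMoment_le_of_origin
    (K := (n : ℝ) - p + 2 * a - 1) hh hM (by linarith) hK₀
    (by rwa [show (n : ℝ) - p + 2 * a - 1 - d = (n : ℝ) - p + 2 * a - d - 1 by ring])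
  -- the slope bound is strict, so it survives a slight increase of `K`
  obtain ⟨K, hK, hKb'⟩ : ∃ K : ℝ, (n : ℝ) - p + 2 * a - 1 < K ∧ K * b < 1 := by
    have hev : ∀ᶠ K : ℝ in 𝓝[>] ((n : ℝ) - p + 2 * a - 1), K * b < 1 :=
      ((continuous_id.mul continuous_const).continuousAt.eventually_lt_const
        hKb).filter_mono nhdsWithin_le_nhds
    obtain ⟨K, h1, h2⟩ := (hev.and self_mem_nhdsWithin).exists
    exact ⟨K, h2, h1⟩
  refine ⟨(K * b).toNNReal, (n * (K * L)).toNNReal, measurable_daStep hh.measurable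
    measurable_fst measurable_snd,
    measurable_residualSum, ae_mem_stateSpace p d,
    fun θ hθ => lintegral_daStep hm hinj hh hM hθ, ?_, fun θ hθ => ?_, fun R => ?_⟩
  · rwa [Real.toNNReal_lt_one]
  · exact lintegral_residualSum_mul_daStep_le hm hinj hm0 hh hM hK (hK₀.trans hK).le hb hL hmom hθ
  · exact exists_minorant hm hinj hh hM R

lemma daIter_eq_iterDensity (j : ℕ) (θ₀ θ : State p d) :
    daIter a h X y j θ₀ θ = iterDensity (stateVolume p d) (daStep a h X y) j θ₀ θ := by
  induction j generalizing θ₀ θ with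
  | zero => rfl
  | succ j ih => simp only [daIter, iterDensity, ih]

end Conclusion

end BayesReg

end

theorem theorem1 (n p d : ℕ) (hd : 1 ≤ d) (a : ℝ)
    (X : Matrix (Fin n) (Fin p) ℝ) (y : Matrix (Fin n) (Fin d) ℝ)
    (hN1 : (Matrix.fromCols X y).rank = p + d)
    (hN2 : (n : ℝ) > (p : ℝ) + 2 * (d : ℝ) - 2 * a)
    (h : ℝ → ℝ) (hh : BayesReg.IsMixingDensity h) (hM : BayesReg.ConditionM d h)
    (horigin : BayesReg.ZeroNearOrigin h ∨
      BayesReg.FasterThanPolynomialNearOrigin h ∨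
      ∃ c : ℝ, ((n : ℝ) - p + 2 * a - d - 1) / 2 < c ∧ BayesReg.PolynomialNearOrigin h c) :
    BayesReg.PosteriorProper a h X y ∧ BayesReg.GeometricallyErgodic a h X y := by
  have hd' : (1 : ℝ) ≤ d := by exact_mod_cast hd
  have hm : (d : ℝ) - 1 < (n : ℝ) - p + 2 * a - d - 1 := by linarith
  have hinj := BayesReg.injective_mulVec_fromCols hN1
  obtain ⟨r, L, H⟩ := BayesReg.driftMinorization_daStep hm (by linarith) (by linarith) hinj hh hM
    horigin
  have hf := BayesReg.measurable_likelihood_mul_prior (a := a) (X := X) (y := y) hh.measurable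
  have hinv : ∀ θ ∈ BayesReg.stateSpace p d, _ := fun θ hθ =>
    BayesReg.lintegral_likelihood_mul_prior_mul_daStep hm hinj hh hM hθ
  have hproper : BayesReg.PosteriorProper a h X y := H.lintegral_lt_top_of_invariant hf hinv
    (BayesReg.setLIntegral_likelihood_mul_prior_lt_top hm hinj hh hM)
  have hpos := BayesReg.marginal_ne_zero hm hinj hh
  have hpm : Measurable (BayesReg.posterior a h X y) := hf.div_const _
  have hpinv : ∀ θ ∈ BayesReg.stateSpace p d, ∫⁻ x, BayesReg.posterior a h X y x *
      BayesReg.daStep a h X y x θ ∂(BayesReg.stateVolume p d) = BayesReg.posterior a h X y θ := by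
    intro θ hθ
    simp only [BayesReg.posterior, div_eq_mul_inv]
    rw [← hinv θ hθ, ← lintegral_mul_const' _ _ (ENNReal.inv_ne_top.2 hpos)]
    exact lintegral_congr fun x => by ring
  have hp1 : ∫⁻ x, BayesReg.posterior a h X y x ∂(BayesReg.stateVolume p d) = 1 := by
    simp only [BayesReg.posterior, div_eq_mul_inv]
    rw [lintegral_mul_const' _ _ (ENNReal.inv_ne_top.2 hpos)]
    exact ENNReal.mul_inv_cancel hpos hproper.ne
  obtain ⟨M, ρ, hρ, hbound⟩ := H.exists_geometric_bound hpm hpinv hp1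
  refine ⟨hproper, M, ρ, hρ, fun j θ₀ hθ₀ => ?_⟩
  simp only [BayesReg.l1Dist, BayesReg.daIter_eq_iterDensity]
  exact hbound j θ₀ hθ₀
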